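/- **Domains.** Let $A$ be an infinite set of atoms and let $D$ be the least set that contains $A$ and $(+,*),(-,*)$ and is closed under $(\iota,\alpha,\beta)$ and $(\iota,[\alpha_1,\dots,\alpha_m])$, where $\iota\in\{+,-\}$ and $[\alpha_1,\dots,\alpha_m]$ is a finite multiset. The dual $\alpha^\perp$ is obtained by exchanging all signs, with $\gamma^\perp=\gamma$ for $\gamma\in A$. Let $A'$ be the set of pairs $(\gamma,s)$ of an atom and a finite sequence of integers, with $(\gamma,())$ identified with $\gamma$, and let $D'\supseteq D$ be built from $A'$ as $D$ is from $A$. For a finite sequence $s$, $\mathrm{dig}(s)$ replaces every $(\gamma,t)$ by $(\gamma,ts)$; for a finite multiset $a$ over $D'$ put $\mathrm{dig}^k_d(a)=\sum_{s\in\{1,\dots,k\}^d}\mathrm{dig}(s)\cdot a$. **Linear proof-structures.** A (cut-free) graph $\Phi$ consists of finitely many ports, finitely many cells of types $\otimes,\wp,1,\bot,!,?$, and wires. Distinct cells have disjoint sets of ports; each cell has one principal port and a number of auxiliary ports (two for $\otimes,\wp$, one of which is marked as the left one; none for $1,\bot$; one for $!$; any finite number for $?$), and each auxiliary port $p$ of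 a $?$-cell carries a number $\#(p)\in\mathbb N$. Wires are unordered pairs of distinct ports, pairwise disjoint; every non-principal port is in a wire; a port of no cell is wired to a non-principal port; no wire joins two principal ports. An axiom is a wire between two non-principal ports; a conclusion is a port that is not both in a cell and in a wire. Let $\le$ be the reflexive transitive closure of: the principal port of a cell is below its auxiliary ports, and an auxiliary port is below a principal port wired to it; $\le$ is required to be antisymmetric. An auxiliary door is an auxiliary port $p$ of a $?$-cell with $\#(p)>0$. The depth of $p$ is the number of $!$-cells whose principal port is $<p$ plus $\sum\#(q)$ over the auxiliary doors $q\le p$. $\Phi$ is a linear proof-structure (LPS) if the two ports of every axiom have the same depth. **Proof-structures.** A proof-structure (PS) $R=(\Phi,b)$ is an LPS $\Phi$ with a set $b(v)$ of auxiliary doors for every $!$-cell $v$, such that $\#(p)$ is the number of $v$ with $p\in b(v)$ for every auxiliary door $p$, and the following holds. Call the auxiliary port of $v$ and the elements of $b(v)$ the doors of $v$; let $B_v$ be the set of ports above some door of $v$. Two distinct doors of the same $v$ are never comparable for $\le$; for $!$-cells $v,w$ the sets $B_v,B_w$ are disjoint or one contains the other; and for every $v$ the following structure, the box of $v$, is again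 a PS (inductively): its ports are those of $B_v$, without the auxiliary port of $v$ if this is wired to a principal port, and a new port $p_0$ for every $p\in b(v)$; its cells are the cells with a port in $B_v$, except $v$ and the cells of the ports in $b(v)$, and for every $p\in b(v)$ a new unary $?$-cell with auxiliary port $p$ and principal port $p_0$; its wires are the wires of $\Phi$ between its ports; $\#(p)$ is the number of $!$-cells $w\ne v$ with a port in $B_v$ and $p\in b(w)$; and $b$ is restricted. **Experiments of a PS.** An experiment $e$ of $R$ associates with every port $p$ a finite multiset $e(p)$ over $D$, and with every $!$-cell $v$ whose principal port has depth $0$ a multiset $[e_1,\dots,e_{n_v}]$ ($n_v\ge0$) of experiments of the box of $v$, such that: $e(p)$ is a singleton if $p$ has depth $0$ and is not an auxiliary door; for every axiom $\{p,q\}$ at depth $0$, $e(p)=[\alpha]$ and $e(q)=[\alpha^\perp]$ for some $\alpha\in D$; for every cell with principal port $p$ of depth $0$: $e(p)=[(+,\alpha,\beta)]$ for $\otimes$ and $e(p)=[(-,\alpha,\beta)]$ for $\wp$, where $[\alpha],[\beta]$ are the labels of the left and right auxiliary ports, $e(p)=[(+,*)]$ for $1$, $e(p)=[(-,*)]$ for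 $\bot$, $e(p)=[(-,\sum_q e(q))]$ for $?$, with $q$ ranging over the auxiliary ports; $e(p)=e(q)$ for every wire $\{p,q\}$ that is not an axiom; and for every $!$-cell $v$ with principal port $p$ of depth $0$: $e(p)=[(+,\sum_i e_i(q))]$ with $q\geq p$ the conclusion of the box of $v$ above $p$, and $e(q)=\sum_i e_i(q)$ for every port $q$ of $\Phi$ that is a port of the box of $v$. Let $\mathrm{ind}$ be a bijection from the conclusions of $\Phi$ onto $\{1,\dots,n\}$. The interpretation $[\![(R,\mathrm{ind})]\!]\subseteq D^n$ is the set of the results $(x_1,\dots,x_n)$ of experiments $e$ of $R$, where $e(\mathrm{ind}^{-1}(i))=[x_i]$. **Points.** A point $r\in D^n$ is a $k$-point if every positive multiset $(+,[\alpha_1,\dots,\alpha_m])$ that occurs in $r$ has $m=k$; it is injective if every atom has no or exactly two occurrences in $r$. For $E\subseteq D^n$, a point $r\in E$ is $E$-atomic if, whenever $r'\in E$ and $\sigma:A\to D$ are such that $r$ is obtained from $r'$ by replacing every occurrence of an atom $\gamma$ by $\sigma(\gamma)$ or by $\sigma(\gamma)^\perp$, one has $\sigma(\gamma)\in A$ for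 all atoms $\gamma$ that occur in $r'$. Let $E_{\mathrm{At}}$ be the set of $E$-atomic points. **$k$-experiments of an LPS.** A $k$-experiment of $\Phi$ is a function $e$ from its ports to $D'$ such that for every cell with principal port $p$: $e(p)=(+,e(q),e(q'))$ for $\otimes$, $e(p)=(-,e(q),e(q'))$ for $\wp$ ($q,q'$ the left and right auxiliary ports), $e(p)=(+,*)$ for $1$, $e(p)=(-,*)$ for $\bot$, $e(p)=(+,\mathrm{dig}^k_1([e(q)]))$ for $!$ with auxiliary port $q$, $e(p)=(-,\sum_q\mathrm{dig}^k_{\#(q)}([e(q)]))$ for $?$; $e(p)=e(q)^\perp\in D$ for every axiom $\{p,q\}$; and $e(p)=e(q)$ for every other wire. It is atomic if it labels all axiom ports by elements of $A$, and injective if the labels of two different axioms never have a common element of $A'$. Its result is $r=e\circ\mathrm{ind}^{-1}$. **Statement.** Let $k\in\mathbb N$ and let $R=(\Phi,b)$ be a PS whose conclusions are indexed by $\mathrm{ind}$. Then $$\{r_0\in[\![(R,\mathrm{ind})]\!]_{\mathrm{At}} : r_0\text{ is an injective }k\text{-point}\}=\bigcup_{(e,r)}\{\rho\cdot r : \rho\text{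 a partial injection from }A'\text{ to }A\text{ defined on all atoms of }r\},$$ where $(e,r)$ ranges over the injective atomic $k$-experiments $e$ of $\Phi$ with their results $r$. -/

import Mathlib

universe u v

namespace ProofStr

/-! ## The domains of labels -/

/-- The two polarities `+` and `-`. -/
inductive Pol : Type
  | pos : Pol
  | neg : Pol

/-- `+^⊥ = -` and `-^⊥ = +`. -/
def Pol.perp : Pol → Pol
  | .pos => .neg
  | .neg => .pos

/-- Presentations of the elements of the domain, with lists in place of finite multisets. -/
inductive PreDom (B : Type u) : Type u
  | atom : B → PreDom B
  | unit : Pol → PreDom B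
  | pair : Pol → PreDom B → PreDom B → PreDom B
  | bag : Pol → List (PreDom B) → PreDom B

/-- Two presentations are identified when they differ by reordering the lists that occur in
them. -/
inductive PreDom.Step {B : Type u} : PreDom B → PreDom B → Prop
  | perm {i : Pol} {l l' : List (PreDom B)} :
      l.Perm l' → PreDom.Step (.bag i l) (.bag i l')
  | head {i : Pol} {x y : PreDom B} {l : List (PreDom B)} :
      PreDom.Step x y → PreDom.Step (.bag i (x :: l)) (.bag i (y :: l))
  | fst {i : Pol} {x x' y : PreDom B} :
      PreDom.Step x x' → PreDom.Step (.pair i x y) (.pair i x' y)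
  | snd {i : Pol} {x y y' : PreDom B} :
      PreDom.Step y y' → PreDom.Step (.pair i x y) (.pair i x y')

/-- The domain over a set `B` of atoms: the least set that contains the atoms and the elements
`(ι, *)`, and that is closed under `(ι, α, β)` and under `(ι, [α₁, …, αₘ])` with
`[α₁, …, αₘ]` a finite multiset. -/
def Dom (B : Type u) : Type u := Quot (PreDom.Step (B := B))

namespace Dom

variable {B : Type u} {X : Type v}

/-- The element given by a presentation. -/
def mk (x : PreDom B) : Dom B := Quot.mk _ x

/-- An atom. -/
def atom (a : B) : Dom B := mk (.atom a)

/-- The element `(ι, *)`. -/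
def unit (i : Pol) : Dom B := mk (.unit i)

/-- The element `(ι, α, β)`. -/
def pair (i : Pol) : Dom B → Dom B → Dom B :=
  Quot.map₂ (PreDom.pair i) (fun _ _ _ h => .snd h) (fun _ _ _ h => .fst h)

/-- A chosen presentation. -/
noncomputable def rep (α : Dom B) : PreDom B := Quot.out α

theorem mk_rep (α : Dom B) : mk (rep α) = α := Quot.out_eq α

/-- The element `(ι, m)` for a finite multiset `m` (it does not depend on the choice of the
presentations, see `bag_mk`). -/
noncomputable def bag (i : Pol) (m : Multiset (Dom B)) : Dom B :=
  mk (.bag i (m.toList.map rep))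

/-- Recursion on presentations. -/
noncomputable def preFold (fa : B → X) (fu : Pol → X) (fp : Pol → X → X → X)
    (fb : Pol → Multiset X → X) (x : PreDom B) : X :=
  PreDom.rec (motive_1 := fun _ => X) (motive_2 := fun _ => List X)
    fa fu (fun i _ _ a b => fp i a b) (fun i _ l => fb i (l : Multiset X))
    [] (fun _ _ a l => a :: l) x

theorem preFold_bag (fa : B → X) (fu : Pol → X) (fp : Pol → X → X → X)
    (fb : Pol → Multiset X → X) (i : Pol) (l : List (PreDom B)) :
    preFold fa fu fp fb (.bag i l) =
      fb i ((l.map (preFold fa fu fp fb) : List X) : Multiset X) := by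
  have h : ∀ l : List (PreDom B),
      PreDom.rec_1 (motive_1 := fun _ => X) (motive_2 := fun _ => List X)
        fa fu (fun i _ _ a b => fp i a b) (fun i _ l => fb i (l : Multiset X))
        [] (fun _ _ a l => a :: l) l = l.map (preFold fa fu fp fb) := by
    intro l
    induction l with
    | nil => rfl
    | cons x l ih => simp only [List.map_cons, ← ih]; rfl
  rw [← h]
  rfl

theorem preFold_step (fa : B → X) (fu : Pol → X) (fp : Pol → X → X → X)
    (fb : Pol → Multiset X → X) {x y : PreDom B} (h : PreDom.Step x y) :
    preFold fa fu fp fb x = preFold fa fu fp fb y := by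
  induction h with
  | perm h =>
    rw [preFold_bag, preFold_bag]
    congr 1
    exact Multiset.coe_eq_coe.2 (h.map _)
  | head _ ih => rw [preFold_bag, preFold_bag, List.map_cons, List.map_cons, ih]
  | fst _ ih => exact congrArg (fun z => fp _ z _) ih
  | snd _ ih => exact congrArg (fun z => fp _ _ z) ih

/-- Definition by recursion on the elements of the domain. -/
noncomputable def fold (fa : B → X) (fu : Pol → X) (fp : Pol → X → X → X)
    (fb : Pol → Multiset X → X) : Dom B → X :=
  Quot.lift (preFold fa fu fp fb) (fun _ _ h => preFold_step fa fu fp fb h)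

theorem fold_atom (fa : B → X) (fu : Pol → X) (fp : Pol → X → X → X)
    (fb : Pol → Multiset X → X) (a : B) : fold fa fu fp fb (atom a) = fa a := rfl

theorem fold_unit (fa : B → X) (fu : Pol → X) (fp : Pol → X → X → X)
    (fb : Pol → Multiset X → X) (i : Pol) : fold fa fu fp fb (unit i) = fu i := rfl

theorem fold_pair (fa : B → X) (fu : Pol → X) (fp : Pol → X → X → X)
    (fb : Pol → Multiset X → X) (i : Pol) (α β : Dom B) :
    fold fa fu fp fb (pair i α β) = fp i (fold fa fu fp fb α) (fold fa fu fp fb β) := by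
  induction α using Quot.ind
  induction β using Quot.ind
  rfl

theorem fold_bag (fa : B → X) (fu : Pol → X) (fp : Pol → X → X → X)
    (fb : Pol → Multiset X → X) (i : Pol) (m : Multiset (Dom B)) :
    fold fa fu fp fb (bag i m) = fb i (m.map (fold fa fu fp fb)) := by
  have h1 : fold fa fu fp fb (bag i m) =
      fb i (((m.toList.map rep).map (preFold fa fu fp fb) : List X) : Multiset X) :=
    preFold_bag fa fu fp fb i _
  have h2 : preFold fa fu fp fb ∘ rep = fold fa fu fp fb := by
    funext α
    conv_rhs => rw [← mk_rep α]
    rfl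
  rw [h1, List.map_map, h2, ← Multiset.map_coe, Multiset.coe_toList]

theorem mk_bag_congr (i : Pol) {l l' : List (PreDom B)} (h : l.map mk = l'.map mk)
    (t : List (PreDom B)) : mk (.bag i (l ++ t)) = mk (.bag i (l' ++ t)) := by
  have hhead : ∀ (x y : PreDom B) (t : List (PreDom B)), mk x = mk y →
      mk (.bag i (x :: t)) = mk (.bag i (y :: t)) := by
    intro x y t hxy
    induction Quot.eqvGen_exact hxy with
    | rel _ _ h => exact Quot.sound (.head h)
    | refl _ => rfl
    | symm _ _ h ih => exact (ih (Quot.eqvGen_sound h)).symm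
    | trans _ _ _ h h' ih ih' =>
      exact (ih (Quot.eqvGen_sound h)).trans (ih' (Quot.eqvGen_sound h'))
  induction l generalizing l' t with
  | nil =>
    cases l' with
    | nil => rfl
    | cons y l' => simp at h
  | cons x l ih =>
    cases l' with
    | nil => simp at h
    | cons y l' =>
      simp only [List.map_cons, List.cons.injEq] at h
      have hp : ∀ (z : PreDom B) (u : List (PreDom B)),
          mk (.bag i (z :: u ++ t)) = mk (.bag i (u ++ (z :: t))) := fun z u =>
        Quot.sound (.perm List.perm_middle.symm)
      rw [List.cons_append, hhead x y _ h.1, ← List.cons_append, hp, hp]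
      exact ih h.2 _

theorem bag_mk (i : Pol) (l : List (PreDom B)) :
    bag i ((l.map mk : List (Dom B)) : Multiset (Dom B)) = mk (.bag i l) := by
  have h : (((l.map mk : List (Dom B)) : Multiset (Dom B)).toList).Perm (l.map mk) :=
    Multiset.coe_eq_coe.1 (Multiset.coe_toList _)
  have h1 : (((l.map mk : List (Dom B)) : Multiset (Dom B)).toList.map rep).Perm
      ((l.map mk).map rep) := h.map rep
  have h2 : mk (.bag i ((l.map mk).map rep)) = mk (.bag i l) := by
    have := mk_bag_congr i (l := (l.map mk).map rep) (l' := l)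
      (by simp [Function.comp_def, mk_rep]) []
    simpa using this
  exact (Quot.sound (.perm h1)).trans h2

/-- Renaming of atoms. -/
noncomputable def map {C : Type v} (f : B → C) : Dom B → Dom C :=
  fold (fun a => atom (f a)) unit pair bag

/-- The orthogonal `α^⊥`: all polarities are exchanged, atoms are left unchanged. -/
noncomputable def perp : Dom B → Dom B :=
  fold atom (fun i => unit i.perp) (fun i => pair i.perp) (fun i => bag i.perp)

/-- Auxiliary recursion for `sub`: an element together with the multiset of its occurrences of
subelements. -/
noncomputable def selfSub : Dom B → Dom B × Multiset (Dom B) :=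
  fold (fun a => (atom a, {atom a})) (fun i => (unit i, {unit i}))
    (fun i x y => (pair i x.1 y.1, {pair i x.1 y.1} + x.2 + y.2))
    (fun i m => (bag i (m.map Prod.fst), {bag i (m.map Prod.fst)} + (m.map Prod.snd).sum))

/-- The multiset `Sub(α)` of occurrences of subelements of `α`. -/
noncomputable def sub (α : Dom B) : Multiset (Dom B) := (selfSub α).2

/-- The set of atoms of `α`. -/
def atoms (α : Dom B) : Set B := {a | atom a ∈ sub α}

/-- `Inst s α β`: the element `β` is obtained from `α` by replacing every occurrence of an atom
`γ` by `s γ` or by `(s γ)^⊥` (atoms carry no polarity, so that an occurrence of `γ` stands for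
`γ` or for `γ^⊥`). -/
inductive Inst {B : Type u} (s : B → Dom B) : Dom B → Dom B → Prop
  | same (c : B) : Inst s (atom c) (s c)
  | dual (c : B) : Inst s (atom c) (perp (s c))
  | unit (i : Pol) : Inst s (unit i) (unit i)
  | pair (i : Pol) {α α' β β' : Dom B} :
      Inst s α α' → Inst s β β' → Inst s (pair i α β) (pair i α' β')
  | bag (i : Pol) {m m' : Multiset (Dom B)} :
      Multiset.Rel (Inst s) m m' → Inst s (bag i m) (bag i m')

end Dom

/-! ## Points -/

section Points

variable {A : Type u} {n : ℕ}

/-- The occurrences of elements in a point. -/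
noncomputable def ptSub (r : Fin n → Dom A) : Multiset (Dom A) := ∑ i, (r i).sub

/-- `r` is a `k`-point: every positive multiset that occurs in `r` has cardinality `k`. -/
def IsKPoint (k : ℕ) (r : Fin n → Dom A) : Prop :=
  ∀ m : Multiset (Dom A), Dom.bag .pos m ∈ ptSub r → m.card = k

open scoped Classical in
/-- `r` is injective: every atom has no or exactly two occurrences in `r`. -/
def IsInjectivePoint (r : Fin n → Dom A) : Prop :=
  ∀ c : A, Dom.atom c ∉ ptSub r ∨ (ptSub r).count (Dom.atom c) = 2

/-- The set of the `E`-atomic elements of `E`. -/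
def atomicPart (E : Set (Fin n → Dom A)) : Set (Fin n → Dom A) :=
  {r | r ∈ E ∧ ∀ r' ∈ E, ∀ s : A → Dom A, (∀ i, Dom.Inst s (r' i) (r i)) →
    ∀ c : A, Dom.atom c ∈ ptSub r' → ∃ a : A, s c = Dom.atom a}

end Points

/-! ## Cells, ports and wires -/

/-- The types of cells: `⊗`, `⅋`, `1`, `⊥`, `!`, `?`. -/
inductive CellType : Type
  | tensor : CellType
  | par : CellType
  | one : CellType
  | bot : CellType
  | bang : CellType
  | whynot : CellType

/-- The data of a graph of cells, ports and wires; the laws are in `IsPPLPS`. The finite sets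
of cells and ports are `cells` and `ports`, inside two ambient types; values of the functions
outside of their domains (`left` on cells that are not multiplicative, `num` on ports that are
not auxiliary ports of `?`-cells) are irrelevant. `num` is the function `#`. -/
structure Graph : Type (v + 1) where
  Cell : Type v
  Port : Type v
  cells : Finset Cell
  ports : Finset Port
  type : Cell → CellType
  arity : Cell → ℕ
  portsOf : Cell → Finset Port
  pri : Cell → Port
  left : Cell → Port
  num : Port → ℕ
  wires : Set (Sym2 Port)

namespace Graph

variable (G : Graph.{v})

open scoped Classical in
/-- The auxiliary ports of a cell. -/
noncomputable def aux (l : G.Cell) : Finset G.Port := (G.portsOf l).erase (G.pri l)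

/-- The principal ports. -/
def priPorts : Set G.Port := {p | ∃ l ∈ G.cells, G.pri l = p}

/-- The ports that belong to some cell. -/
def cellPorts : Set G.Port := {p | ∃ l ∈ G.cells, p ∈ G.portsOf l}

open scoped Classical in
/-- The `!`-cells. -/
noncomputable def bangs : Finset G.Cell := G.cells.filter (fun l => G.type l = .bang)

/-- The laws of cells and ports. -/
structure IsPorts : Prop where
  arity_mult : ∀ l ∈ G.cells, G.type l = .tensor ∨ G.type l = .par → G.arity l = 2
  arity_unit : ∀ l ∈ G.cells, G.type l = .one ∨ G.type l = .bot → G.arity l = 0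
  arity_bang : ∀ l ∈ G.cells, G.type l = .bang → G.arity l = 1
  portsOf_subset : ∀ l ∈ G.cells, G.portsOf l ⊆ G.ports
  portsOf_disjoint : ∀ l ∈ G.cells, ∀ l' ∈ G.cells, ∀ p, p ∈ G.portsOf l → p ∈ G.portsOf l' →
    l = l'
  portsOf_card : ∀ l ∈ G.cells, (G.portsOf l).card = G.arity l + 1
  pri_mem : ∀ l ∈ G.cells, G.pri l ∈ G.portsOf l
  left_mem : ∀ l ∈ G.cells, G.type l = .tensor ∨ G.type l = .par → G.left l ∈ G.aux l

/-- Pre-pre-linear proof-structures. -/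
structure IsPPLPS : Prop extends G.IsPorts where
  wire_ne : ∀ w ∈ G.wires, ¬ w.IsDiag
  wire_ports : ∀ w ∈ G.wires, ∀ p ∈ w, p ∈ G.ports
  wire_disjoint : ∀ w ∈ G.wires, ∀ w' ∈ G.wires, ∀ p, p ∈ w → p ∈ w' → w = w'
  wire_of_not_pri : ∀ p ∈ G.ports, p ∉ G.priPorts → ∃ q ∈ G.ports, s(p, q) ∈ G.wires
  wire_of_no_cell : ∀ p ∈ G.ports, p ∉ G.cellPorts →
    ∃ q ∈ G.ports, q ∉ G.priPorts ∧ s(p, q) ∈ G.wires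
  wire_not_cut : ∀ w ∈ G.wires, ∃ p ∈ w, p ∉ G.priPorts

/-- The free ports, or conclusions. -/
def conclusions : Set G.Port :=
  {p | p ∈ G.ports ∧ ¬ (p ∈ G.cellPorts ∧ ∃ w ∈ G.wires, p ∈ w)}

/-- The axioms: the wires between two ports that are not principal. -/
def axioms : Set (Sym2 G.Port) := {w | w ∈ G.wires ∧ ∀ p ∈ w, p ∉ G.priPorts}

/-- `p` is immediately below `q`. -/
def Below (p q : G.Port) : Prop :=
  (∃ l ∈ G.cells, p = G.pri l ∧ q ∈ G.aux l) ∨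
    (∃ l ∈ G.cells, ∃ l' ∈ G.cells, p ∈ G.aux l ∧ q = G.pri l' ∧ s(p, q) ∈ G.wires)

/-- The relation `p ≤ q`: the port `q` is above the port `p`. -/
def Le (p q : G.Port) : Prop := Relation.ReflTransGen G.Below p q

/-- Pre-linear proof-structures: there are no vicious cycles. -/
structure IsPLPS : Prop extends G.IsPPLPS where
  antisymm : ∀ p q, G.Le p q → G.Le q p → p = q

open scoped Classical in
/-- The auxiliary doors: the auxiliary ports `p` of `?`-cells such that `#(p) > 0`. -/
noncomputable def auxDoors : Finset G.Port :=
  G.ports.filter (fun p => (∃ l ∈ G.cells, G.type l = .whynot ∧ p ∈ G.aux l) ∧ 0 < G.num p)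

open scoped Classical in
/-- The depth of a port: the number of doors of boxes through which one passes on the way down
from `p`, the port `p` included if it is itself an auxiliary door. -/
noncomputable def depth (p : G.Port) : ℕ :=
  (G.bangs.filter (fun l => G.Le (G.pri l) p ∧ G.pri l ≠ p)).card +
    ∑ q ∈ G.auxDoors.filter (fun q => G.Le q p), G.num q

/-- Linear proof-structures: the two ports of an axiom have the same depth. -/
structure IsLPS : Prop extends G.IsPLPS where
  depth_eq : ∀ p q, s(p, q) ∈ G.axioms → G.depth p = G.depth q

end Graph

/-! ## `k`-experiments of linear proof-structures -/

section KExperiments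

variable {A : Type u}

/-- The set `A'` of indexed atoms `(γ, s)`, with `s` a finite sequence of integers; `(γ, [])`
is the atom `γ` itself. -/
abbrev IAtom (A : Type u) : Type u := A × List ℕ

/-- The inclusion of `A` in `A'`. -/
def toIAtom (c : A) : IAtom A := (c, [])

/-- The function `dig(s)` on indexed atoms. -/
def dig (s : List ℕ) (d : IAtom A) : IAtom A := (d.1, d.2 ++ s)

/-- `digM k d m` is the sum, over the sequences `s` in `{1, …, k}^d`, of the multisets
`dig(s) · m`. -/
noncomputable def digM (k d : ℕ) (m : Multiset (Dom (IAtom A))) : Multiset (Dom (IAtom A)) :=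
  ∑ s : Fin d → Fin k, m.map (Dom.map (dig (List.ofFn (fun j => (s j : ℕ) + 1))))

/-- `e` is a `k`-experiment of `G`. Only the values of `e` on the ports of `G` matter. -/
structure IsKExp (k : ℕ) (G : Graph.{v}) (e : G.Port → Dom (IAtom A)) : Prop where
  tensor : ∀ l ∈ G.cells, G.type l = .tensor → ∀ q ∈ G.aux l, q ≠ G.left l →
    e (G.pri l) = Dom.pair .pos (e (G.left l)) (e q)
  par : ∀ l ∈ G.cells, G.type l = .par → ∀ q ∈ G.aux l, q ≠ G.left l →
    e (G.pri l) = Dom.pair .neg (e (G.left l)) (e q)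
  one : ∀ l ∈ G.cells, G.type l = .one → e (G.pri l) = Dom.unit .pos
  bot : ∀ l ∈ G.cells, G.type l = .bot → e (G.pri l) = Dom.unit .neg
  bang : ∀ l ∈ G.cells, G.type l = .bang →
    e (G.pri l) = Dom.bag .pos (∑ p ∈ G.aux l, digM k 1 {e p})
  whynot : ∀ l ∈ G.cells, G.type l = .whynot →
    e (G.pri l) = Dom.bag .neg (∑ p ∈ G.aux l, digM k (G.num p) {e p})
  ax : ∀ p q, s(p, q) ∈ G.axioms →
    e p = (e q).perp ∧ e p ∈ Set.range (Dom.map (toIAtom (A := A)))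
  wire : ∀ p q, s(p, q) ∈ G.wires → s(p, q) ∉ G.axioms → e p = e q

/-- `e` is atomic: it labels the axiom ports by elements of `A`. -/
def IsAtomicExp (G : Graph.{v}) (e : G.Port → Dom (IAtom A)) : Prop :=
  ∀ w ∈ G.axioms, ∀ p ∈ w, ∃ c : A, e p = Dom.atom (toIAtom c)

/-- `e` is injective: no atom occurs in the labels of two different axioms. -/
def IsInjectiveExp (G : Graph.{v}) (e : G.Port → Dom (IAtom A)) : Prop :=
  ∀ w ∈ G.axioms, ∀ w' ∈ G.axioms, ∀ p ∈ w, ∀ p' ∈ w',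
    ((e p).atoms ∩ (e p').atoms).Nonempty → w = w'

/-- The result of `e` with respect to the indexing `ind` of the conclusions. -/
def kResult (G : Graph.{v}) {n : ℕ} (ind : G.conclusions ≃ Fin n)
    (e : G.Port → Dom (IAtom A)) : Fin n → Dom (IAtom A) :=
  fun i => e (ind.symm i).1

/-- `IsRenaming ρ r r₀`: the partial injection `ρ` from `A'` to `A` is defined on all atoms of
`r`, and `ρ · r = r₀`. -/
def IsRenaming {n : ℕ} (ρ : IAtom A ≃. A) (r : Fin n → Dom (IAtom A)) (r₀ : Fin n → Dom A) :
    Prop :=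
  ∀ i, (r i).map ρ = (r₀ i).map some

end KExperiments

/-! ## Proof-structures -/

/-- The data of a proof-structure: a graph, and for every `!`-cell `v` the set `b v` of the
auxiliary doors of its box; the laws are in `IsPS`. -/
structure PreStr : Type (v + 1) extends Graph.{v} where
  b : Cell → Finset Port

namespace PreStr

variable (R : PreStr.{v})

/-- The doors of the box of `v`, seen from inside: the auxiliary port of `v` and the elements
of `b v`. -/
def doors (v : R.Cell) : Set R.Port := {p | p ∈ R.aux v ∨ p ∈ R.b v}

/-- The set `B_v` of the ports above the doors of the box of `v`. -/
def region (v : R.Cell) : Set R.Port := {q | q ∈ R.ports ∧ ∃ p ∈ R.doors v, R.Le p q}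

/-- The ports of `R` that remain ports in the box of `v`: those of `B_v`, except that the
auxiliary port of `v`, which is no more in a cell once `v` is removed, disappears if it is
wired to a principal port (which then becomes a conclusion of the box). -/
def InBox (v : R.Cell) (q : R.Port) : Prop :=
  q ∈ R.region v ∧ ¬ (q ∈ R.aux v ∧ ∃ l ∈ R.cells, s(q, R.pri l) ∈ R.wires)

open scoped Classical in
/-- The box of the `!`-cell `v`. It consists of what is above `v` and above the doors in `b v`
(the ports and cells of the form `Sum.inl _`), without `v`, and of one new unary `?`-cell
`Sum.inr p` with a new principal port `Sum.inr p` below every `p ∈ b v`. The function `#` counts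
the boxes inside the box of `v`. -/
@[reducible] noncomputable def box (v : R.Cell) : PreStr.{v} where
  Cell := R.Cell ⊕ R.Port
  Port := R.Port ⊕ R.Port
  cells := (R.cells.filter (fun l => l ≠ v ∧ (∃ p ∈ R.portsOf l, p ∈ R.region v) ∧
    ¬ ∃ p ∈ R.portsOf l, p ∈ R.b v)).disjSum (R.b v)
  ports := (R.ports.filter (fun q => R.InBox v q)).disjSum (R.b v)
  type := Sum.elim R.type (fun _ => .whynot)
  arity := Sum.elim R.arity (fun _ => 1)
  portsOf := Sum.elim (fun l => (R.portsOf l).map Function.Embedding.inl)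
    (fun p => {Sum.inl p, Sum.inr p})
  pri := Sum.elim (fun l => Sum.inl (R.pri l)) Sum.inr
  left := Sum.elim (fun l => Sum.inl (R.left l)) Sum.inr
  num := Sum.elim (fun p => (R.bangs.filter (fun w => w ≠ v ∧
    (∃ q ∈ R.portsOf w, q ∈ R.region v) ∧ p ∈ R.b w)).card) (fun _ => 0)
  wires := {w | ∃ w₀ ∈ R.wires, (∀ p ∈ w₀, R.InBox v p) ∧ w = w₀.map Sum.inl}
  b := Sum.elim (fun w => (R.b w).map Function.Embedding.inl) (fun _ => ∅)

open scoped Classical in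
/-- Proof-structures, by induction on the nesting of boxes. The field `hdoor` says that no door
of a box is strictly above another door of the same box, that is, the cell below a door of a box
is outside of this box. -/
inductive IsPS : PreStr.{v} → Prop
  | mk (R : PreStr.{v})
      (hlps : R.toGraph.IsLPS)
      (hb : ∀ v ∈ R.bangs, R.b v ⊆ R.auxDoors)
      (hnum : ∀ p ∈ R.auxDoors, R.num p = (R.bangs.filter (fun l => p ∈ R.b l)).card)
      (hdoor : ∀ v ∈ R.bangs, ∀ p ∈ R.doors v, ∀ q ∈ R.doors v, R.Le p q → p = q)
      (hnest : ∀ v ∈ R.bangs, ∀ w ∈ R.bangs, Disjoint (R.region v) (R.region w) ∨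
        R.region v ⊆ R.region w ∨ R.region w ⊆ R.region v)
      (hbox : ∀ v ∈ R.bangs, IsPS (R.box v)) : IsPS R

/-- `IsExp R e`: the function `e`, which labels the ports of `R` by finite multisets of
elements of the domain, is (the function on ports of) an experiment of `R`; `f v 0, f v 1, …`
are the experiments of the box of `v` that it associates with a `!`-cell `v` of depth zero. The
last hypothesis holds by itself for wires of positive depth, except that it fixes the label of
the auxiliary port of `v` if this port is not a port of the box of `v`. -/
inductive IsExp {A : Type u} :
    (R : PreStr.{v}) → (R.Port → Multiset (Dom A)) → Prop
  | mk (R : PreStr.{v}) (e : R.Port → Multiset (Dom A))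
      (n : R.Cell → ℕ)
      (f : (v : R.Cell) → Fin (n v) → (R.box v).Port → Multiset (Dom A))
      (hf : ∀ v ∈ R.bangs, R.depth (R.pri v) = 0 → ∀ i, IsExp (R.box v) (f v i))
      (hcard : ∀ p ∈ R.ports, p ∉ R.auxDoors → R.depth p = 0 → (e p).card = 1)
      (hax : ∀ p q, s(p, q) ∈ R.axioms → R.depth p = 0 → R.depth q = 0 →
        ∃ α β : Dom A, e p = {α} ∧ e q = {β} ∧ α = β.perp)
      (htensor : ∀ l ∈ R.cells, R.type l = .tensor → R.depth (R.pri l) = 0 →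
        ∀ q ∈ R.aux l, q ≠ R.left l → ∃ α β : Dom A,
          e (R.left l) = {α} ∧ e q = {β} ∧ e (R.pri l) = {Dom.pair .pos α β})
      (hpar : ∀ l ∈ R.cells, R.type l = .par → R.depth (R.pri l) = 0 →
        ∀ q ∈ R.aux l, q ≠ R.left l → ∃ α β : Dom A,
          e (R.left l) = {α} ∧ e q = {β} ∧ e (R.pri l) = {Dom.pair .neg α β})
      (hone : ∀ l ∈ R.cells, R.type l = .one → R.depth (R.pri l) = 0 →
        e (R.pri l) = {Dom.unit .pos})
      (hbot : ∀ l ∈ R.cells, R.type l = .bot → R.depth (R.pri l) = 0 →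
        e (R.pri l) = {Dom.unit .neg})
      (hwhynot : ∀ l ∈ R.cells, R.type l = .whynot → R.depth (R.pri l) = 0 →
        e (R.pri l) = {Dom.bag .neg (∑ p ∈ R.aux l, e p)})
      (hbang : ∀ v ∈ R.bangs, R.depth (R.pri v) = 0 →
        ∃ p, Sum.inl p ∈ (R.box v).conclusions ∧ R.Le (R.pri v) p ∧
          e (R.pri v) = {Dom.bag .pos (∑ i, f v i (Sum.inl p))})
      (hinside : ∀ v ∈ R.bangs, R.depth (R.pri v) = 0 →
        ∀ p, Sum.inl p ∈ (R.box v).ports → e p = ∑ i, f v i (Sum.inl p))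
      (hwire : ∀ p q, s(p, q) ∈ R.wires → s(p, q) ∉ R.axioms → e p = e q) :
      IsExp R e

/-- The interpretation of `(R, ind)`: the set of the results of the experiments of `R`. -/
def interp (A : Type u) (R : PreStr.{v}) {n : ℕ} (ind : R.conclusions ≃ Fin n) :
    Set (Fin n → Dom A) :=
  {r | ∃ e : R.Port → Multiset (Dom A), IsExp R e ∧ ∀ i, e (ind.symm i).1 = {r i}}

end PreStr

end ProofStr

namespace ProofStr

/-! Let `e` be an injective atomic `k`-experiment of the underlying linear structure. Give each port
one copy of its label for every choice of a copy, among `k`, of each of the boxes that contain the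
port (`copies`). Two facts relate these copies to the experiments of `R`.

Unfolding (`isExp_copies`): under any renaming of the indexed atoms by atoms, the copies form an
experiment of `R`, so every renamed result of `e` lies in the interpretation. Genericity
(`exists_subst`): every experiment whose positive multisets all have cardinality `k` is obtained
from the copies by substituting elements for indexed atoms, up to duality at each occurrence. Both
are inductions on the nesting of boxes, in which the last index of an atom tells the copy of the
outermost box. For genericity the substitutions found for the different boxes and copies have to be
glued. This is possible because `e` is injective: an atom determines its axiom, hence the box, and
its last index determines the copy.

A counting argument (`sum_conclusions`, `count_result`) shows that an indexed atom has no or two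
occurrences in the result of `e`: passing from a port to the ports immediately above it preserves
the atoms of the copies, so the atoms found at the conclusions are those found at the two ends of
the axioms.

From left to right, an injective atomic `k`-point is an instance of the result of `e` by genericity.
Embedding the indexed atoms into the infinite set `A` puts a renamed result in the interpretation.
Atomicity of the point then forces the values of the substitution to be atoms, and counting
occurrences (two before, at most two after) makes it injective. From right to left, only atomicity
needs an argument. If a renamed result is an instance of some `r'`, then `r'` is an instance of the
result by genericity, and the composite of the two substitutions does not change the weight `wt`.
Since atoms weigh `1` and all other elements at least `2`, all the values involved are atoms. -/

theorem mem_sum_map {α β : Type*} {m : Multiset α} {f : α → Multiset β} {b : β} :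
    b ∈ (m.map f).sum ↔ ∃ x ∈ m, b ∈ f x := by
  have : b ∈ (m.map f).join ↔ ∃ x ∈ m, b ∈ f x := by simp [Multiset.mem_join]
  exact this

/-! ### Elements of the domain: atoms, renamings, substitutions and weights. -/

namespace Dom

universe w

variable {B : Type u} {C : Type v}

/-- Induction on the elements of the domain. -/
theorem ind {P : Dom B → Prop} (ha : ∀ a, P (atom a)) (hu : ∀ i, P (unit i))
    (hp : ∀ i α β, P α → P β → P (pair i α β))
    (hb : ∀ i m, (∀ x ∈ m, P x) → P (bag i m)) (α : Dom B) : P α := by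
  induction α using Quot.ind with
  | _ x =>
    -- The recursor of the nested type needs a second motive, for lists: all entries satisfy `P`.
    exact PreDom.rec (motive_1 := fun x => P (mk x)) (motive_2 := fun l => ∀ x ∈ l, P (mk x))
      ha hu (fun i x y hx hy => hp i (mk x) (mk y) hx hy)
      (fun i l hl => by rw [← bag_mk]; apply hb; simpa using hl)
      (by simp) (fun x l hx hl => by simpa using ⟨hx, hl⟩) x

@[simp] theorem map_atom (f : B → C) (a : B) : map f (atom a) = atom (f a) := rfl

@[simp] theorem map_unit (f : B → C) (i : Pol) : map f (unit i : Dom B) = unit i := rfl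

@[simp] theorem map_pair (f : B → C) (i : Pol) (α β : Dom B) :
    map f (pair i α β) = pair i (map f α) (map f β) := fold_pair _ _ _ _ _ _ _

@[simp] theorem map_bag (f : B → C) (i : Pol) (m : Multiset (Dom B)) :
    map f (bag i m) = bag i (m.map (map f)) := fold_bag _ _ _ _ _ _

@[simp] theorem perp_atom (a : B) : perp (atom a) = atom a := rfl

@[simp] theorem perp_pair (i : Pol) (α β : Dom B) :
    perp (pair i α β) = pair i.perp (perp α) (perp β) := fold_pair _ _ _ _ _ _ _

@[simp] theorem perp_bag (i : Pol) (m : Multiset (Dom B)) :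
    perp (bag i m) = bag i.perp (m.map perp) := fold_bag _ _ _ _ _ _

/-- The multiset of occurrences of atoms. -/
noncomputable def atm : Dom B → Multiset B :=
  fold (fun a => {a}) (fun _ => 0) (fun _ x y => x + y) (fun _ m => m.sum)

@[simp] theorem atm_atom (a : B) : atm (atom a) = {a} := rfl

@[simp] theorem atm_unit (i : Pol) : atm (unit i : Dom B) = 0 := rfl

@[simp] theorem atm_pair (i : Pol) (α β : Dom B) : atm (pair i α β) = atm α + atm β :=
  fold_pair _ _ _ _ _ _ _

@[simp] theorem atm_bag (i : Pol) (m : Multiset (Dom B)) :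
    atm (bag i m) = (m.map atm).sum := fold_bag _ _ _ _ _ _

theorem mem_atm_bag {i : Pol} {m : Multiset (Dom B)} {a : B} :
    a ∈ atm (bag i m) ↔ ∃ x ∈ m, a ∈ atm x := by
  rw [atm_bag, mem_sum_map]

theorem map_congr {f g : B → C} {α : Dom B} (h : ∀ a ∈ atm α, f a = g a) :
    map f α = map g α := by
  induction α using ind with
  | ha a => simp [h a (by simp)]
  | hu i => rfl
  | hp i α β h1 h2 =>
    rw [map_pair, map_pair, h1 (fun a ha => h a (by simp [ha])),
      h2 (fun a ha => h a (by simp [ha]))]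
  | hb i m ih =>
    rw [map_bag, map_bag]
    congr 1
    exact Multiset.map_congr rfl fun x hx => ih x hx fun a ha => h a (mem_atm_bag.2 ⟨x, hx, ha⟩)

theorem map_map {D : Type w} (f : B → C) (g : C → D) (α : Dom B) :
    map g (map f α) = map (g ∘ f) α := by
  induction α using ind with
  | ha a => rfl
  | hu i => rfl
  | hp i α β h1 h2 => simp [h1, h2]
  | hb i m ih =>
    rw [map_bag, map_bag, map_bag, Multiset.map_map]
    congr 1
    exact Multiset.map_congr rfl ih

theorem map_id (α : Dom B) : map id α = α := by
  induction α using ind with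
  | ha a => rfl
  | hu i => rfl
  | hp i α β h1 h2 => simp [h1, h2]
  | hb i m ih =>
    rw [map_bag]
    congr 1
    conv_rhs => rw [← Multiset.map_id m]
    exact Multiset.map_congr rfl ih

theorem atm_map (f : B → C) (α : Dom B) : atm (map f α) = (atm α).map f := by
  induction α using ind with
  | ha a => rfl
  | hu i => rfl
  | hp i α β h1 h2 => simp [h1, h2]
  | hb i m ih =>
    rw [map_bag, atm_bag, atm_bag, Multiset.map_map]
    have := map_multiset_sum (Multiset.mapAddMonoidHom f) (m.map atm)
    simp only [Multiset.coe_mapAddMonoidHom] at this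
    rw [this, Multiset.map_map]
    exact congrArg _ (Multiset.map_congr rfl ih)

theorem atm_perp (α : Dom B) : atm (perp α) = atm α := by
  induction α using ind with
  | ha a => rfl
  | hu i => rfl
  | hp i α β h1 h2 => simp [h1, h2]
  | hb i m ih =>
    rw [perp_bag, atm_bag, atm_bag, Multiset.map_map]
    exact congrArg _ (Multiset.map_congr rfl ih)

/-- The atom of an element that is an atom. -/
noncomputable def getAtom : Dom B → Option B :=
  fold some (fun _ => none) (fun _ _ _ => none) (fun _ _ => none)

theorem getAtom_bag (i : Pol) (m : Multiset (Dom B)) : getAtom (bag i m) = none :=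
  fold_bag _ _ _ _ _ _

theorem getAtom_pair (i : Pol) (α β : Dom B) : getAtom (pair i α β) = none :=
  fold_pair _ _ _ _ _ _ _

theorem atom_injective : Function.Injective (atom : B → Dom B) := fun _ _ h =>
  Option.some_injective _ (congrArg getAtom h)

theorem atom_ne_unit (a : B) (i : Pol) : atom a ≠ unit i := fun h => by
  cases congrArg getAtom h

theorem atom_ne_pair (a : B) (i : Pol) (α β : Dom B) : atom a ≠ pair i α β := fun h => by
  have := congrArg getAtom h
  rw [getAtom_pair] at this
  cases this

theorem atom_ne_bag (a : B) (i : Pol) (m : Multiset (Dom B)) : atom a ≠ bag i m := fun h => by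
  have := congrArg getAtom h
  rw [getAtom_bag] at this
  cases this

/-- The polarity and the cardinality of an element that is given by a multiset. -/
noncomputable def bagSize : Dom B → Option (Pol × ℕ) :=
  fold (fun _ => none) (fun _ => none) (fun _ _ _ => none) (fun i m => some (i, m.card))

theorem bagSize_bag (i : Pol) (m : Multiset (Dom B)) : bagSize (bag i m) = some (i, m.card) := by
  rw [bagSize, fold_bag, Multiset.card_map]

theorem bagSize_pair (i : Pol) (α β : Dom B) : bagSize (pair i α β) = none :=
  fold_pair _ _ _ _ _ _ _

/-- The paired recursion rebuilds the element in its first component. Knowing this turns the second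
component into the expected recursion for `sub`. -/
theorem selfSub_fst (α : Dom B) : (selfSub α).1 = α := by
  induction α using ind with
  | ha a => rfl
  | hu i => rfl
  | hp i α β h1 h2 =>
    rw [selfSub, fold_pair]
    exact congrArg₂ _ h1 h2
  | hb i m ih =>
    rw [selfSub, fold_bag]
    show bag i _ = _
    rw [Multiset.map_map]
    congr 1
    conv_rhs => rw [← Multiset.map_id m]
    exact Multiset.map_congr rfl ih

@[simp] theorem sub_atom (a : B) : sub (atom a) = {atom a} := rfl

@[simp] theorem sub_unit (i : Pol) : sub (unit i : Dom B) = {unit i} := rfl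

@[simp] theorem sub_pair (i : Pol) (α β : Dom B) :
    sub (pair i α β) = {pair i α β} + sub α + sub β := by
  conv_lhs => rw [sub, selfSub, fold_pair]
  show {pair i (selfSub α).1 (selfSub β).1} + sub α + sub β = _
  rw [selfSub_fst, selfSub_fst]

@[simp] theorem sub_bag (i : Pol) (m : Multiset (Dom B)) :
    sub (bag i m) = {bag i m} + (m.map sub).sum := by
  have h := selfSub_fst (bag i m)
  have h' : selfSub (bag i m) = (bag i ((m.map selfSub).map Prod.fst),
      {bag i ((m.map selfSub).map Prod.fst)} + ((m.map selfSub).map Prod.snd).sum) :=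
    fold_bag _ _ _ _ _ _
  have h2 : sub (bag i m) =
      {bag i ((m.map selfSub).map Prod.fst)} + ((m.map selfSub).map Prod.snd).sum :=
    congrArg Prod.snd h'
  rw [h2, ← show bag i ((m.map selfSub).map Prod.fst) = bag i m from
    (congrArg Prod.fst h').symm.trans h, Multiset.map_map Prod.snd selfSub]
  rfl

-- No unit, pair or bag is an atom, so only the leaves contribute. Conditions on points can thus be
-- read on `atm`, which is additive and commutes with renaming.
open scoped Classical in
theorem count_atom_sub (α : Dom B) (a : B) : (sub α).count (atom a) = (atm α).count a := by
  induction α using ind with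
  | ha b =>
    rw [sub_atom, atm_atom, Multiset.count_singleton, Multiset.count_singleton]
    simp only [atom_injective.eq_iff]
  | hu i => simp [atom_ne_unit]
  | hp i α β h1 h2 => simp [atom_ne_pair, h1, h2]
  | hb i m ih =>
    rw [sub_bag, atm_bag, Multiset.count_add, Multiset.count_singleton,
      if_neg (atom_ne_bag _ _ _), zero_add, Multiset.count_sum, Multiset.count_sum]
    exact congrArg _ (Multiset.map_congr rfl ih)

theorem atom_mem_sub {α : Dom B} {a : B} : atom a ∈ sub α ↔ a ∈ atm α := by
  classical
  rw [← Multiset.count_pos, ← Multiset.count_pos, count_atom_sub]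

/-- All the positive multisets that occur in an element have cardinality `k`. -/
noncomputable def Good (k : ℕ) : Dom B → Prop :=
  fold (fun _ => True) (fun _ => True) (fun _ P Q => P ∧ Q)
    (fun i M => (i = .pos → M.card = k) ∧ ∀ P ∈ M, P)

theorem good_pair {k : ℕ} {i : Pol} {α β : Dom B} :
    Good k (pair i α β) ↔ Good k α ∧ Good k β := by
  rw [Good, fold_pair]

theorem good_bag {k : ℕ} {i : Pol} {m : Multiset (Dom B)} :
    Good k (bag i m) ↔ (i = .pos → m.card = k) ∧ ∀ x ∈ m, Good k x := by
  conv_lhs => rw [Good, fold_bag]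
  rw [Multiset.card_map]
  exact and_congr_right fun _ => Multiset.forall_mem_map_iff (p := fun P => P)

theorem good_iff {k : ℕ} {α : Dom B} :
    Good k α ↔ ∀ m : Multiset (Dom B), bag .pos m ∈ sub α → m.card = k := by
  induction α using ind with
  | ha a =>
    refine iff_of_true trivial fun m h => ?_
    rw [sub_atom, Multiset.mem_singleton] at h
    exact absurd h.symm (atom_ne_bag _ _ _)
  | hu i =>
    refine iff_of_true trivial fun m h => ?_
    rw [sub_unit, Multiset.mem_singleton] at h
    have := congrArg bagSize h
    rw [bagSize_bag] at this
    cases this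
  | hp i α β h1 h2 =>
    rw [good_pair, h1, h2, ← forall_and]
    refine forall_congr' fun m => ?_
    have : bag .pos m ≠ pair i α β := fun h => by
      have := congrArg bagSize h
      rw [bagSize_bag, bagSize_pair] at this
      cases this
    simp [this]
    tauto
  | hb i m ih =>
    rw [good_bag]
    constructor
    · rintro ⟨h1, h2⟩ m' hm
      rw [sub_bag, Multiset.mem_add, Multiset.mem_singleton, mem_sum_map] at hm
      rcases hm with hm | ⟨x, hx, hm⟩
      -- Only the polarity and the cardinality of the two multisets matter, so `bagSize` replaces
      -- the injectivity of `bag`.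
      · have := congrArg bagSize hm
        rw [bagSize_bag, bagSize_bag] at this
        simp only [Option.some.injEq, Prod.mk.injEq] at this
        rw [this.2, h1 this.1.symm]
      · exact (ih x hx).1 (h2 x hx) m' hm
    · intro h
      refine ⟨fun hi => h m (by subst hi; simp), fun x hx => (ih x hx).2 fun m' hm => h m' ?_⟩
      rw [sub_bag, Multiset.mem_add, mem_sum_map]
      exact Or.inr ⟨x, hx, hm⟩

theorem good_map {k : ℕ} {f : B → C} {α : Dom B} : Good k (map f α) ↔ Good k α := by
  induction α using ind with
  | ha a => exact Iff.rfl
  | hu i => exact Iff.rfl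
  | hp i α β h1 h2 => rw [map_pair, good_pair, good_pair, h1, h2]
  | hb i m ih =>
    rw [map_bag, good_bag, good_bag, Multiset.card_map]
    simp only [Multiset.mem_map, forall_exists_index, and_imp, forall_apply_eq_imp_iff₂]
    exact and_congr_right fun _ => forall₂_congr ih

/-- The relation `Inst`, with values in the domain over another set of atoms. -/
noncomputable def SubstRel (s : C → Dom B) : Dom C → Dom B → Prop :=
  fold (fun c β => β = s c ∨ β = perp (s c)) (fun i β => β = unit i)
    (fun i P Q β => ∃ x y, P x ∧ Q y ∧ β = pair i x y)
    (fun i M β => ∃ m', Multiset.Rel (fun P x => P x) M m' ∧ β = bag i m')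

variable {s : C → Dom B}

theorem substRel_atom {c : C} {β : Dom B} :
    SubstRel s (atom c) β ↔ β = s c ∨ β = perp (s c) := Iff.rfl

theorem substRel_unit {i : Pol} {β : Dom B} : SubstRel s (unit i) β ↔ β = unit i := Iff.rfl

theorem substRel_pair {i : Pol} {α α' : Dom C} {β : Dom B} :
    SubstRel s (pair i α α') β ↔
      ∃ x y, SubstRel s α x ∧ SubstRel s α' y ∧ β = pair i x y := by
  rw [SubstRel, fold_pair]

theorem substRel_bag {i : Pol} {m : Multiset (Dom C)} {β : Dom B} :
    SubstRel s (bag i m) β ↔ ∃ m', Multiset.Rel (SubstRel s) m m' ∧ β = bag i m' := by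
  conv_lhs => rw [SubstRel, fold_bag]
  simp only [Multiset.rel_map_left]
  rfl

/-- Moves a renaming from the substitution to the element. It is applied to `dig`, when the
substitutions of the copies of a box are glued, and to an embedding of the indexed atoms into `A`.
-/
theorem substRel_map {D : Type w} {h : C → D} {s' : D → Dom B} {α : Dom C} {β : Dom B}
    (hs : ∀ c ∈ atm α, s c = s' (h c)) (hr : SubstRel s α β) : SubstRel s' (map h α) β := by
  induction α using ind generalizing β with
  | ha a => rw [map_atom, substRel_atom, ← hs a (by simp)]; exact hr
  | hu i => exact hr
  | hp i α α' h1 h2 =>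
    rw [substRel_pair] at hr
    obtain ⟨x, y, hx, hy, rfl⟩ := hr
    rw [map_pair, substRel_pair]
    exact ⟨x, y, h1 (fun c hc => hs c (by simp [hc])) hx, h2 (fun c hc => hs c (by simp [hc])) hy,
      rfl⟩
  | hb i m ih =>
    rw [substRel_bag] at hr
    obtain ⟨m', hm, rfl⟩ := hr
    rw [map_bag, substRel_bag]
    refine ⟨m', Multiset.rel_map_left.2 (hm.mono fun x hx y _ hxy => ?_), rfl⟩
    exact ih x hx (fun c hc => hs c (mem_atm_bag.2 ⟨x, hx, hc⟩)) hxy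

theorem SubstRel.inst {s : B → Dom B} {α β : Dom B} (h : SubstRel s α β) : Inst s α β := by
  induction α using ind generalizing β with
  | ha a =>
    rcases substRel_atom.1 h with rfl | rfl
    · exact .same a
    · exact .dual a
  | hu i => rw [substRel_unit.1 h]; exact .unit i
  | hp i α α' h1 h2 =>
    obtain ⟨x, y, hx, hy, rfl⟩ := substRel_pair.1 h
    exact .pair i (h1 hx) (h2 hy)
  | hb i m ih =>
    obtain ⟨m', hm, rfl⟩ := substRel_bag.1 h
    exact .bag i (hm.mono fun x hx y _ hxy => ih x hx hxy)

theorem Inst.substRel {s : B → Dom B} {α β : Dom B} (h : Inst s α β) : SubstRel s α β :=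
  -- `Inst` is nested through `Multiset.Rel`, so the induction carries a second motive for related
  -- multisets.
  Inst.rec (motive_1 := fun α β _ => SubstRel s α β)
    (motive_2 := fun m m' _ => Multiset.Rel (SubstRel s) m m')
    (fun _ => Or.inl rfl) (fun _ => Or.inr rfl) (fun _ => rfl)
    (fun _ _ _ _ _ _ _ h1 h2 => substRel_pair.2 ⟨_, _, h1, h2, rfl⟩)
    (fun _ _ _ _ h => substRel_bag.2 ⟨_, h, rfl⟩) .zero (fun _ _ h1 h2 => .cons h1 h2) h

/-- A weight that is minimal on atoms. -/
noncomputable def wt (φ : B → ℕ) : Dom B → ℕ :=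
  fold φ (fun _ => 2) (fun _ x y => 2 + x + y) (fun _ m => 2 + m.sum)

theorem wt_atom (φ : B → ℕ) (a : B) : wt φ (atom a) = φ a := rfl

theorem wt_unit (φ : B → ℕ) (i : Pol) : wt φ (unit i) = 2 := rfl

theorem wt_pair (φ : B → ℕ) (i : Pol) (α β : Dom B) :
    wt φ (pair i α β) = 2 + wt φ α + wt φ β := fold_pair _ _ _ _ _ _ _

theorem wt_bag (φ : B → ℕ) (i : Pol) (m : Multiset (Dom B)) :
    wt φ (bag i m) = 2 + (m.map (wt φ)).sum := fold_bag _ _ _ _ _ _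

theorem wt_perp (φ : B → ℕ) (α : Dom B) : wt φ (perp α) = wt φ α := by
  induction α using ind with
  | ha a => rfl
  | hu i => rfl
  | hp i α β h1 h2 => simp [wt_pair, h1, h2]
  | hb i m ih =>
    rw [perp_bag, wt_bag, wt_bag, Multiset.map_map]
    congr 2
    exact Multiset.map_congr rfl ih

theorem wt_map (f : C → B) (φ : B → ℕ) (α : Dom C) : wt φ (map f α) = wt (φ ∘ f) α := by
  induction α using ind with
  | ha a => rfl
  | hu i => rfl
  | hp i α β h1 h2 => simp [wt_pair, h1, h2]
  | hb i m ih =>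
    rw [map_bag, wt_bag, wt_bag, Multiset.map_map]
    congr 2
    exact Multiset.map_congr rfl ih

/-- Weights ignore polarities, so the choice between a value and its dual at each occurrence is
invisible. This makes the weight of a composite of two substitutions computable. -/
theorem SubstRel.wt_eq {α : Dom C} {β : Dom B} (h : SubstRel s α β) (φ : B → ℕ) :
    wt φ β = wt (fun c => wt φ (s c)) α := by
  induction α using ind generalizing β with
  | ha a =>
    rcases substRel_atom.1 h with rfl | rfl
    · rfl
    · exact wt_perp _ _
  | hu i => rw [substRel_unit.1 h]; rfl
  | hp i α α' h1 h2 =>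
    obtain ⟨x, y, hx, hy, rfl⟩ := substRel_pair.1 h
    rw [wt_pair, wt_pair, h1 hx, h2 hy]
  | hb i m ih =>
    obtain ⟨m', hm, rfl⟩ := substRel_bag.1 h
    rw [wt_bag, wt_bag]
    congr 2
    exact (Multiset.rel_eq.1
      (Multiset.rel_map.2 (hm.mono fun x hx y _ hxy => (ih x hx hxy).symm))).symm

/-- Substitution acts at the leaves and keeps the cardinality of the multisets already present; new
multisets appear only inside the substituted values. -/
theorem SubstRel.good {k : ℕ} {α : Dom C} {β : Dom B} (h : SubstRel s α β) (hβ : Good k β) :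
    Good k α := by
  induction α using ind generalizing β with
  | ha a => trivial
  | hu i => trivial
  | hp i α α' h1 h2 =>
    obtain ⟨x, y, hx, hy, rfl⟩ := substRel_pair.1 h
    rw [good_pair] at hβ ⊢
    exact ⟨h1 hx hβ.1, h2 hy hβ.2⟩
  | hb i m ih =>
    obtain ⟨m', hm, rfl⟩ := substRel_bag.1 h
    rw [good_bag] at hβ ⊢
    refine ⟨fun hi => (Multiset.card_eq_card_of_rel hm).trans (hβ.1 hi), fun x hx => ?_⟩
    obtain ⟨y, hy, hxy⟩ := Multiset.exists_mem_of_rel_of_mem hm hx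
    exact ih x hx hxy (hβ.2 y hy)

theorem SubstRel.mem_atm {α : Dom C} {β : Dom B} (h : SubstRel s α β) {a : B} (ha : a ∈ atm β) :
    ∃ c ∈ atm α, a ∈ atm (s c) := by
  induction α using ind generalizing β with
  | ha c =>
    rcases substRel_atom.1 h with rfl | rfl
    · exact ⟨c, by simp, ha⟩
    · exact ⟨c, by simp, by rwa [atm_perp] at ha⟩
  | hu i => rw [substRel_unit.1 h] at ha; simp at ha
  | hp i α α' h1 h2 =>
    obtain ⟨x, y, hx, hy, rfl⟩ := substRel_pair.1 h
    rw [atm_pair, Multiset.mem_add] at ha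
    rcases ha with ha | ha
    · obtain ⟨c, hc, h⟩ := h1 hx ha
      exact ⟨c, by simp [hc], h⟩
    · obtain ⟨c, hc, h⟩ := h2 hy ha
      exact ⟨c, by simp [hc], h⟩
  | hb i m ih =>
    obtain ⟨m', hm, rfl⟩ := substRel_bag.1 h
    obtain ⟨y, hy, ha⟩ := mem_atm_bag.1 ha
    obtain ⟨x, hx, hxy⟩ := Multiset.exists_mem_of_rel_of_mem
      (Multiset.rel_flip.2 hm) hy
    obtain ⟨c, hc, h⟩ := ih x hx hxy ha
    exact ⟨c, mem_atm_bag.2 ⟨x, hx, hc⟩, h⟩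

/-- Atoms are their own duals, so the choice at each occurrence disappears when all values are
atoms. -/
theorem SubstRel.eq_map {α : Dom C} {β : Dom B} (h : SubstRel s α β) {g : C → B}
    (hg : ∀ c ∈ atm α, s c = atom (g c)) : β = map g α := by
  induction α using ind generalizing β with
  | ha c =>
    have := hg c (by simp)
    rcases substRel_atom.1 h with rfl | rfl <;> rw [this] <;> rfl
  | hu i => exact substRel_unit.1 h
  | hp i α α' h1 h2 =>
    obtain ⟨x, y, hx, hy, rfl⟩ := substRel_pair.1 h
    rw [map_pair, h1 hx fun c hc => hg c (by simp [hc]), h2 hy fun c hc => hg c (by simp [hc])]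
  | hb i m ih =>
    obtain ⟨m', hm, rfl⟩ := substRel_bag.1 h
    rw [map_bag]
    congr 1
    refine (Multiset.rel_eq.1 (Multiset.rel_map_left.2 (hm.mono fun x hx y _ hxy => ?_))).symm
    exact (ih x hx hxy fun c hc => hg c (mem_atm_bag.2 ⟨x, hx, hc⟩)).symm

/-- Separates the contribution of the constructors, independent of `φ`, from that of the occurrences
of atoms. -/
theorem wt_eq_add (φ : B → ℕ) (α : Dom B) :
    wt φ α = wt (fun _ => 0) α + ((atm α).map φ).sum := by
  induction α using ind with
  | ha a => simp [wt_atom]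
  | hu i => rfl
  | hp i α β h1 h2 => simp only [wt_pair, atm_pair, Multiset.map_add, Multiset.sum_add, h1, h2]; ring
  | hb i m ih =>
    rw [wt_bag, wt_bag, Multiset.map_congr rfl ih, Multiset.sum_map_add, atm_bag, ← add_assoc]
    congr 1
    have := map_multiset_sum (Multiset.sumAddMonoidHom.comp (Multiset.mapAddMonoidHom φ))
      (m.map atm)
    simp only [Multiset.map_map] at this
    exact this.symm

/-- The contributions of the constructors cancel. There remains a sum of terms at least `1` that
equals its number of terms. -/
theorem eq_one_of_wt_eq {φ : B → ℕ} {α : Dom B} (hφ : ∀ a, 1 ≤ φ a)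
    (h : wt φ α = wt (fun _ => 1) α) : ∀ a ∈ atm α, φ a = 1 := by
  rw [wt_eq_add φ, wt_eq_add (fun _ => 1), add_left_cancel_iff] at h
  generalize atm α = m at h
  induction m using Multiset.induction with
  | empty => simp
  | cons b m ih =>
    have h1 : (m.map (fun _ => 1)).sum ≤ (m.map φ).sum :=
      Multiset.sum_map_le_sum_map _ _ fun a _ => hφ a
    simp only [Multiset.map_cons, Multiset.sum_cons] at h
    have := hφ b
    intro a ha
    rcases Multiset.mem_cons.1 ha with rfl | ha
    · omega
    · exact ih (by omega) a ha

theorem one_le_wt {φ : B → ℕ} (hφ : ∀ a, 1 ≤ φ a) (α : Dom B) : 1 ≤ wt φ α := by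
  induction α using ind with
  | ha a => exact hφ a
  | hu i => simp [wt_unit]
  | hp i α β h1 h2 => rw [wt_pair]; omega
  | hb i m ih => rw [wt_bag]; omega

/-- Every constructor other than `atom` contributes at least `2`, whatever `φ` is. -/
theorem exists_atom_of_wt_eq_one {φ : B → ℕ} {α : Dom B} (h : wt φ α = 1) :
    ∃ a, α = atom a := by
  induction α using ind with
  | ha a => exact ⟨a, rfl⟩
  | hu i => simp [wt_unit] at h
  | hp i α β h1 h2 => rw [wt_pair] at h; omega
  | hb i m ih => rw [wt_bag] at h; omega

end Dom

end ProofStr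

namespace ProofStr

/-! ### The multisets of indexed copies. -/

section DigM

open Dom

variable {A : Type u}

theorem map_sum_finset {α β ι : Type*} (f : α → β) (s : Finset ι) (m : ι → Multiset α) :
    (∑ i ∈ s, m i).map f = ∑ i ∈ s, (m i).map f :=
  map_sum (Multiset.mapAddMonoidHom f) m s

theorem digM_zero (k : ℕ) (m : Multiset (Dom (IAtom A))) : digM k 0 m = m := by
  have : (dig [] : IAtom A → IAtom A) = id := by
    funext x
    simp [dig]
  have h : (Dom.map id : Dom (IAtom A) → _) = id := funext map_id
  simp [digM, this, h]

/-- `dig` appends on the right, so it is the last index that is split off: it is the one that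
selects the copy of the outermost box. -/
theorem digM_succ (k d : ℕ) (m : Multiset (Dom (IAtom A))) :
    digM k (d + 1) m = ∑ i : Fin k, (digM k d m).map (Dom.map (dig [(i : ℕ) + 1])) := by
  simp only [digM, map_sum_finset]
  rw [← (Fin.snocEquiv (fun _ => Fin k)).sum_comp, Fintype.sum_prod_type]
  refine Finset.sum_congr rfl fun i _ => Finset.sum_congr rfl fun s _ => ?_
  rw [Multiset.map_map]
  refine Multiset.map_congr rfl fun x _ => ?_
  rw [Function.comp_apply, Dom.map_map]
  congr 1
  funext y
  rw [List.ofFn_succ']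
  simp [dig, Fin.snocEquiv]

theorem digM_add (k a b : ℕ) (m : Multiset (Dom (IAtom A))) :
    digM k (a + b) m = digM k a (digM k b m) := by
  induction a with
  | zero => rw [zero_add, digM_zero]
  | succ a ih => rw [Nat.add_right_comm, digM_succ, digM_succ, ih]

theorem digM_sum {ι : Type*} (k d : ℕ) (s : Finset ι) (m : ι → Multiset (Dom (IAtom A))) :
    digM k d (∑ i ∈ s, m i) = ∑ i ∈ s, digM k d (m i) := by
  simp only [digM, map_sum_finset]
  exact Finset.sum_comm

theorem card_digM_one (k : ℕ) (m : Multiset (Dom (IAtom A))) :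
    (digM k 1 m).card = k * m.card := by
  simp [digM]

theorem forall_mem_digM {k d : ℕ} {P : Dom (IAtom A) → Prop} {m : Multiset (Dom (IAtom A))}
    (h : ∀ s, ∀ x ∈ m, P (Dom.map (dig s) x)) : ∀ x ∈ digM k d m, P x := by
  intro x hx
  rw [digM, Multiset.mem_sum] at hx
  obtain ⟨s, _, hx⟩ := hx
  obtain ⟨y, hy, rfl⟩ := Multiset.mem_map.1 hx
  exact h _ y hy

/-- The multiset of the occurrences of atoms in a multiset. -/
noncomputable def atmM (m : Multiset (Dom (IAtom A))) : Multiset (IAtom A) := (m.map atm).sum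

@[simp] theorem atmM_singleton (x : Dom (IAtom A)) : atmM {x} = atm x := by simp [atmM]

theorem atmM_sum {ι : Type*} (s : Finset ι) (m : ι → Multiset (Dom (IAtom A))) :
    atmM (∑ i ∈ s, m i) = ∑ i ∈ s, atmM (m i) :=
  map_sum (Multiset.sumAddMonoidHom.comp (Multiset.mapAddMonoidHom atm)) m s

theorem atmM_map (f : IAtom A → IAtom A) (m : Multiset (Dom (IAtom A))) :
    atmM (m.map (Dom.map f)) = (atmM m).map f := by
  have := map_multiset_sum (Multiset.mapAddMonoidHom f) (m.map atm)
  simp only [Multiset.coe_mapAddMonoidHom] at this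
  rw [atmM, atmM, this, Multiset.map_map, Multiset.map_map]
  exact congrArg _ (Multiset.map_congr rfl fun x _ => atm_map f x)

/-- Allows a label to be replaced, under the indexing, by the labels from which it is built, as only
atoms are counted. -/
theorem atmM_digM_congr (k d : ℕ) {m m' : Multiset (Dom (IAtom A))} (h : atmM m = atmM m') :
    atmM (digM k d m) = atmM (digM k d m') := by
  simp only [digM, atmM_sum, atmM_map, h]

-- The copies of one atom carry pairwise different index sequences.
open scoped Classical in
theorem count_atmM_digM_le (k d : ℕ) (c : A) (x : IAtom A) :
    (atmM (digM k d {atom (toIAtom c)})).count x ≤ 1 := by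
  have h : atmM (digM k d {atom (toIAtom c)}) =
      (Finset.univ.val.map fun s : Fin d → Fin k =>
        ((c, List.ofFn fun j => (s j : ℕ) + 1) : IAtom A)) := by
    rw [← Multiset.sum_map_singleton (Finset.univ.val.map _), Multiset.map_map]
    simp only [digM, atmM_sum, atmM_singleton, Multiset.map_singleton]
    rfl
  rw [h]
  refine Multiset.nodup_iff_count_le_one.1 (Multiset.Nodup.map ?_ Finset.univ.nodup) x
  intro s t hst
  have := List.ofFn_injective (Prod.ext_iff.1 hst).2
  funext j
  have := congrFun this j
  exact Fin.ext (Nat.succ.inj this)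

theorem fst_of_mem_atmM_digM {k d : ℕ} {c : A} {x : IAtom A}
    (h : x ∈ atmM (digM k d {atom (toIAtom c)})) : x.1 = c := by
  obtain ⟨y, hy, hx⟩ := mem_sum_map.1 h
  revert hx
  revert y
  refine forall_mem_digM fun s y hy => ?_
  rw [Multiset.mem_singleton.1 hy]
  intro hx
  rw [map_atom, atm_atom, Multiset.mem_singleton] at hx
  rw [hx]
  rfl

theorem rel_add_sum {α β ι : Type*} {r : α → β → Prop} (s : Finset ι) {f : ι → Multiset α}
    {g : ι → Multiset β} (h : ∀ i ∈ s, Multiset.Rel r (f i) (g i)) :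
    Multiset.Rel r (∑ i ∈ s, f i) (∑ i ∈ s, g i) := by
  classical
  induction s using Finset.induction_on with
  | empty => simp
  | insert a s ha ih =>
    rw [Finset.sum_insert ha, Finset.sum_insert ha]
    exact (h a (by simp)).add (ih fun i hi => h i (by simp [hi]))

end DigM

end ProofStr

namespace ProofStr

/-! ### The order on ports and the depth. -/

namespace Graph

variable {G : Graph.{v}}

theorem mem_aux {l : G.Cell} {q : G.Port} : q ∈ G.aux l ↔ q ≠ G.pri l ∧ q ∈ G.portsOf l := by
  classical
  rw [aux, Finset.mem_erase]

theorem mem_bangs {l : G.Cell} : l ∈ G.bangs ↔ l ∈ G.cells ∧ G.type l = .bang := by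
  classical
  rw [bangs, Finset.mem_filter]

theorem mem_auxDoors {p : G.Port} : p ∈ G.auxDoors ↔
    p ∈ G.ports ∧ (∃ l ∈ G.cells, G.type l = .whynot ∧ p ∈ G.aux l) ∧ 0 < G.num p := by
  classical
  rw [auxDoors, Finset.mem_filter]

theorem wires_swap {p q : G.Port} (h : s(p, q) ∈ G.wires) : s(q, p) ∈ G.wires := by
  rwa [Sym2.eq_swap]

theorem axioms_swap {p q : G.Port} (h : s(p, q) ∈ G.axioms) : s(q, p) ∈ G.axioms := by
  rwa [Sym2.eq_swap]

theorem mem_axioms {p q : G.Port} :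
    s(p, q) ∈ G.axioms ↔ s(p, q) ∈ G.wires ∧ p ∉ G.priPorts ∧ q ∉ G.priPorts := by
  simp [axioms]

theorem pri_mem_priPorts {l : G.Cell} (hl : l ∈ G.cells) : G.pri l ∈ G.priPorts := ⟨l, hl, rfl⟩

namespace IsPorts

theorem aux_ne_pri (h : G.IsPorts) {l l' : G.Cell} (hl : l ∈ G.cells) (hl' : l' ∈ G.cells)
    {q : G.Port} (hq : q ∈ G.aux l) : q ≠ G.pri l' := by
  rintro rfl
  rw [mem_aux] at hq
  have := h.portsOf_disjoint l hl l' hl' _ hq.2 (h.pri_mem l' hl')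
  subst this
  exact hq.1 rfl

theorem aux_not_pri (h : G.IsPorts) {l : G.Cell} (hl : l ∈ G.cells)
    {q : G.Port} (hq : q ∈ G.aux l) : q ∉ G.priPorts := by
  rintro ⟨l', hl', rfl⟩
  exact h.aux_ne_pri hl hl' hq rfl

theorem pri_inj (h : G.IsPorts) {l l' : G.Cell} (hl : l ∈ G.cells) (hl' : l' ∈ G.cells)
    (e : G.pri l = G.pri l') : l = l' :=
  h.portsOf_disjoint l hl l' hl' _ (h.pri_mem l hl) (e ▸ h.pri_mem l' hl')

theorem aux_inj (h : G.IsPorts) {l l' : G.Cell} (hl : l ∈ G.cells) (hl' : l' ∈ G.cells)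
    {q : G.Port} (hq : q ∈ G.aux l) (hq' : q ∈ G.aux l') : l = l' :=
  h.portsOf_disjoint l hl l' hl' _ (mem_aux.1 hq).2 (mem_aux.1 hq').2

theorem aux_mem (h : G.IsPorts) {l : G.Cell} (hl : l ∈ G.cells) {q : G.Port}
    (hq : q ∈ G.aux l) : q ∈ G.ports := h.portsOf_subset l hl (mem_aux.1 hq).2

theorem pri_mem_ports (h : G.IsPorts) {l : G.Cell} (hl : l ∈ G.cells) : G.pri l ∈ G.ports :=
  h.portsOf_subset l hl (h.pri_mem l hl)

theorem card_aux (h : G.IsPorts) {l : G.Cell} (hl : l ∈ G.cells) :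
    (G.aux l).card = G.arity l := by
  classical
  rw [aux, Finset.card_erase_of_mem (h.pri_mem l hl), h.portsOf_card l hl, Nat.add_sub_cancel]

theorem exists_aux_bang (h : G.IsPorts) {l : G.Cell} (hl : l ∈ G.bangs) :
    ∃ q, G.aux l = {q} := by
  rw [mem_bangs] at hl
  rw [← Finset.card_eq_one, h.card_aux hl.1, h.arity_bang l hl.1 hl.2]

theorem exists_aux_mult (h : G.IsPorts) {l : G.Cell} (hl : l ∈ G.cells)
    (ht : G.type l = .tensor ∨ G.type l = .par) :
    ∃ q ∈ G.aux l, q ≠ G.left l ∧ ∀ q' ∈ G.aux l, q' ≠ G.left l → q' = q := by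
  classical
  have h1 : ((G.aux l).erase (G.left l)).card = 1 := by
    rw [Finset.card_erase_of_mem (h.left_mem l hl ht), h.card_aux hl, h.arity_mult l hl ht]
  obtain ⟨q, hq⟩ := Finset.card_eq_one.1 h1
  have hq' : q ∈ (G.aux l).erase (G.left l) := by simp [hq]
  rw [Finset.mem_erase] at hq'
  refine ⟨q, hq'.2, hq'.1, fun q' h1 h2 => ?_⟩
  have : q' ∈ (G.aux l).erase (G.left l) := Finset.mem_erase.2 ⟨h2, h1⟩
  simpa [hq] using this

theorem exists_aux_of_cellPorts {p : G.Port} (hp : p ∈ G.cellPorts)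
    (hn : p ∉ G.priPorts) : ∃ l ∈ G.cells, p ∈ G.aux l := by
  obtain ⟨l, hl, hp⟩ := hp
  exact ⟨l, hl, mem_aux.2 ⟨fun e => hn ⟨l, hl, e.symm⟩, hp⟩⟩

end IsPorts

theorem below_aux {l : G.Cell} (hl : l ∈ G.cells) {q : G.Port} (hq : q ∈ G.aux l) :
    G.Below (G.pri l) q := Or.inl ⟨l, hl, rfl, hq⟩

theorem below_wire {l l' : G.Cell} (hl : l ∈ G.cells) (hl' : l' ∈ G.cells) {q : G.Port}
    (hq : q ∈ G.aux l) (hw : s(q, G.pri l') ∈ G.wires) : G.Below q (G.pri l') :=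
  Or.inr ⟨l, hl, l', hl', hq, rfl, hw⟩

namespace IsPPLPS

theorem wire_unique (h : G.IsPPLPS) {p q q' : G.Port} (h1 : s(p, q) ∈ G.wires)
    (h2 : s(p, q') ∈ G.wires) : q = q' := by
  exact Sym2.congr_right.1 (h.wire_disjoint _ h1 _ h2 p (by simp) (by simp))

theorem wire_irrefl (h : G.IsPPLPS) {p q : G.Port} (h1 : s(p, q) ∈ G.wires) : p ≠ q := by
  have := h.wire_ne _ h1
  simpa using this

theorem wire_left (h : G.IsPPLPS) {p q : G.Port} (h1 : s(p, q) ∈ G.wires) : p ∈ G.ports :=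
  h.wire_ports _ h1 p (by simp)

theorem wire_right (h : G.IsPPLPS) {p q : G.Port} (h1 : s(p, q) ∈ G.wires) : q ∈ G.ports :=
  h.wire_ports _ h1 q (by simp)

/-- A port is in at most one cell and one wire, and no auxiliary port is principal. The relation
`Below` is therefore a forest, whose roots are the conclusions (`mem_conclusions_iff`). -/
theorem below_unique (h : G.IsPPLPS) {p p' q : G.Port} (h1 : G.Below p q) (h2 : G.Below p' q) :
    p = p' := by
  rcases h1 with ⟨l, hl, rfl, hq⟩ | ⟨l, hl, l', hl', hp, rfl, hw⟩
  · rcases h2 with ⟨m, hm, rfl, hq'⟩ | ⟨m, hm, m', hm', hp', rfl, hw'⟩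
    · rw [h.aux_inj hl hm hq hq']
    · exact absurd rfl (h.aux_ne_pri hl hm' hq)
  · rcases h2 with ⟨m, hm, rfl, hq'⟩ | ⟨m, hm, m', hm', hp', he, hw'⟩
    · exact absurd rfl (h.aux_ne_pri hm hl' hq')
    · exact h.wire_unique (wires_swap hw) (wires_swap hw')

theorem below_left (h : G.IsPPLPS) {p q : G.Port} (h1 : G.Below p q) : p ∈ G.ports := by
  rcases h1 with ⟨l, hl, rfl, hq⟩ | ⟨l, hl, l', hl', hp, rfl, hw⟩
  · exact h.pri_mem_ports hl
  · exact h.aux_mem hl hp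

theorem below_right (h : G.IsPPLPS) {p q : G.Port} (h1 : G.Below p q) : q ∈ G.ports := by
  rcases h1 with ⟨l, hl, rfl, hq⟩ | ⟨l, hl, l', hl', hp, rfl, hw⟩
  · exact h.aux_mem hl hq
  · exact h.pri_mem_ports hl'

theorem below_irrefl (h : G.IsPPLPS) {p q : G.Port} (h1 : G.Below p q) : p ≠ q := by
  rcases h1 with ⟨l, hl, rfl, hq⟩ | ⟨l, hl, l', hl', hp, rfl, hw⟩
  · exact (h.aux_ne_pri hl hl hq).symm
  · exact h.wire_irrefl hw

/-- There is no cut, so `p` is not principal; and a port of no cell may only be wired to a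
non-principal port. -/
theorem aux_of_wire_pri (h : G.IsPPLPS) {p : G.Port} {l : G.Cell} (hl : l ∈ G.cells)
    (hw : s(p, G.pri l) ∈ G.wires) : ∃ l' ∈ G.cells, p ∈ G.aux l' := by
  have hp : p ∉ G.priPorts := by
    obtain ⟨x, hx, hn⟩ := h.wire_not_cut _ hw
    rcases Sym2.mem_iff.1 hx with rfl | rfl
    · exact hn
    · exact absurd (pri_mem_priPorts hl) hn
  by_cases hc : p ∈ G.cellPorts
  · exact IsPorts.exists_aux_of_cellPorts hc hp
  · obtain ⟨q, _, hq, hpq⟩ := h.wire_of_no_cell p (h.wire_left hw) hc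
    rw [← h.wire_unique hw hpq] at hq
    exact absurd (pri_mem_priPorts hl) hq

theorem below_of_wire_pri (h : G.IsPPLPS) {p : G.Port} {l : G.Cell} (hl : l ∈ G.cells)
    (hw : s(p, G.pri l) ∈ G.wires) : G.Below p (G.pri l) := by
  obtain ⟨l', hl', hp⟩ := h.aux_of_wire_pri hl hw
  exact below_wire hl' hl hp hw

theorem mem_conclusions_iff (h : G.IsPPLPS) {p : G.Port} :
    p ∈ G.conclusions ↔ p ∈ G.ports ∧ ∀ q, ¬ G.Below q p := by
  refine and_congr_right fun hp => ?_
  constructor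
  · rintro hn q (⟨l, hl, rfl, hq⟩ | ⟨l, hl, l', hl', hq, rfl, hw⟩)
    · obtain ⟨q', _, hw⟩ := h.wire_of_not_pri p hp (h.aux_not_pri hl hq)
      exact hn ⟨⟨l, hl, (mem_aux.1 hq).2⟩, _, hw, by simp⟩
    · exact hn ⟨⟨l', hl', h.pri_mem l' hl'⟩, _, hw, by simp⟩
  · rintro hn ⟨hc, w, hw, hpw⟩
    by_cases hpri : p ∈ G.priPorts
    · obtain ⟨l, hl, rfl⟩ := hpri
      obtain ⟨q, rfl⟩ := Sym2.mem_iff_exists.1 hpw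
      exact hn q (h.below_of_wire_pri hl (wires_swap hw))
    · obtain ⟨l, hl, hp⟩ := IsPorts.exists_aux_of_cellPorts hc hpri
      exact hn _ (below_aux hl hp)

/-- A port is principal, or wired to a principal port, or in an axiom. -/
theorem cases_above (h : G.IsPPLPS) {p : G.Port} (hp : p ∈ G.ports) :
    (∃ l ∈ G.cells, G.pri l = p) ∨
      (p ∉ G.priPorts ∧ ∃ l ∈ G.cells, s(p, G.pri l) ∈ G.wires) ∨ ∃ q, s(p, q) ∈ G.axioms := by
  by_cases hpri : p ∈ G.priPorts
  · exact Or.inl hpri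
  · obtain ⟨q, _, hw⟩ := h.wire_of_not_pri p hp hpri
    by_cases hq : q ∈ G.priPorts
    · obtain ⟨l, hl, rfl⟩ := hq
      exact Or.inr (Or.inl ⟨hpri, l, hl, hw⟩)
    · exact Or.inr (Or.inr ⟨q, mem_axioms.2 ⟨hw, hpri, hq⟩⟩)

theorem not_below_of_mem_axioms (h : G.IsPPLPS) {p q r : G.Port} (hpq : s(p, q) ∈ G.axioms) :
    ¬ G.Below p r := by
  rw [mem_axioms] at hpq
  rintro (⟨l, hl, rfl, hq⟩ | ⟨l, hl, l', hl', hq, rfl, hw⟩)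
  · exact hpq.2.1 (pri_mem_priPorts hl)
  · rw [h.wire_unique hpq.1 hw] at hpq
    exact hpq.2.2 (pri_mem_priPorts hl')

/-- The two ports of a wire that is not an axiom. -/
theorem wire_cases (h : G.IsPPLPS) {p q : G.Port} (hw : s(p, q) ∈ G.wires)
    (ha : s(p, q) ∉ G.axioms) : G.Below p q ∧ p ∉ G.priPorts ∧ q ∈ G.priPorts ∨
      G.Below q p ∧ q ∉ G.priPorts ∧ p ∈ G.priPorts := by
  rw [mem_axioms] at ha
  have key : ∀ p q, s(p, q) ∈ G.wires → q ∈ G.priPorts → G.Below p q ∧ p ∉ G.priPorts := by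
    rintro p _ hw ⟨l, hl, rfl⟩
    obtain ⟨l', hl', hp⟩ := h.aux_of_wire_pri hl hw
    exact ⟨below_wire hl' hl hp hw, h.aux_not_pri hl' hp⟩
  by_cases hq : q ∈ G.priPorts
  · exact Or.inl ⟨(key p q hw hq).1, (key p q hw hq).2, hq⟩
  · have hp : p ∈ G.priPorts := by
      by_contra hp
      exact ha ⟨hw, hp, hq⟩
    exact Or.inr ⟨(key q p (wires_swap hw) hp).1, hq, hp⟩

theorem below_pri_iff (h : G.IsPPLPS) {l : G.Cell} (hl : l ∈ G.cells) {q : G.Port} :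
    G.Below (G.pri l) q ↔ q ∈ G.aux l := by
  refine ⟨?_, below_aux hl⟩
  rintro (⟨l', hl', he, hq⟩ | ⟨m, hm, l', hl', hq, rfl, hw⟩)
  · rwa [h.pri_inj hl hl' he]
  · exact absurd rfl (h.aux_ne_pri hm hl hq)

theorem le_cases (h : G.IsPPLPS) {p p' q : G.Port} (hb : G.Below p' p) :
    G.Le q p ↔ q = p ∨ G.Le q p' := by
  constructor
  · intro hq
    rcases Relation.ReflTransGen.cases_tail hq with e | ⟨r, hr, hrp⟩
    · exact Or.inl e.symm
    · exact Or.inr (h.below_unique hb hrp ▸ hr)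
  · rintro (rfl | hq)
    · exact .refl
    · exact hq.tail hb

theorem le_ports (h : G.IsPPLPS) {p q : G.Port} (hq : G.Le p q) (hp : p ∈ G.ports) :
    q ∈ G.ports := by
  induction hq with
  | refl => exact hp
  | tail _ hb _ => exact h.below_right hb

theorem le_root {p q : G.Port} (hp : ∀ r, ¬ G.Below r p) (hq : G.Le q p) :
    q = p := by
  rcases Relation.ReflTransGen.cases_tail hq with e | ⟨r, _, hrp⟩
  · exact e.symm
  · exact absurd hrp (hp r)

end IsPPLPS

namespace IsPLPS

theorem not_le_of_below (h : G.IsPLPS) {p q : G.Port} (hb : G.Below p q) : ¬ G.Le q p := fun hq =>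
  h.below_irrefl hb (h.antisymm p q (.single hb) hq)

/-- The finite set of ports above strictly shrinks on the way up: by acyclicity the starting port
drops out. -/
theorem ind_up (h : G.IsPLPS) {P : G.Port → Prop}
    (hP : ∀ p ∈ G.ports, (∀ q, G.Below p q → P q) → P p) : ∀ p ∈ G.ports, P p := by
  classical
  intro p hp
  induction hn : (G.ports.filter (fun q => G.Le p q)).card using Nat.strong_induction_on
    generalizing p with
  | _ n ih =>
    refine hP p hp fun q hq => ih _ ?_ q (h.below_right hq) rfl
    rw [← hn]
    refine Finset.card_lt_card ((Finset.ssubset_iff_of_subset fun r hr => ?_).2 ⟨p, ?_, ?_⟩)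
    · rw [Finset.mem_filter] at hr ⊢
      exact ⟨hr.1, .head hq hr.2⟩
    · exact Finset.mem_filter.2 ⟨hp, .refl⟩
    · rw [Finset.mem_filter]
      exact fun hc => h.not_le_of_below hq hc.2

theorem ind_down (h : G.IsPLPS) {P : G.Port → Prop}
    (hP : ∀ p ∈ G.ports, (∀ q, G.Below q p → P q) → P p) : ∀ p ∈ G.ports, P p := by
  classical
  intro p hp
  induction hn : (G.ports.filter (fun q => G.Le q p)).card using Nat.strong_induction_on
    generalizing p with
  | _ n ih =>
    refine hP p hp fun q hq => ih _ ?_ q (h.below_left hq) rfl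
    rw [← hn]
    refine Finset.card_lt_card ((Finset.ssubset_iff_of_subset fun r hr => ?_).2 ⟨p, ?_, ?_⟩)
    · rw [Finset.mem_filter] at hr ⊢
      exact ⟨hr.1, .tail hr.2 hq⟩
    · exact Finset.mem_filter.2 ⟨hp, .refl⟩
    · rw [Finset.mem_filter]
      exact fun hc => h.not_le_of_below hq hc.2

-- By `le_cases`, what is below `p` is `p` and what is below `p'`. One step up thus adds one for a
-- `!`-cell with principal port `p'`, and `G.num p` if `p` is an auxiliary door.
open scoped Classical in
theorem depth_below (h : G.IsPLPS) {p p' : G.Port} (hb : G.Below p' p) :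
    G.depth p = G.depth p' + (G.bangs.filter (fun l => G.pri l = p')).card +
      if p ∈ G.auxDoors then G.num p else 0 := by
  have h1 : G.bangs.filter (fun l => G.Le (G.pri l) p ∧ G.pri l ≠ p) =
      G.bangs.filter (fun l => G.Le (G.pri l) p' ∧ G.pri l ≠ p') ∪
        G.bangs.filter (fun l => G.pri l = p') := by
    rw [← Finset.filter_or]
    refine Finset.filter_congr fun l _ => ?_
    rw [h.le_cases hb]
    have h2 : G.Le (G.pri l) p' → G.pri l ≠ p := fun h3 e => h.not_le_of_below hb (e ▸ h3)
    have h3 : G.pri l = p' → G.Le (G.pri l) p' := fun e => e ▸ .refl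
    tauto
  have h2 : G.auxDoors.filter (fun q => G.Le q p) =
      G.auxDoors.filter (fun q => G.Le q p') ∪ G.auxDoors.filter (fun q => q = p) := by
    rw [← Finset.filter_or]
    exact Finset.filter_congr fun l _ => by rw [h.le_cases hb, or_comm]
  have h3 : ∑ q ∈ G.auxDoors.filter (fun q => q = p), G.num q =
      if p ∈ G.auxDoors then G.num p else 0 := by
    have : G.auxDoors.filter (fun q => q = p) = if p ∈ G.auxDoors then {p} else ∅ := by
      ext q
      split_ifs <;> simp <;> aesop
    rw [this]
    split_ifs <;> simp
  rw [depth, depth, h1, h2, Finset.card_union_of_disjoint, Finset.sum_union, h3]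
  · ring
  · rw [Finset.disjoint_filter]
    rintro q _ hq rfl
    exact h.not_le_of_below hb hq
  · rw [Finset.disjoint_filter]
    exact fun q _ hq hq' => hq.2 hq'

theorem depth_root {p : G.Port} (hp : ∀ q, ¬ G.Below q p) : G.depth p = 0 := by
  classical
  rw [depth, Nat.add_eq_zero_iff, Finset.card_eq_zero, Finset.filter_eq_empty_iff,
    Finset.sum_eq_zero_iff]
  refine ⟨fun l _ hl => hl.2 (IsPPLPS.le_root hp hl.1), fun q hq => ?_⟩
  rw [Finset.mem_filter, mem_auxDoors] at hq
  obtain ⟨⟨_, ⟨l, hl, _, hql⟩, _⟩, hq⟩ := hq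
  rw [IsPPLPS.le_root hp hq] at hql
  exact absurd (below_aux hl hql) (hp _)

theorem depth_conclusion (h : G.IsPLPS) {p : G.Port} (hp : p ∈ G.conclusions) :
    G.depth p = 0 := depth_root (h.mem_conclusions_iff.1 hp).2

theorem depth_wire (h : G.IsPLPS) {p q : G.Port} (hb : G.Below p q) (hp : p ∉ G.priPorts)
    (hq : q ∈ G.priPorts) : G.depth q = G.depth p := by
  classical
  rw [h.depth_below hb, if_neg, Finset.filter_false_of_mem]
  · rfl
  · rintro l hl rfl
    exact hp (pri_mem_priPorts (mem_bangs.1 hl).1)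
  · rw [mem_auxDoors]
    rintro ⟨_, ⟨l, hl, _, hql⟩, _⟩
    exact h.aux_not_pri hl hql hq

theorem depth_wire_pri (h : G.IsPLPS) {p : G.Port} {l : G.Cell} (hl : l ∈ G.cells)
    (hw : s(p, G.pri l) ∈ G.wires) : G.depth (G.pri l) = G.depth p := by
  obtain ⟨l', hl', hp⟩ := h.aux_of_wire_pri hl hw
  exact h.depth_wire (h.below_of_wire_pri hl hw) (h.aux_not_pri hl' hp) (pri_mem_priPorts hl)

theorem depth_aux (h : G.IsPLPS) {l : G.Cell} (hl : l ∈ G.cells) {q : G.Port}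
    (hq : q ∈ G.aux l) (hb : G.type l ≠ .bang) (hw : G.type l ≠ .whynot) :
    G.depth q = G.depth (G.pri l) := by
  classical
  rw [h.depth_below (below_aux hl hq), if_neg, Finset.filter_false_of_mem]
  · rfl
  · intro l' hl' he
    rw [mem_bangs] at hl'
    rw [h.pri_inj hl'.1 hl he] at hl'
    exact hb hl'.2
  · rw [mem_auxDoors]
    rintro ⟨_, ⟨l', hl', ht, hql⟩, _⟩
    rw [h.aux_inj hl' hl hql hq] at ht
    exact hw ht

theorem depth_aux_bang (h : G.IsPLPS) {l : G.Cell} (hl : l ∈ G.bangs) {q : G.Port}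
    (hq : q ∈ G.aux l) : G.depth q = G.depth (G.pri l) + 1 := by
  classical
  have hl' := mem_bangs.1 hl
  rw [h.depth_below (below_aux hl'.1 hq), if_neg, show
    G.bangs.filter (fun l' => G.pri l' = G.pri l) = {l} from ?_, Finset.card_singleton, add_zero]
  · ext l'
    rw [Finset.mem_filter, Finset.mem_singleton]
    exact ⟨fun h' => h.pri_inj (mem_bangs.1 h'.1).1 hl'.1 h'.2, fun e => by rw [e]; exact ⟨hl, rfl⟩⟩
  · rw [mem_auxDoors]
    rintro ⟨_, ⟨l', hl'', ht, hql⟩, _⟩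
    rw [h.aux_inj hl'' hl'.1 hql hq, hl'.2] at ht
    cases ht

theorem depth_aux_whynot (h : G.IsPLPS) {l : G.Cell} (hl : l ∈ G.cells)
    (ht : G.type l = .whynot) {q : G.Port} (hq : q ∈ G.aux l) :
    G.depth q = G.depth (G.pri l) + G.num q := by
  classical
  rw [h.depth_below (below_aux hl hq), Finset.filter_false_of_mem, Finset.card_empty, add_zero]
  · split_ifs with hd
    · rfl
    · rw [mem_auxDoors] at hd
      have : ¬ 0 < G.num q := fun h0 => hd ⟨h.aux_mem hl hq, ⟨l, hl, ht, hq⟩, h0⟩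
      omega
  · intro l' hl' he
    rw [mem_bangs] at hl'
    rw [h.pri_inj hl'.1 hl he, ht] at hl'
    cases hl'.2

theorem depth_mono (h : G.IsPLPS) {p q : G.Port} (hpq : G.Le p q) : G.depth p ≤ G.depth q := by
  induction hpq with
  | refl => exact le_rfl
  | tail _ hb ih => rw [h.depth_below hb]; omega

theorem depth_pos_of_auxDoor (h : G.IsPLPS) {p : G.Port} (hp : p ∈ G.auxDoors) :
    0 < G.depth p := by
  obtain ⟨_, ⟨l, hl, ht, hpl⟩, h0⟩ := mem_auxDoors.1 hp
  rw [h.depth_aux_whynot hl ht hpl]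
  omega

end IsPLPS

theorem IsLPS.depth_of_wire (h : G.IsLPS) {p q : G.Port} (hw : s(p, q) ∈ G.wires) :
    G.depth p = G.depth q := by
  by_cases ha : s(p, q) ∈ G.axioms
  · exact h.depth_eq p q ha
  · rcases h.wire_cases hw ha with ⟨h1, h2, h3⟩ | ⟨h1, h2, h3⟩
    · exact (h.depth_wire h1 h2 h3).symm
    · exact h.depth_wire h1 h2 h3

end Graph

end ProofStr

namespace ProofStr

/-! ### Boxes of a proof-structure. -/

namespace PreStr

variable {R : PreStr.{v}}

namespace IsPS

theorem lps (h : R.IsPS) : R.toGraph.IsLPS := by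
  cases h; assumption

theorem b_subset (h : R.IsPS) {v : R.Cell} (hv : v ∈ R.bangs) : R.b v ⊆ R.auxDoors := by
  cases h with
  | mk _ _ hb => exact hb v hv

open scoped Classical in
theorem num_eq (h : R.IsPS) {p : R.Port} (hp : p ∈ R.auxDoors) :
    R.num p = (R.bangs.filter (fun l => p ∈ R.b l)).card := by
  cases h with
  | mk _ _ _ hnum => exact hnum p hp

theorem eq_of_doors (h : R.IsPS) {v : R.Cell} (hv : v ∈ R.bangs) {p q : R.Port}
    (hp : p ∈ R.doors v) (hq : q ∈ R.doors v) (hpq : R.Le p q) : p = q := by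
  cases h with
  | mk _ _ _ _ hdoor => exact hdoor v hv p hp q hq hpq

theorem nested (h : R.IsPS) {v w : R.Cell} (hv : v ∈ R.bangs) (hw : w ∈ R.bangs) :
    Disjoint (R.region v) (R.region w) ∨ R.region v ⊆ R.region w ∨ R.region w ⊆ R.region v := by
  cases h with
  | mk _ _ _ _ _ hnest => exact hnest v hv w hw

theorem box (h : R.IsPS) {v : R.Cell} (hv : v ∈ R.bangs) : (R.box v).IsPS := by
  cases h with
  | mk _ _ _ _ _ _ hbox => exact hbox v hv

theorem b_aux (h : R.IsPS) {v : R.Cell} (hv : v ∈ R.bangs) {p : R.Port} (hp : p ∈ R.b v) :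
    ∃ l ∈ R.cells, R.type l = .whynot ∧ p ∈ R.aux l :=
  (Graph.mem_auxDoors.1 (h.b_subset hv hp)).2.1

theorem door_aux (h : R.IsPS) {v : R.Cell} (hv : v ∈ R.bangs) {p : R.Port} (hp : p ∈ R.doors v) :
    ∃ l ∈ R.cells, p ∈ R.aux l := by
  rcases hp with hp | hp
  · exact ⟨v, (Graph.mem_bangs.1 hv).1, hp⟩
  · obtain ⟨l, hl, _, hp⟩ := h.b_aux hv hp
    exact ⟨l, hl, hp⟩

theorem door_ports (h : R.IsPS) {v : R.Cell} (hv : v ∈ R.bangs) {p : R.Port}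
    (hp : p ∈ R.doors v) : p ∈ R.ports := by
  obtain ⟨l, hl, hp⟩ := h.door_aux hv hp
  exact h.lps.aux_mem hl hp

theorem not_b_of_aux (h : R.IsPS) {v w : R.Cell} (hv : v ∈ R.bangs) (hw : w ∈ R.bangs)
    {p : R.Port} (hp : p ∈ R.aux v) : p ∉ R.b w := by
  intro hb
  obtain ⟨l, hl, ht, hpl⟩ := h.b_aux hw hb
  rw [Graph.mem_bangs] at hv
  rw [h.lps.aux_inj hl hv.1 hpl hp, hv.2] at ht
  cases ht

theorem eq_of_aux_door (h : R.IsPS) {v w : R.Cell} (hv : v ∈ R.bangs) (hw : w ∈ R.bangs)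
    {p : R.Port} (hp : p ∈ R.aux v) (hd : p ∈ R.doors w) : v = w := by
  rcases hd with hd | hd
  · exact h.lps.aux_inj (Graph.mem_bangs.1 hv).1 (Graph.mem_bangs.1 hw).1 hp hd
  · exact absurd hd (h.not_b_of_aux hv hw hp)

theorem door_region (h : R.IsPS) {v : R.Cell} (hv : v ∈ R.bangs) {p : R.Port}
    (hp : p ∈ R.doors v) : p ∈ R.region v := ⟨h.door_ports hv hp, p, hp, .refl⟩

theorem region_up (h : R.IsPS) {v : R.Cell} {p q : R.Port} (hp : p ∈ R.region v)
    (hpq : R.Le p q) : q ∈ R.region v := by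
  obtain ⟨hp, d, hd, hdp⟩ := hp
  exact ⟨h.lps.le_ports hpq hp, d, hd, Relation.ReflTransGen.trans hdp hpq⟩

/-- On the way up, a box is entered only through one of its doors and never left. -/
theorem region_below (h : R.IsPS) {v : R.Cell} {p q : R.Port}
    (hb : R.Below p q) : q ∈ R.region v ↔ q ∈ R.doors v ∨ p ∈ R.region v := by
  constructor
  · rintro ⟨hq, d, hd, hdq⟩
    rcases (h.lps.le_cases hb).1 hdq with rfl | hdp
    · exact Or.inl hd
    · exact Or.inr ⟨h.lps.below_left hb, d, hd, hdp⟩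
  · rintro (hd | hp)
    · exact ⟨h.lps.below_right hb, q, hd, .refl⟩
    · exact h.region_up hp (.single hb)

theorem root_not_region (h : R.IsPS) {v : R.Cell} (hv : v ∈ R.bangs) {p : R.Port}
    (hp : ∀ q, ¬ R.Below q p) : p ∉ R.region v := by
  rintro ⟨_, d, hd, hdp⟩
  obtain ⟨l, hl, hd⟩ := h.door_aux hv hd
  rw [Graph.IsPPLPS.le_root hp hdp] at hd
  exact hp _ (Graph.below_aux hl hd)

/-- Otherwise `p` would be above some door of `v`, and `d` would be strictly above that door. -/
theorem door_not_region (h : R.IsPS) {v : R.Cell} (hv : v ∈ R.bangs) {p d : R.Port}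
    (hd : d ∈ R.doors v) (hb : R.Below p d) : p ∉ R.region v := by
  rintro ⟨_, d', hd', hdp⟩
  have := h.eq_of_doors hv hd' hd (.tail hdp hb)
  subst this
  exact h.lps.not_le_of_below hb hdp

theorem exists_aux (h : R.IsPS) {v : R.Cell} (hv : v ∈ R.bangs) :
    ∃ a, R.aux v = {a} ∧ a ∈ R.aux v ∧ R.Below (R.pri v) a := by
  obtain ⟨a, ha⟩ := h.lps.exists_aux_bang hv
  have : a ∈ R.aux v := by simp [ha]
  exact ⟨a, ha, this, Graph.below_aux (Graph.mem_bangs.1 hv).1 this⟩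

theorem pri_not_region (h : R.IsPS) {v : R.Cell} (hv : v ∈ R.bangs) :
    R.pri v ∉ R.region v := by
  obtain ⟨a, _, ha, hb⟩ := h.exists_aux hv
  exact h.door_not_region hv (Or.inl ha) hb

theorem pri_not_door (h : R.IsPS) {v : R.Cell} (hv : v ∈ R.bangs) {p : R.Port}
    (hp : p ∈ R.priPorts) : p ∉ R.doors v := by
  intro hd
  obtain ⟨l, hl, hd⟩ := h.door_aux hv hd
  exact h.lps.aux_not_pri hl hd hp

open scoped Classical in
theorem card_b (h : R.IsPS) {l : R.Cell} (hl : l ∈ R.cells) (ht : R.type l = .whynot)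
    {p : R.Port} (hp : p ∈ R.aux l) :
    R.num p = (R.bangs.filter (fun w => p ∈ R.b w)).card := by
  by_cases hd : p ∈ R.auxDoors
  · exact h.num_eq hd
  · rw [Finset.filter_false_of_mem fun w hw hb => hd (h.b_subset hw hb), Finset.card_empty]
    by_contra hn
    exact hd (Graph.mem_auxDoors.2 ⟨h.lps.aux_mem hl hp, ⟨l, hl, ht, hp⟩, Nat.pos_of_ne_zero hn⟩)

open scoped Classical in
/-- The depth of a port is the number of boxes that contain it. -/
theorem depth_eq_card (h : R.IsPS) : ∀ p ∈ R.ports,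
    R.depth p = (R.bangs.filter (fun w => p ∈ R.region w)).card := by
  refine h.lps.ind_down fun p hp ih => ?_
  by_cases hr : ∀ q, ¬ R.Below q p
  · rw [Graph.IsPLPS.depth_root hr, Finset.filter_false_of_mem fun w hw => h.root_not_region hw hr]
    rfl
  · push Not at hr
    obtain ⟨p', hb⟩ := hr
    -- The boxes around `p` are those around `p'`, the one entered through its `!`-cell, and those
    -- entered through the auxiliary door `p`. These match the three terms of `depth_below`.
    have h1 : R.bangs.filter (fun w => p ∈ R.region w) =
        R.bangs.filter (fun w => p' ∈ R.region w) ∪ (R.bangs.filter (fun w => R.pri w = p') ∪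
          R.bangs.filter (fun w => p ∈ R.b w)) := by
      rw [← Finset.filter_or, ← Finset.filter_or]
      refine Finset.filter_congr fun w hw => ?_
      rw [h.region_below hb, or_comm]
      refine or_congr_right (or_congr_left ?_)
      rw [← h.lps.below_pri_iff (Graph.mem_bangs.1 hw).1]
      exact ⟨fun hb' => h.lps.below_unique hb' hb, fun e => e ▸ hb⟩
    have h2 : (if p ∈ R.auxDoors then R.num p else 0) =
        (R.bangs.filter (fun w => p ∈ R.b w)).card := by
      split_ifs with hd
      · exact h.num_eq hd
      · rw [Finset.filter_false_of_mem fun w hw hb => hd (h.b_subset hw hb), Finset.card_empty]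
    rw [h.lps.depth_below hb, ih p' hb, h1, h2, Finset.card_union_of_disjoint,
      Finset.card_union_of_disjoint, add_assoc]
    · rw [Finset.disjoint_filter]
      rintro w hw rfl hb'
      exact h.not_b_of_aux hw hw ((h.lps.below_pri_iff (Graph.mem_bangs.1 hw).1).1 hb) hb'
    · rw [← Finset.filter_or, Finset.disjoint_filter]
      rintro w hw hr hd
      refine h.door_not_region hw (d := p) ?_ hb hr
      rcases hd with rfl | hd
      · exact Or.inl ((h.lps.below_pri_iff (Graph.mem_bangs.1 hw).1).1 hb)
      · exact Or.inr hd

theorem depth_eq_zero_iff (h : R.IsPS) {p : R.Port} (hp : p ∈ R.ports) :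
    R.depth p = 0 ↔ ∀ w ∈ R.bangs, p ∉ R.region w := by
  classical
  rw [h.depth_eq_card p hp, Finset.card_eq_zero, Finset.filter_eq_empty_iff]

theorem pri_ports (h : R.IsPS) {v : R.Cell} (hv : v ∈ R.bangs) : R.pri v ∈ R.ports :=
  h.lps.pri_mem_ports (Graph.mem_bangs.1 hv).1

/-- A box `w` around the box of `v` would contain the auxiliary port of `v`: either as a door, and
then `w = v`, or with the principal port of `v` inside `w`, against its depth zero. -/
theorem region_subset (h : R.IsPS) {v w : R.Cell} (hv : v ∈ R.bangs) (h0 : R.depth (R.pri v) = 0)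
    (hw : w ∈ R.bangs) {p : R.Port} (hpv : p ∈ R.region v) (hpw : p ∈ R.region w) :
    R.region w ⊆ R.region v := by
  rcases h.nested hv hw with hd | hs | hs
  · exact absurd hpw (Set.disjoint_left.1 hd hpv)
  · obtain ⟨a, _, ha, hb⟩ := h.exists_aux hv
    rcases (h.region_below hb).1 (hs (h.door_region hv (Or.inl ha))) with hd | hp
    · rw [h.eq_of_aux_door hv hw ha hd]
    · exact absurd hp ((h.depth_eq_zero_iff (h.pri_ports hv)).1 h0 w hw)
  · exact hs

theorem pri_mem_region (h : R.IsPS) {v w : R.Cell} (hv : v ∈ R.bangs)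
    (hw : w ∈ R.bangs) (hne : w ≠ v) (hs : R.region w ⊆ R.region v) : R.pri w ∈ R.region v := by
  obtain ⟨a, _, ha, hb⟩ := h.exists_aux hw
  rcases (h.region_below hb).1 (hs (h.door_region hw (Or.inl ha))) with hd | hp
  · exact absurd (h.eq_of_aux_door hw hv ha hd) hne
  · exact hp

theorem exists_box (h : R.IsPS) {p : R.Port} (hp : p ∈ R.ports) (h0 : R.depth p ≠ 0) :
    ∃ v ∈ R.bangs, R.depth (R.pri v) = 0 ∧ p ∈ R.region v := by
  classical
  rw [Ne, h.depth_eq_zero_iff hp] at h0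
  push Not at h0
  obtain ⟨w, hw, hpw⟩ := h0
  -- The outermost box around `p` is one with the largest region: a box containing the principal
  -- port of `v` would have a strictly larger region.
  obtain ⟨v, hv, hmax⟩ := Finset.exists_max_image (R.bangs.filter (fun w => p ∈ R.region w))
    (fun w => (R.region w).ncard) ⟨w, by simp [hw, hpw]⟩
  rw [Finset.mem_filter] at hv
  refine ⟨v, hv.1, ?_, hv.2⟩
  rw [h.depth_eq_zero_iff (h.pri_ports hv.1)]
  intro w hw hpw
  have hne := h.pri_not_region hv.1
  have hvw : R.region v ⊆ R.region w := by
    rcases h.nested hv.1 hw with hd | hs | hs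
    · obtain ⟨a, _, ha, hb⟩ := h.exists_aux hv.1
      exact absurd (h.region_up hpw (.single hb))
        (Set.disjoint_left.1 hd (h.door_region hv.1 (Or.inl ha)))
    · exact hs
    · exact absurd (hs hpw) hne
  have hfin : (R.region w).Finite := R.ports.finite_toSet.subset fun q hq => hq.1
  have hlt := Set.ncard_lt_ncard (Set.ssubset_iff_of_subset hvw |>.2 ⟨_, hpw, hne⟩) hfin
  exact absurd (hmax w (Finset.mem_filter.2 ⟨hw, hvw hv.2⟩)) (not_le.2 hlt)

/-- A box around `q` would meet the outermost box of `v` at the door `p`, hence lie inside it,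
whereas `q` is outside. -/
theorem depth_pri_of_b (h : R.IsPS) {v : R.Cell} (hv : v ∈ R.bangs)
    (h0 : R.depth (R.pri v) = 0) {p q : R.Port} (hp : p ∈ R.b v) (hb : R.Below q p) :
    R.depth q = 0 := by
  rw [h.depth_eq_zero_iff (h.lps.below_left hb)]
  intro w hw hq
  exact h.door_not_region hv (Or.inr hp) hb
    (h.region_subset hv h0 hw (h.door_region hv (Or.inr hp)) (h.region_up hq (.single hb)) hq)

theorem inBox_of_not_aux {v : R.Cell} {p : R.Port} (hp : p ∈ R.region v)
    (ha : p ∉ R.aux v) : R.InBox v p := ⟨hp, fun hn => ha hn.1⟩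

theorem inBox_of_pri (h : R.IsPS) {v : R.Cell} (hv : v ∈ R.bangs) {p : R.Port}
    (hp : p ∈ R.region v) (hpri : p ∈ R.priPorts) : R.InBox v p :=
  inBox_of_not_aux hp fun ha => h.lps.aux_not_pri (Graph.mem_bangs.1 hv).1 ha hpri

theorem inBox_of_mem_axioms (h : R.IsPS) {v : R.Cell} {p q : R.Port}
    (hp : p ∈ R.region v) (hpq : s(p, q) ∈ R.axioms) : R.InBox v p := by
  refine ⟨hp, ?_⟩
  rintro ⟨_, l, hl, hw⟩
  rw [Graph.mem_axioms] at hpq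
  rw [h.lps.wire_unique hpq.1 hw] at hpq
  exact hpq.2.2 (Graph.pri_mem_priPorts hl)

/-- A cell that meets the region but has its principal port outside has a door among its auxiliary
ports: it is `v` or the cell of an element of `R.b v`, both of which are excluded. -/
theorem inl_mem_cells (h : R.IsPS) {v : R.Cell} (hv : v ∈ R.bangs) {l : R.Cell} :
    Sum.inl l ∈ (R.box v).cells ↔ l ∈ R.cells ∧ R.pri l ∈ R.region v := by
  simp only [PreStr.box, Finset.inl_mem_disjSum, Finset.mem_filter]
  refine and_congr_right fun hl => ?_
  constructor
  · rintro ⟨hne, ⟨p, hp, hpr⟩, hb⟩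
    by_cases he : p = R.pri l
    · rwa [← he]
    · have ha : p ∈ R.aux l := Graph.mem_aux.2 ⟨he, hp⟩
      rcases (h.region_below (Graph.below_aux hl ha)).1 hpr with (hd | hd) | hpr
      · exact absurd (h.lps.aux_inj hl (Graph.mem_bangs.1 hv).1 ha hd) hne
      · exact absurd ⟨p, hp, hd⟩ hb
      · exact hpr
  · intro hr
    refine ⟨?_, ⟨_, h.lps.pri_mem l hl, hr⟩, ?_⟩
    · rintro rfl
      exact h.pri_not_region hv hr
    · rintro ⟨p, hp, hpb⟩
      by_cases he : p = R.pri l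
      · exact h.pri_not_door hv (Graph.pri_mem_priPorts hl) (he ▸ Or.inr hpb)
      · exact h.door_not_region hv (Or.inr hpb) (Graph.below_aux hl (Graph.mem_aux.2 ⟨he, hp⟩)) hr

end IsPS

theorem inr_mem_cells {v : R.Cell} {p : R.Port} :
    Sum.inr p ∈ (R.box v).cells ↔ p ∈ R.b v := by
  simp [PreStr.box]

theorem inl_mem_ports {v : R.Cell} {p : R.Port} :
    Sum.inl p ∈ (R.box v).ports ↔ R.InBox v p := by
  simp only [PreStr.box, Finset.inl_mem_disjSum, Finset.mem_filter]
  exact ⟨fun hp => hp.2, fun hp => ⟨hp.1.1, hp⟩⟩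

theorem inr_mem_ports {v : R.Cell} {p : R.Port} :
    Sum.inr p ∈ (R.box v).ports ↔ p ∈ R.b v := by
  simp [PreStr.box]

theorem aux_box_inl {v l : R.Cell} :
    (R.box v).aux (Sum.inl l) = (R.aux l).map Function.Embedding.inl := by
  ext x
  rw [Graph.mem_aux, Finset.mem_map]
  simp only [PreStr.box, Sum.elim_inl, Finset.mem_map, Function.Embedding.inl_apply]
  constructor
  · rintro ⟨hne, p, hp, rfl⟩
    exact ⟨p, Graph.mem_aux.2 ⟨fun e => hne (e ▸ rfl), hp⟩, rfl⟩
  · rintro ⟨p, hp, rfl⟩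
    rw [Graph.mem_aux] at hp
    exact ⟨fun e => hp.1 (Sum.inl_injective e), p, hp.2, rfl⟩

theorem aux_box_inr {v : R.Cell} {p : R.Port} :
    (R.box v).aux (Sum.inr p) = {Sum.inl p} := by
  ext x
  rw [Graph.mem_aux]
  simp only [PreStr.box, Sum.elim_inr, Finset.mem_insert, Finset.mem_singleton]
  constructor
  · rintro ⟨hne, rfl | rfl⟩
    · rfl
    · exact absurd rfl hne
  · rintro rfl
    simp

theorem inl_mem_aux {v l : R.Cell} {p : R.Port} :
    Sum.inl p ∈ (R.box v).aux (Sum.inl l) ↔ p ∈ R.aux l := by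
  rw [aux_box_inl, Finset.mem_map]
  simp

theorem inr_not_mem_aux {v : R.Cell} {l : (R.box v).Cell} {p : R.Port} :
    Sum.inr p ∉ (R.box v).aux l := by
  rcases l with l | q
  · rw [aux_box_inl, Finset.mem_map]
    simp
  · rw [aux_box_inr]
    simp

theorem mem_wires_box {v : R.Cell} {x y : (R.box v).Port} :
    s(x, y) ∈ (R.box v).wires ↔ ∃ p q, x = Sum.inl p ∧ y = Sum.inl q ∧ s(p, q) ∈ R.wires ∧
      R.InBox v p ∧ R.InBox v q := by
  constructor
  · rintro ⟨w, hw, hin, he⟩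
    induction w using Sym2.ind with
    | _ p q =>
      rw [Sym2.map_mk, Sym2.eq_iff] at he
      have hp := hin p (by simp)
      have hq := hin q (by simp)
      rcases he with ⟨rfl, rfl⟩ | ⟨rfl, rfl⟩
      · exact ⟨p, q, rfl, rfl, hw, hp, hq⟩
      · exact ⟨q, p, rfl, rfl, Graph.wires_swap hw, hq, hp⟩
  · rintro ⟨p, q, rfl, rfl, hw, hp, hq⟩
    refine ⟨s(p, q), hw, fun r hr => ?_, rfl⟩
    rcases Sym2.mem_iff.1 hr with rfl | rfl
    · exact hp
    · exact hq

theorem wires_box {v : R.Cell} {p q : R.Port} :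
    s(Sum.inl p, Sum.inl q) ∈ (R.box v).wires ↔ s(p, q) ∈ R.wires ∧ R.InBox v p ∧ R.InBox v q := by
  rw [mem_wires_box]
  constructor
  · rintro ⟨p', q', hp, hq, hw⟩
    rw [Sum.inl_injective hp, Sum.inl_injective hq]
    exact hw
  · exact fun hw => ⟨p, q, rfl, rfl, hw⟩

namespace IsPS

theorem priPorts_box (h : R.IsPS) {v : R.Cell} (hv : v ∈ R.bangs) {p : R.Port}
    (hp : p ∈ R.region v) : Sum.inl p ∈ (R.box v).priPorts ↔ p ∈ R.priPorts := by
  constructor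
  · rintro ⟨l | q, hl, he⟩
    · rw [h.inl_mem_cells hv] at hl
      exact ⟨l, hl.1, Sum.inl_injective he⟩
    · cases he
  · rintro ⟨l, hl, rfl⟩
    exact ⟨Sum.inl l, (h.inl_mem_cells hv).2 ⟨hl, hp⟩, rfl⟩

theorem axioms_box (h : R.IsPS) {v : R.Cell} (hv : v ∈ R.bangs) {p q : R.Port} :
    s(Sum.inl p, Sum.inl q) ∈ (R.box v).axioms ↔
      s(p, q) ∈ R.axioms ∧ R.InBox v p ∧ R.InBox v q := by
  rw [Graph.mem_axioms, Graph.mem_axioms, wires_box]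
  constructor
  · rintro ⟨⟨hw, hp, hq⟩, hp', hq'⟩
    rw [h.priPorts_box hv hp.1] at hp'
    rw [h.priPorts_box hv hq.1] at hq'
    exact ⟨⟨hw, hp', hq'⟩, hp, hq⟩
  · rintro ⟨⟨hw, hp', hq'⟩, hp, hq⟩
    rw [h.priPorts_box hv hp.1, h.priPorts_box hv hq.1]
    exact ⟨⟨hw, hp, hq⟩, hp', hq'⟩

/-- An axiom does not cross the border of a box: the box is itself a proof-structure, so the
non-principal port `p` must be wired inside it, and its wires come from those of `R`. -/
theorem inBox_mem_axioms (h : R.IsPS) {v : R.Cell} (hv : v ∈ R.bangs) {p q : R.Port}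
    (hp : p ∈ R.region v) (hpq : s(p, q) ∈ R.axioms) : R.InBox v q := by
  have hp' := h.inBox_of_mem_axioms hp hpq
  rw [Graph.mem_axioms] at hpq
  obtain ⟨x, _, hw⟩ := (h.box hv).lps.wire_of_not_pri (Sum.inl p) (inl_mem_ports.2 hp')
    (by rw [h.priPorts_box hv hp]; exact hpq.2.1)
  obtain ⟨p', q', he, rfl, hw, _, hq⟩ := mem_wires_box.1 hw
  obtain rfl := Sum.inl_injective he
  rwa [h.lps.wire_unique hpq.1 hw]

theorem mem_bangs_box (h : R.IsPS) {v : R.Cell} (hv : v ∈ R.bangs) {x : (R.box v).Cell} :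
    x ∈ (R.box v).bangs ↔ ∃ w, x = Sum.inl w ∧ w ∈ R.bangs ∧ R.pri w ∈ R.region v := by
  rw [Graph.mem_bangs]
  rcases x with w | p
  · rw [h.inl_mem_cells hv]
    constructor
    · rintro ⟨hw, ht⟩
      exact ⟨w, rfl, Graph.mem_bangs.2 ⟨hw.1, ht⟩, hw.2⟩
    · rintro ⟨w', he, hw, hr⟩
      obtain rfl := Sum.inl_injective he
      rw [Graph.mem_bangs] at hw
      exact ⟨⟨hw.1, hr⟩, hw.2⟩
  · constructor
    · rintro ⟨_, ht⟩
      cases ht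
    · rintro ⟨w, he, _⟩
      cases he

theorem below_of_box (h : R.IsPS) {v : R.Cell} (hv : v ∈ R.bangs) {p : R.Port}
    {x : (R.box v).Port} (hb : (R.box v).Below (Sum.inl p) x) :
    ∃ q, x = Sum.inl q ∧ R.Below p q ∧ R.InBox v p ∧ R.InBox v q := by
  have h1 := (h.box hv).lps.below_left hb
  have h2 := (h.box hv).lps.below_right hb
  rcases hb with ⟨l | r, hl, he, hx⟩ | ⟨l | r, hl, l' | r', hl', hp, rfl, hw⟩
  · obtain rfl := Sum.inl_injective he
    rcases x with q | q
    · rw [h.inl_mem_cells hv] at hl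
      exact ⟨q, rfl, Graph.below_aux hl.1 (inl_mem_aux.1 hx), inl_mem_ports.1 h1,
        inl_mem_ports.1 h2⟩
    · exact absurd hx inr_not_mem_aux
  · cases he
  · rw [h.inl_mem_cells hv] at hl'
    exact ⟨_, rfl, h.lps.below_of_wire_pri hl'.1 (wires_box.1 hw).1, inl_mem_ports.1 h1,
      inl_mem_ports.1 h2⟩
  · obtain ⟨_, _, _, he, _⟩ := mem_wires_box.1 hw
    cases he
  · rw [h.inl_mem_cells hv] at hl'
    exact ⟨_, rfl, h.lps.below_of_wire_pri hl'.1 (wires_box.1 hw).1, inl_mem_ports.1 h1,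
      inl_mem_ports.1 h2⟩
  · obtain ⟨_, _, _, he, _⟩ := mem_wires_box.1 hw
    cases he

theorem below_inr_box {v : R.Cell} {p : R.Port}
    {x : (R.box v).Port} (hb : (R.box v).Below (Sum.inr p) x) : p ∈ R.b v ∧ x = Sum.inl p := by
  rcases hb with ⟨l | r, hl, he, hx⟩ | ⟨l, hl, l', hl', hp, rfl, hw⟩
  · cases he
  · obtain rfl := Sum.inr_injective he
    rw [aux_box_inr, Finset.mem_singleton] at hx
    exact ⟨inr_mem_cells.1 hl, hx⟩
  · exact absurd hp inr_not_mem_aux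

theorem below_box (h : R.IsPS) {v : R.Cell} (hv : v ∈ R.bangs) {p q : R.Port}
    (hb : R.Below p q) (hp : R.InBox v p) :
    (R.box v).Below (Sum.inl p) (Sum.inl q) ∧ R.InBox v q := by
  have hq := h.region_up hp.1 (.single hb)
  rcases hb with ⟨l, hl, rfl, hql⟩ | ⟨l, hl, l', hl', hpl, rfl, hw⟩
  · refine ⟨Graph.below_aux ((h.inl_mem_cells hv).2 ⟨hl, hp.1⟩) (inl_mem_aux.2 hql),
      inBox_of_not_aux hq fun ha => ?_⟩
    rw [h.lps.aux_inj hl (Graph.mem_bangs.1 hv).1 hql ha] at hp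
    exact h.pri_not_region hv hp.1
  · have hq' := h.inBox_of_pri hv hq (Graph.pri_mem_priPorts hl')
    refine ⟨(h.box hv).lps.below_of_wire_pri ((h.inl_mem_cells hv).2 ⟨hl', hq⟩)
      (wires_box.2 ⟨hw, hp, hq'⟩), hq'⟩

theorem le_of_box (h : R.IsPS) {v : R.Cell} (hv : v ∈ R.bangs) {p : R.Port}
    {x : (R.box v).Port} (hb : (R.box v).Le (Sum.inl p) x) : ∃ q, x = Sum.inl q ∧ R.Le p q := by
  induction hb with
  | refl => exact ⟨p, rfl, .refl⟩
  | tail _ hb ih =>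
    obtain ⟨q, rfl, hq⟩ := ih
    obtain ⟨r, rfl, hr, _⟩ := h.below_of_box hv hb
    exact ⟨r, rfl, .tail hq hr⟩

theorem le_box (h : R.IsPS) {v : R.Cell} (hv : v ∈ R.bangs) {p q : R.Port}
    (hb : R.Le p q) (hp : R.InBox v p) :
    (R.box v).Le (Sum.inl p) (Sum.inl q) ∧ R.InBox v q := by
  induction hb with
  | refl => exact ⟨.refl, hp⟩
  | tail _ hb ih =>
    obtain ⟨h1, h2⟩ := h.below_box hv hb ih.2
    exact ⟨.tail ih.1 h1, h2⟩

theorem door_box {v w : R.Cell} {x : (R.box v).Port} :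
    x ∈ (R.box v).doors (Sum.inl w) ↔ ∃ d ∈ R.doors w, x = Sum.inl d := by
  rcases x with p | p
  · refine ⟨?_, ?_⟩
    · rintro (hx | hx)
      · exact ⟨p, Or.inl (inl_mem_aux.1 hx), rfl⟩
      · exact ⟨p, Or.inr (by simpa [PreStr.box] using hx), rfl⟩
    · rintro ⟨d, hd, he⟩
      obtain rfl := Sum.inl_injective he
      rcases hd with hd | hd
      · exact Or.inl (inl_mem_aux.2 hd)
      · exact Or.inr (by simpa [PreStr.box] using hd)
  · refine ⟨?_, ?_⟩
    · rintro (hx | hx)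
      · exact absurd hx inr_not_mem_aux
      · simp [PreStr.box] at hx
    · rintro ⟨d, hd, he⟩
      cases he

/-- The doors of `w` are all ports of the box of `v`, since none is the auxiliary port of `v`. The
paths that start from them survive in this box. -/
theorem region_box (h : R.IsPS) {v w : R.Cell} (hv : v ∈ R.bangs) (h0 : R.depth (R.pri v) = 0)
    (hw : w ∈ R.bangs) (hwv : R.pri w ∈ R.region v) {p : R.Port} (hp : R.InBox v p) :
    Sum.inl p ∈ (R.box v).region (Sum.inl w) ↔ p ∈ R.region w := by
  constructor
  · rintro ⟨_, x, hx, hle⟩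
    obtain ⟨d, hd, rfl⟩ := door_box.1 hx
    obtain ⟨q, he, hle⟩ := h.le_of_box hv hle
    obtain rfl := Sum.inl_injective he
    exact ⟨hp.1.1, d, hd, hle⟩
  · rintro ⟨_, d, hd, hle⟩
    obtain ⟨a, _, ha, hb⟩ := h.exists_aux hw
    have hs := h.region_subset hv h0 hw (h.region_up hwv (.single hb))
      (h.door_region hw (Or.inl ha))
    have hd' : R.InBox v d := by
      refine inBox_of_not_aux (hs (h.door_region hw hd)) fun hda => ?_
      rw [← h.eq_of_aux_door hv hw hda hd] at hwv
      exact h.pri_not_region hv hwv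
    exact ⟨inl_mem_ports.2 hp, _, door_box.2 ⟨d, hd, rfl⟩, (h.le_box hv hle hd').1⟩

/-- Counting boxes with `depth_eq_card`: around `p` there are `v` itself and the boxes whose
principal port is in the region of `v`, which are the boxes of the box of `v`. -/
theorem depth_box (h : R.IsPS) {v : R.Cell} (hv : v ∈ R.bangs) (h0 : R.depth (R.pri v) = 0)
    {p : R.Port} (hp : R.InBox v p) : R.depth p = (R.box v).depth (Sum.inl p) + 1 := by
  classical
  rw [h.depth_eq_card p hp.1.1, (h.box hv).depth_eq_card _ (inl_mem_ports.2 hp)]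
  have h1 : R.bangs.filter (fun w => p ∈ R.region w) =
      insert v (R.bangs.filter (fun w => R.pri w ∈ R.region v ∧ p ∈ R.region w)) := by
    ext w
    rw [Finset.mem_insert, Finset.mem_filter, Finset.mem_filter]
    constructor
    · rintro ⟨hw, hpw⟩
      by_cases hne : w = v
      · exact Or.inl hne
      · exact Or.inr ⟨hw, h.pri_mem_region hv hw hne (h.region_subset hv h0 hw hp.1 hpw), hpw⟩
    · rintro (rfl | ⟨hw, _, hpw⟩)
      · exact ⟨hv, hp.1⟩
      · exact ⟨hw, hpw⟩
  have h2 : (R.box v).bangs.filter (fun x => Sum.inl p ∈ (R.box v).region x) =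
      (R.bangs.filter (fun w => R.pri w ∈ R.region v ∧ p ∈ R.region w)).map
        Function.Embedding.inl := by
    ext x
    rw [Finset.mem_filter, h.mem_bangs_box hv, Finset.mem_map]
    constructor
    · rintro ⟨⟨w, rfl, hw, hr⟩, hx⟩
      rw [h.region_box hv h0 hw hr hp] at hx
      exact ⟨w, Finset.mem_filter.2 ⟨hw, hr, hx⟩, rfl⟩
    · rintro ⟨w, hw, rfl⟩
      rw [Finset.mem_filter] at hw
      exact ⟨⟨w, rfl, hw.1, hw.2.1⟩, (h.region_box hv h0 hw.1 hw.2.1 hp).2 hw.2.2⟩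
  rw [h1, h2, Finset.card_map, Finset.card_insert_of_notMem]
  rw [Finset.mem_filter]
  exact fun hn => h.pri_not_region hv hn.2.1

theorem not_below_inr (h : R.IsPS) {v : R.Cell} (hv : v ∈ R.bangs) {p : R.Port}
    (x : (R.box v).Port) : ¬ (R.box v).Below x (Sum.inr p) := by
  intro hb
  rcases x with q | q
  · obtain ⟨_, he, _⟩ := h.below_of_box hv hb
    cases he
  · cases (below_inr_box hb).2

/-- The box of `v` is not counted inside itself, but it does not have `p` as a door since the cell
of `p` is inside. Every other box with door `p` is inside too. -/
theorem num_box (h : R.IsPS) {v : R.Cell} (hv : v ∈ R.bangs) (h0 : R.depth (R.pri v) = 0)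
    {l : R.Cell} (hl : l ∈ R.cells) (hr : R.pri l ∈ R.region v) (ht : R.type l = .whynot)
    {p : R.Port} (hp : p ∈ R.aux l) : (R.box v).num (Sum.inl p) = R.num p := by
  classical
  rw [h.card_b hl ht hp]
  show (R.bangs.filter _).card = _
  congr 1
  refine Finset.filter_congr fun w hw => ⟨fun hn => hn.2.2, fun hb => ?_⟩
  have hpr := h.region_up hr (.single (Graph.below_aux hl hp))
  have hne : w ≠ v := by
    rintro rfl
    exact h.door_not_region hw (Or.inr hb) (Graph.below_aux hl hp) hr
  refine ⟨hne, ⟨R.pri w, h.lps.pri_mem w (Graph.mem_bangs.1 hw).1, ?_⟩, hb⟩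
  exact h.pri_mem_region hv hw hne
    (h.region_subset hv h0 hw hpr (h.door_region hw (Or.inr hb)))

/-- The doors in `R.b v` have new `?`-cells below them, so the only old port left without a port
below is the auxiliary port of `v`, or the principal port wired to it when it is removed. -/
theorem conclusion_box (h : R.IsPS) {v : R.Cell} (hv : v ∈ R.bangs) {p : R.Port}
    (hp : Sum.inl p ∈ (R.box v).conclusions) : R.InBox v p ∧
      ∃ a ∈ R.aux v, p = a ∨ (s(a, p) ∈ R.wires ∧ p ∈ R.priPorts) := by
  rw [(h.box hv).lps.mem_conclusions_iff, inl_mem_ports] at hp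
  refine ⟨hp.1, ?_⟩
  have : ∃ q, R.Below q p := by
    by_contra hn
    push Not at hn
    exact h.root_not_region hv hn hp.1.1
  obtain ⟨q, hb⟩ := this
  rcases (h.region_below hb).1 hp.1.1 with (hd | hd) | hq
  · exact ⟨p, hd, Or.inl rfl⟩
  · refine absurd (Graph.below_aux (inr_mem_cells.2 hd) ?_) (hp.2 (Sum.inr p))
    rw [aux_box_inr]
    simp
  · by_cases hin : R.InBox v q
    · exact absurd (h.below_box hv hb hin).1 (hp.2 _)
    · have ha : q ∈ R.aux v := by
        by_contra ha
        exact hin (inBox_of_not_aux hq ha)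
      refine ⟨q, ha, Or.inr ?_⟩
      rcases hb with ⟨l, hl, rfl, hql⟩ | ⟨l, hl, l', hl', hpl, rfl, hw⟩
      · exact absurd (Graph.pri_mem_priPorts hl)
          (h.lps.aux_not_pri (Graph.mem_bangs.1 hv).1 ha)
      · exact ⟨hw, Graph.pri_mem_priPorts hl'⟩

theorem conclusion_box_unique (h : R.IsPS) {v : R.Cell} (hv : v ∈ R.bangs) {p q : R.Port}
    (hp : Sum.inl p ∈ (R.box v).conclusions) (hq : Sum.inl q ∈ (R.box v).conclusions) :
    p = q := by
  obtain ⟨hp, a, ha, hpa⟩ := h.conclusion_box hv hp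
  obtain ⟨hq, a', ha', hqa⟩ := h.conclusion_box hv hq
  obtain ⟨b, hb, _⟩ := h.exists_aux hv
  rw [hb, Finset.mem_singleton] at ha ha'
  subst ha
  subst ha'
  have key : R.InBox v a' → ¬ ∃ q, s(a', q) ∈ R.wires ∧ q ∈ R.priPorts := by
    rintro hin ⟨_, hw, l, hl, rfl⟩
    exact hin.2 ⟨by simp [hb], l, hl, hw⟩
  rcases hpa with rfl | hpa
  · rcases hqa with rfl | hqa
    · rfl
    · exact absurd ⟨q, hqa⟩ (key hp)
  · rcases hqa with rfl | hqa
    · exact absurd ⟨p, hpa⟩ (key hq)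
    · exact h.lps.wire_unique hpa.1 hqa.1

theorem exists_conclusion_box (h : R.IsPS) {v : R.Cell} (hv : v ∈ R.bangs) :
    ∃ p, Sum.inl p ∈ (R.box v).conclusions ∧ R.Le (R.pri v) p := by
  obtain ⟨a, hav, ha, hb⟩ := h.exists_aux hv
  have har := h.door_region hv (Or.inl ha)
  by_cases hw : ∃ l ∈ R.cells, s(a, R.pri l) ∈ R.wires
  · obtain ⟨l, hl, hw⟩ := hw
    have hbl := h.lps.below_of_wire_pri hl hw
    refine ⟨R.pri l, (h.box hv).lps.mem_conclusions_iff.2 ⟨?_, ?_⟩, .tail (.single hb) hbl⟩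
    · exact inl_mem_ports.2 (h.inBox_of_pri hv (h.region_up har (.single hbl))
        (Graph.pri_mem_priPorts hl))
    · rintro (x | x) hx
      · obtain ⟨_, he, hx, hin, _⟩ := h.below_of_box hv hx
        obtain rfl := Sum.inl_injective he
        rw [h.lps.below_unique hx hbl] at hin
        exact hin.2 ⟨ha, l, hl, hw⟩
      · obtain ⟨hx, he⟩ := below_inr_box hx
        obtain rfl := Sum.inl_injective he
        exact h.pri_not_door hv (Graph.pri_mem_priPorts hl) (Or.inr hx)
  · refine ⟨a, (h.box hv).lps.mem_conclusions_iff.2 ⟨?_, ?_⟩, .single hb⟩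
    · exact inl_mem_ports.2 ⟨har, fun hn => hw hn.2⟩
    · rintro (x | x) hx
      · obtain ⟨_, he, hx, hin, _⟩ := h.below_of_box hv hx
        obtain rfl := Sum.inl_injective he
        rw [h.lps.below_unique hx hb] at hin
        exact h.pri_not_region hv hin.1
      · obtain ⟨hx, he⟩ := below_inr_box hx
        obtain rfl := Sum.inl_injective he
        exact h.not_b_of_aux hv hv ha hx

end IsPS

end PreStr

end ProofStr

namespace ProofStr

open Dom

/-! ### Copies of labels, and the number of occurrences of atoms. -/

section Flat

variable {A : Type u} {G : Graph.{v}} {k : ℕ} {e : G.Port → Dom (IAtom A)}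

/-- The multiset of the copies of the label of a port, one for every choice of a copy of each of
the boxes that contain it. -/
noncomputable def copies (k : ℕ) (G : Graph.{v}) (e : G.Port → Dom (IAtom A)) (p : G.Port) :
    Multiset (Dom (IAtom A)) := digM k (G.depth p) {e p}

theorem copies_of_depth_zero {p : G.Port} (h : G.depth p = 0) : copies k G e p = {e p} := by
  rw [copies, h, digM_zero]

theorem sum_aux_mult {M : Type*} [AddCommMonoid M] (h : G.IsPorts) {l : G.Cell} (hl : l ∈ G.cells)
    (ht : G.type l = .tensor ∨ G.type l = .par) :
    ∃ q ∈ G.aux l, q ≠ G.left l ∧ ∀ f : G.Port → M, ∑ p ∈ G.aux l, f p = f (G.left l) + f q := by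
  classical
  obtain ⟨q, hq, hne, huniq⟩ := h.exists_aux_mult hl ht
  refine ⟨q, hq, hne, fun f => ?_⟩
  have : G.aux l = {G.left l, q} := by
    ext x
    rw [Finset.mem_insert, Finset.mem_singleton]
    constructor
    · intro hx
      by_cases hx' : x = G.left l
      · exact Or.inl hx'
      · exact Or.inr (huniq x hx hx')
    · rintro (rfl | rfl)
      · exact h.left_mem l hl ht
      · exact hq
  rw [this, Finset.sum_pair hne.symm]

theorem sum_aux_unit {M : Type*} [AddCommMonoid M] (h : G.IsPorts) {l : G.Cell} (hl : l ∈ G.cells)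
    (ht : G.type l = .one ∨ G.type l = .bot) (f : G.Port → M) : ∑ p ∈ G.aux l, f p = 0 := by
  have : G.aux l = ∅ := by
    rw [← Finset.card_eq_zero, h.card_aux hl, h.arity_unit l hl ht]
  rw [this, Finset.sum_empty]

theorem atmM_eq (m : Multiset (Dom (IAtom A))) : atmM m = (m.map atm).sum := rfl

/-- One formula serves all types of cells: the difference of depths is `0` at a multiplicative cell,
`1` at a `!`-cell and `G.num q` at a `?`-cell, as in the respective labels. -/
theorem IsKExp.atm_pri (he : IsKExp k G e) (h : G.IsPLPS) {l : G.Cell} (hl : l ∈ G.cells) :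
    atm (e (G.pri l)) =
      ∑ q ∈ G.aux l, atmM (digM k (G.depth q - G.depth (G.pri l)) {e q}) := by
  have hd : G.type l ≠ .bang → G.type l ≠ .whynot → ∀ q ∈ G.aux l,
      atmM (digM k (G.depth q - G.depth (G.pri l)) {e q}) = atm (e q) := by
    intro h1 h2 q hq
    rw [h.depth_aux hl hq h1 h2, Nat.sub_self, digM_zero, atmM_singleton]
  cases ht : G.type l with
  | tensor =>
    rw [ht] at hd
    obtain ⟨q, hq, hne, hs⟩ := sum_aux_mult (M := Multiset (IAtom A)) h.toIsPorts hl (Or.inl ht)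
    rw [Finset.sum_congr rfl (hd nofun nofun), hs, he.tensor l hl ht q hq hne, atm_pair]
  | par =>
    rw [ht] at hd
    obtain ⟨q, hq, hne, hs⟩ := sum_aux_mult (M := Multiset (IAtom A)) h.toIsPorts hl (Or.inr ht)
    rw [Finset.sum_congr rfl (hd nofun nofun), hs, he.par l hl ht q hq hne, atm_pair]
  | one => rw [sum_aux_unit h.toIsPorts hl (Or.inl ht), he.one l hl ht, atm_unit]
  | bot => rw [sum_aux_unit h.toIsPorts hl (Or.inr ht), he.bot l hl ht, atm_unit]
  | bang =>
    rw [he.bang l hl ht, atm_bag, ← atmM_eq, atmM_sum]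
    refine Finset.sum_congr rfl fun q hq => ?_
    rw [h.depth_aux_bang (Graph.mem_bangs.2 ⟨hl, ht⟩) hq, Nat.add_sub_cancel_left]
  | whynot =>
    rw [he.whynot l hl ht, atm_bag, ← atmM_eq, atmM_sum]
    refine Finset.sum_congr rfl fun q hq => ?_
    rw [h.depth_aux_whynot hl ht hq, Nat.add_sub_cancel_left]

open scoped Classical in
theorem IsKExp.atm_eq (he : IsKExp k G e) (h : G.IsPLPS) {p : G.Port} (hp : p ∈ G.ports)
    (ha : ∀ q, s(p, q) ∉ G.axioms) :
    atm (e p) = ∑ q ∈ G.ports.filter (fun q => G.Below p q),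
      atmM (digM k (G.depth q - G.depth p) {e q}) := by
  rcases h.cases_above hp with ⟨l, hl, rfl⟩ | ⟨hpri, l, hl, hw⟩ | ⟨q, hq⟩
  · rw [he.atm_pri h hl]
    refine Finset.sum_congr ?_ fun _ _ => rfl
    ext q
    rw [Finset.mem_filter, h.below_pri_iff hl]
    exact ⟨fun hq => ⟨h.aux_mem hl hq, hq⟩, fun hq => hq.2⟩
  · have : G.ports.filter (fun q => G.Below p q) = {G.pri l} := by
      ext q
      rw [Finset.mem_filter, Finset.mem_singleton]
      constructor
      · rintro ⟨_, ⟨l, hl, rfl, _⟩ | ⟨_, _, l', hl', _, rfl, hw'⟩⟩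
        · exact absurd (Graph.pri_mem_priPorts hl) hpri
        · exact h.wire_unique hw' hw
      · rintro rfl
        exact ⟨h.pri_mem_ports hl, h.below_of_wire_pri hl hw⟩
    rw [this, Finset.sum_singleton, h.depth_wire_pri hl hw, Nat.sub_self, digM_zero,
      atmM_singleton, he.wire p _ hw (ha _)]
  · exact absurd hq (ha q)

-- Conservation of atoms on the way up: the indices for the boxes around `p` and those for the boxes
-- entered between `p` and `q` combine by `digM_add` into those for `q`.
open scoped Classical in
theorem IsKExp.atmM_copies (he : IsKExp k G e) (h : G.IsPLPS) {p : G.Port} (hp : p ∈ G.ports)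
    (ha : ∀ q, s(p, q) ∉ G.axioms) :
    atmM (copies k G e p) =
      ∑ q ∈ G.ports.filter (fun q => G.Below p q), atmM (copies k G e q) := by
  have h1 : atmM {e p} = atmM (∑ q ∈ G.ports.filter (fun q => G.Below p q),
      digM k (G.depth q - G.depth p) {e q}) := by
    rw [atmM_singleton, he.atm_eq h hp ha, atmM_sum]
  rw [copies, atmM_digM_congr k _ h1, digM_sum, atmM_sum]
  refine Finset.sum_congr rfl fun q hq => ?_
  rw [← digM_add, Nat.add_sub_cancel' (h.depth_mono (.single (Finset.mem_filter.1 hq).2)), copies]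

-- Sum the conservation law over all ports. Every port that is not a conclusion is immediately above
-- exactly one port, so its term cancels; conclusions and axiom ports remain.
open scoped Classical in
theorem IsKExp.sum_conclusions (he : IsKExp k G e) (h : G.IsPLPS) :
    ∑ p ∈ G.ports.filter (fun p => p ∈ G.conclusions), atmM (copies k G e p) =
      ∑ p ∈ G.ports.filter (fun p => ∃ q, s(p, q) ∈ G.axioms), atmM (copies k G e p) := by
  have h1 : ∑ p ∈ G.ports, atmM (copies k G e p) =
      ∑ p ∈ G.ports.filter (fun p => ∃ q, s(p, q) ∈ G.axioms), atmM (copies k G e p) +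
        ∑ p ∈ G.ports, ∑ q ∈ G.ports.filter (fun q => G.Below p q), atmM (copies k G e q) := by
    rw [Finset.sum_filter, ← Finset.sum_add_distrib]
    refine Finset.sum_congr rfl fun p hp => ?_
    split_ifs with ha
    · obtain ⟨q, hq⟩ := ha
      rw [Finset.filter_false_of_mem fun r _ => h.not_below_of_mem_axioms hq, Finset.sum_empty,
        add_zero]
    · rw [zero_add]
      exact he.atmM_copies h hp (not_exists.1 ha)
  have h2 : ∑ p ∈ G.ports, ∑ q ∈ G.ports.filter (fun q => G.Below p q), atmM (copies k G e q) =
      ∑ q ∈ G.ports.filter (fun p => p ∉ G.conclusions), atmM (copies k G e q) := by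
    simp only [Finset.sum_filter]
    rw [Finset.sum_comm]
    refine Finset.sum_congr rfl fun q hq => ?_
    split_ifs with hc
    · exact Finset.sum_eq_zero fun p _ => if_neg ((h.mem_conclusions_iff.1 hc).2 p)
    · have hc' : ∃ p, G.Below p q := by
        by_contra hn
        push Not at hn
        exact hc (h.mem_conclusions_iff.2 ⟨hq, hn⟩)
      obtain ⟨p, hb⟩ := hc'
      rw [Finset.sum_eq_single p, if_pos hb]
      · exact fun r _ hr => if_neg fun hb' => hr (h.below_unique hb' hb)
      · exact fun hn => absurd (h.below_left hb) hn
  rw [h2, ← Finset.sum_filter_add_sum_filter_not _ (fun p => p ∈ G.conclusions)] at h1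
  exact add_right_cancel h1

theorem IsAtomicExp.exists_atom (ha : IsAtomicExp G e) {p q : G.Port}
    (hpq : s(p, q) ∈ G.axioms) : ∃ c : A, e p = atom (toIAtom c) :=
  ha _ hpq p (by simp)

theorem IsKExp.eq_of_mem_axioms (he : IsKExp k G e) (ha : IsAtomicExp G e) {p q : G.Port}
    (hpq : s(p, q) ∈ G.axioms) : e p = e q := by
  obtain ⟨c, hc⟩ := ha _ hpq q (by simp)
  rw [(he.ax p q hpq).1, hc, perp_atom]

theorem IsInjectiveExp.eq_or_eq (hi : IsInjectiveExp G e) {p q r t : G.Port} {c : A}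
    (hpq : s(p, q) ∈ G.axioms) (hrt : s(r, t) ∈ G.axioms) (hp : e p = atom (toIAtom c))
    (hr : e r = atom (toIAtom c)) : r = p ∨ r = q := by
  have := hi _ hpq _ hrt p (by simp) r (by simp) ⟨toIAtom c, by simp [hp, atoms], by
    simp [hr, atoms]⟩
  rw [← Sym2.mem_iff, this]
  simp

/-- An atom of a label can be followed upwards to an axiom; on the way only its index sequence
changes. -/
theorem IsKExp.exists_mem_axioms (he : IsKExp k G e) (ha : IsAtomicExp G e) (h : G.IsPLPS) :
    ∀ p ∈ G.ports, ∀ x ∈ atm (e p), ∃ q r, G.Le p q ∧ s(q, r) ∈ G.axioms ∧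
      e q = atom (toIAtom x.1) := by
  classical
  refine h.ind_up fun p hp ih x hx => ?_
  by_cases hax : ∃ q, s(p, q) ∈ G.axioms
  · obtain ⟨q, hq⟩ := hax
    obtain ⟨c, hc⟩ := ha.exists_atom hq
    refine ⟨p, q, .refl, hq, ?_⟩
    rw [hc, atm_atom, Multiset.mem_singleton] at hx
    rw [hc, hx]
    rfl
  · rw [he.atm_eq h hp (not_exists.1 hax), Multiset.mem_sum] at hx
    obtain ⟨q, hq, hx⟩ := hx
    rw [Finset.mem_filter] at hq
    obtain ⟨y, hy, hx⟩ := mem_sum_map.1 hx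
    revert hx
    revert y
    refine forall_mem_digM fun s y hy hx => ?_
    rw [Multiset.mem_singleton.1 hy, atm_map, Multiset.mem_map] at hx
    obtain ⟨z, hz, rfl⟩ := hx
    obtain ⟨r, t, hr, hrt, her⟩ := ih q hq.2 z hz
    exact ⟨r, t, .head hq.2 hr, hrt, her⟩

theorem IsKExp.good (he : IsKExp k G e) (ha : IsAtomicExp G e) (h : G.IsPLPS) :
    ∀ p ∈ G.ports, Good k (e p) := by
  refine h.ind_up fun p hp ih => ?_
  rcases h.cases_above hp with ⟨l, hl, rfl⟩ | ⟨hpri, l, hl, hw⟩ | ⟨q, hq⟩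
  · have ih' : ∀ q ∈ G.aux l, Good k (e q) := fun q hq => ih q (Graph.below_aux hl hq)
    have hd : ∀ d : G.Port → ℕ, ∀ x ∈ ∑ q ∈ G.aux l, digM k (d q) {e q}, Good k x := by
      intro d x hx
      obtain ⟨q, hq, hx⟩ := Multiset.mem_sum.1 hx
      refine forall_mem_digM (P := Good k) (fun s x hx => ?_) x hx
      rw [Multiset.mem_singleton.1 hx, good_map]
      exact ih' q hq
    cases ht : G.type l with
    | tensor =>
      obtain ⟨q, hq, hne, -⟩ := h.exists_aux_mult hl (Or.inl ht)
      rw [he.tensor l hl ht q hq hne, good_pair]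
      exact ⟨ih' _ (h.left_mem l hl (Or.inl ht)), ih' _ hq⟩
    | par =>
      obtain ⟨q, hq, hne, -⟩ := h.exists_aux_mult hl (Or.inr ht)
      rw [he.par l hl ht q hq hne, good_pair]
      exact ⟨ih' _ (h.left_mem l hl (Or.inr ht)), ih' _ hq⟩
    | one => rw [he.one l hl ht]; trivial
    | bot => rw [he.bot l hl ht]; trivial
    | bang =>
      rw [he.bang l hl ht, good_bag]
      refine ⟨fun _ => ?_, hd _⟩
      obtain ⟨q, hq⟩ := h.exists_aux_bang (Graph.mem_bangs.2 ⟨hl, ht⟩)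
      rw [hq, Finset.sum_singleton, card_digM_one, Multiset.card_singleton, mul_one]
    | whynot =>
      rw [he.whynot l hl ht, good_bag]
      exact ⟨nofun, hd _⟩
  · rw [he.wire p _ hw fun hax => (Graph.mem_axioms.1 hax).2.2 (Graph.pri_mem_priPorts hl)]
    exact ih _ (h.below_of_wire_pri hl hw)
  · obtain ⟨c, hc⟩ := ha.exists_atom hq
    rw [hc]
    trivial

open scoped Classical in
/-- Every atom has no or exactly two occurrences in the result of an injective atomic
experiment. -/
theorem IsKExp.count_result (he : IsKExp k G e) (ha : IsAtomicExp G e) (hi : IsInjectiveExp G e)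
    (h : G.IsLPS) {n : ℕ} (ind : G.conclusions ≃ Fin n) (x : IAtom A) :
    (∑ i, atm (kResult G ind e i)).count x = 0 ∨ (∑ i, atm (kResult G ind e i)).count x = 2 := by
  have h1 : ∑ i, atm (kResult G ind e i) =
      ∑ p ∈ G.ports.filter (fun p => p ∈ G.conclusions), atmM (copies k G e p) := by
    refine Finset.sum_bij (fun i _ => (ind.symm i).1) ?_ ?_ ?_ ?_
    · exact fun i _ => Finset.mem_filter.2 ⟨(ind.symm i).2.1, (ind.symm i).2⟩
    · exact fun i _ j _ hij => ind.symm.injective (Subtype.ext hij)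
    · exact fun p hp => ⟨ind ⟨p, (Finset.mem_filter.1 hp).2⟩, Finset.mem_univ _, by simp⟩
    · intro i _
      rw [copies_of_depth_zero (h.depth_conclusion (ind.symm i).2), atmM_singleton]
      rfl
  rw [h1, he.sum_conclusions h.toIsPLPS, Multiset.count_sum']
  by_cases h0 : ∀ p ∈ G.ports.filter (fun p => ∃ q, s(p, q) ∈ G.axioms),
      (atmM (copies k G e p)).count x = 0
  · exact Or.inl (Finset.sum_eq_zero h0)
  · right
    push Not at h0
    obtain ⟨p, hp, hpx⟩ := h0
    obtain ⟨hpp, q, hpq⟩ := Finset.mem_filter.1 hp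
    have hq : q ∈ G.ports.filter (fun p => ∃ q, s(p, q) ∈ G.axioms) :=
      Finset.mem_filter.2 ⟨h.wire_right (Graph.mem_axioms.1 hpq).1, p, Graph.axioms_swap hpq⟩
    have hcount : ∀ r t, s(r, t) ∈ G.axioms → (atmM (copies k G e r)).count x ≠ 0 →
        e r = atom (toIAtom x.1) ∧ (atmM (copies k G e r)).count x = 1 := by
      intro r t hrt hr
      obtain ⟨c, hc⟩ := ha.exists_atom hrt
      have h2 := count_atmM_digM_le k (G.depth r) c x
      rw [copies, hc] at hr ⊢
      have h3 := fst_of_mem_atmM_digM (Multiset.count_ne_zero.1 hr)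
      exact ⟨by rw [h3], by omega⟩
    obtain ⟨hep, hp1⟩ := hcount p q hpq hpx
    -- The two ends of an axiom have the same atomic label and the same depth, hence the same
    -- copies.
    have hq1 : (atmM (copies k G e q)).count x = 1 := by
      rw [← hp1, copies, copies, he.eq_of_mem_axioms ha hpq, h.depth_eq p q hpq]
    rw [Finset.sum_eq_add_of_mem p q hp hq (h.wire_irrefl (Graph.mem_axioms.1 hpq).1), hp1, hq1]
    rintro r hr ⟨hrp, hrq⟩
    by_contra hrx
    obtain ⟨t, hrt⟩ := (Finset.mem_filter.1 hr).2
    rcases hi.eq_or_eq hpq hrt hep (hcount r t hrt hrx).1 with e | e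
    · exact hrp e
    · exact hrq e

end Flat

/-! ### From `k`-experiments to experiments. -/

namespace PreStr

variable {A : Type u} {R : PreStr.{v}} {k : ℕ} {e : R.Port → Dom (IAtom A)}

/-- The experiment of a box that is induced by an experiment. -/
noncomputable def boxExp (k : ℕ) (R : PreStr.{v}) (v : R.Cell) (e : R.Port → Dom (IAtom A)) :
    (R.box v).Port → Dom (IAtom A) :=
  Sum.elim e fun p => bag .neg (digM k ((R.box v).num (Sum.inl p)) {e p})

/-- The old cells keep their rules, for `?`-cells because of `num_box`; `boxExp` labels the new
`?`-cells by the very formula required. -/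
theorem IsPS.isKExp_box (h : R.IsPS) (he : IsKExp k R.toGraph e) {v : R.Cell} (hv : v ∈ R.bangs)
    (h0 : R.depth (R.pri v) = 0) : IsKExp k (R.box v).toGraph (boxExp k R v e) where
  tensor := by
    rintro (l | r) hl ht
    · rw [h.inl_mem_cells hv] at hl
      rw [aux_box_inl]
      intro q hq hne
      obtain ⟨q, hq', rfl⟩ := Finset.mem_map.1 hq
      exact he.tensor l hl.1 ht q hq' fun e => hne (e ▸ rfl)
    · cases ht
  par := by
    rintro (l | r) hl ht
    · rw [h.inl_mem_cells hv] at hl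
      rw [aux_box_inl]
      intro q hq hne
      obtain ⟨q, hq', rfl⟩ := Finset.mem_map.1 hq
      exact he.par l hl.1 ht q hq' fun e => hne (e ▸ rfl)
    · cases ht
  one := by
    rintro (l | r) hl ht
    · exact he.one l ((h.inl_mem_cells hv).1 hl).1 ht
    · cases ht
  bot := by
    rintro (l | r) hl ht
    · exact he.bot l ((h.inl_mem_cells hv).1 hl).1 ht
    · cases ht
  bang := by
    rintro (l | r) hl ht
    · rw [aux_box_inl, Finset.sum_map]
      exact he.bang l ((h.inl_mem_cells hv).1 hl).1 ht
    · cases ht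
  whynot := by
    rintro (l | r) hl ht
    · rw [h.inl_mem_cells hv] at hl
      rw [aux_box_inl, Finset.sum_map]
      refine (he.whynot l hl.1 ht).trans (congrArg _ (Finset.sum_congr rfl fun q hq => ?_))
      rw [Function.Embedding.inl_apply, h.num_box hv h0 hl.1 hl.2 ht hq]
      rfl
    · rw [aux_box_inr, Finset.sum_singleton]
      rfl
  ax := by
    intro x y hxy
    obtain ⟨p, q, rfl, rfl, _⟩ := mem_wires_box.1 (Graph.mem_axioms.1 hxy).1
    exact he.ax p q ((h.axioms_box hv).1 hxy).1
  wire := by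
    intro x y hxy hax
    obtain ⟨p, q, rfl, rfl, hw, hp, hq⟩ := mem_wires_box.1 hxy
    exact he.wire p q hw fun ha => hax ((h.axioms_box hv).2 ⟨ha, hp, hq⟩)

theorem IsPS.isAtomicExp_box (h : R.IsPS) (ha : IsAtomicExp R.toGraph e) {v : R.Cell}
    (hv : v ∈ R.bangs) : IsAtomicExp (R.box v).toGraph (boxExp k R v e) := by
  intro w hw x hx
  obtain ⟨y, rfl⟩ := Sym2.mem_iff_exists.1 hx
  obtain ⟨p, q, rfl, rfl, _⟩ := mem_wires_box.1 (Graph.mem_axioms.1 hw).1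
  exact ha.exists_atom ((h.axioms_box hv).1 hw).1

theorem IsPS.isInjectiveExp_box (h : R.IsPS) (hi : IsInjectiveExp R.toGraph e) {v : R.Cell}
    (hv : v ∈ R.bangs) : IsInjectiveExp (R.box v).toGraph (boxExp k R v e) := by
  intro w hw w' hw' x hx x' hx' hne
  obtain ⟨y, rfl⟩ := Sym2.mem_iff_exists.1 hx
  obtain ⟨y', rfl⟩ := Sym2.mem_iff_exists.1 hx'
  obtain ⟨p, q, rfl, rfl, _⟩ := mem_wires_box.1 (Graph.mem_axioms.1 hw).1
  obtain ⟨p', q', rfl, rfl, _⟩ := mem_wires_box.1 (Graph.mem_axioms.1 hw').1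
  have := hi _ ((h.axioms_box hv).1 hw).1 _ ((h.axioms_box hv).1 hw').1 p (by simp) p'
    (by simp) hne
  exact congrArg (Sym2.map Sum.inl) this

theorem IsPS.copies_box (h : R.IsPS) {v : R.Cell} (hv : v ∈ R.bangs)
    (h0 : R.depth (R.pri v) = 0) {p : R.Port} (hp : R.InBox v p) :
    copies k R.toGraph e p = ∑ i : Fin k,
      (copies k (R.box v).toGraph (boxExp k R v e) (Sum.inl p)).map
        (Dom.map (dig [(i : ℕ) + 1])) := by
  rw [copies, h.depth_box hv h0 hp, digM_succ]
  rfl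

/-- The box may start at the auxiliary port of `v` or one wire above it. Labels do not see the
difference. -/
theorem IsPS.wire_of_conclusion_box (h : R.IsPS) {v : R.Cell} (hv : v ∈ R.bangs)
    {p : R.Port} (hp : Sum.inl p ∈ (R.box v).conclusions) {X : Type*} {f : R.Port → X}
    (hf : ∀ p q, s(p, q) ∈ R.wires → s(p, q) ∉ R.axioms → f p = f q) :
    R.InBox v p ∧ ∃ a ∈ R.aux v, f a = f p := by
  obtain ⟨hin, a, ha, rfl | ⟨hw, hpri⟩⟩ := h.conclusion_box hv hp
  · exact ⟨hin, p, ha, rfl⟩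
  · exact ⟨hin, a, ha, hf a p hw fun hax => (Graph.mem_axioms.1 hax).2.2 hpri⟩

/-- The copies of the labels of an atomic `k`-experiment form an experiment. -/
theorem IsPS.isExp_copies (h : R.IsPS) (he : IsKExp k R.toGraph e)
    (ha : IsAtomicExp R.toGraph e) (g : IAtom A → A) :
    IsExp R (fun p => (copies k R.toGraph e p).map (Dom.map g)) := by
  -- The renaming must vary, since the copies of a box differ by an index absorbed in it.
  induction h generalizing g with
  | mk R hlps hb hnum hdoor hnest hbox ih =>
    have h : R.IsPS := .mk R hlps hb hnum hdoor hnest hbox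
    have hc : ∀ {p : R.Port}, R.depth p = 0 →
        (copies k R.toGraph e p).map (Dom.map g) = {Dom.map g (e p)} := fun h0 => by
      rw [copies_of_depth_zero h0, Multiset.map_singleton]
    have hcw : ∀ p q, s(p, q) ∈ R.wires → s(p, q) ∉ R.axioms →
        copies k R.toGraph e p = copies k R.toGraph e q := by
      intro p q hw hax
      rw [copies, copies, he.wire p q hw hax, hlps.depth_of_wire hw]
    -- Each box is given `k` experiments. For the one numbered `i` from zero, `i + 1` is appended to
    -- the indices in the box before renaming by `g`.
    refine IsExp.mk R _ (fun _ => k) (fun v i x =>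
      (copies k (R.box v).toGraph (boxExp k R v e) x).map (Dom.map (g ∘ dig [(i : ℕ) + 1])))
      ?_ ?_ ?_ ?_ ?_ ?_ ?_ ?_ ?_ ?_ ?_
    · exact fun v hv h0 i => ih v hv (h.isKExp_box he hv h0) (h.isAtomicExp_box ha hv) _
    · intro p _ _ h0
      rw [hc h0, Multiset.card_singleton]
    · intro p q hpq hp0 hq0
      refine ⟨_, _, hc hp0, hc hq0, ?_⟩
      obtain ⟨c, hc⟩ := ha.exists_atom hpq
      rw [← he.eq_of_mem_axioms ha hpq, hc]
      rfl
    · intro l hl ht h0 q hq hne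
      have hd : ∀ q ∈ R.aux l, R.depth q = 0 := fun q hq => by
        rw [hlps.depth_aux hl hq (by simp [ht]) (by simp [ht]), h0]
      refine ⟨_, _, hc (hd _ (hlps.left_mem l hl (Or.inl ht))), hc (hd _ hq), ?_⟩
      rw [hc h0, he.tensor l hl ht q hq hne, map_pair]
    · intro l hl ht h0 q hq hne
      have hd : ∀ q ∈ R.aux l, R.depth q = 0 := fun q hq => by
        rw [hlps.depth_aux hl hq (by simp [ht]) (by simp [ht]), h0]
      refine ⟨_, _, hc (hd _ (hlps.left_mem l hl (Or.inr ht))), hc (hd _ hq), ?_⟩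
      rw [hc h0, he.par l hl ht q hq hne, map_pair]
    · intro l hl ht h0
      rw [hc h0, he.one l hl ht, map_unit]
    · intro l hl ht h0
      rw [hc h0, he.bot l hl ht, map_unit]
    · intro l hl ht h0
      rw [hc h0, he.whynot l hl ht, map_bag, map_sum_finset]
      congr 2
      refine Finset.sum_congr rfl fun q hq => ?_
      rw [copies, hlps.depth_aux_whynot hl ht hq, h0, zero_add]
    · intro v hv h0
      obtain ⟨p, hp, hle⟩ := h.exists_conclusion_box hv
      refine ⟨p, hp, hle, ?_⟩
      obtain ⟨hin, a, hav, hap⟩ := h.wire_of_conclusion_box hv hp hcw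
      have hv' := Graph.mem_bangs.1 hv
      obtain ⟨b, hb⟩ := hlps.exists_aux_bang hv
      rw [hb, Finset.mem_singleton] at hav
      subst hav
      rw [hc h0, he.bang v hv'.1 hv'.2, map_bag, hb, Finset.sum_singleton]
      have h1 : digM k 1 {e a} = copies k R.toGraph e a := by
        rw [copies, hlps.depth_aux_bang hv (by simp [hb]), h0]
      rw [h1, hap, h.copies_box hv h0 hin, map_sum_finset]
      simp only [Multiset.map_map, Function.comp_apply, Dom.map_map]
    · intro v hv h0 p hp
      rw [inl_mem_ports] at hp
      rw [h.copies_box hv h0 hp, map_sum_finset]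
      simp only [Multiset.map_map, Function.comp_apply, Dom.map_map]
    · intro p q hw hax
      exact congrArg _ (hcw p q hw hax)

end PreStr

end ProofStr

namespace ProofStr

open Dom

theorem rel_singleton {α β : Type*} {r : α → β → Prop} {a : α} {b : β} :
    Multiset.Rel r {a} {b} ↔ r a b := by
  refine ⟨fun h => ?_, fun h => .cons h .zero⟩
  obtain ⟨y, hy, hr⟩ := Multiset.exists_mem_of_rel_of_mem h (Multiset.mem_singleton_self a)
  rwa [Multiset.mem_singleton.1 hy] at hr

/-! ### From experiments to substitution instances of a `k`-experiment. -/

namespace PreStr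

variable {A : Type u} {R : PreStr.{v}} {k : ℕ}

theorem IsExp.card_eq_one {E : R.Port → Multiset (Dom A)} (h : IsExp R E) {p : R.Port}
    (hp : p ∈ R.ports) (hd : p ∉ R.auxDoors) (h0 : R.depth p = 0) : (E p).card = 1 := by
  cases h with
  | mk _ _ _ _ _ hcard => exact hcard p hp hd h0

theorem IsExp.whynot_eq {E : R.Port → Multiset (Dom A)} (h : IsExp R E) {l : R.Cell}
    (hl : l ∈ R.cells) (ht : R.type l = .whynot) (h0 : R.depth (R.pri l) = 0) :
    E (R.pri l) = {bag .neg (∑ p ∈ R.aux l, E p)} := by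
  cases h with
  | mk _ _ _ _ _ _ _ _ _ _ _ hwhynot => exact hwhynot l hl ht h0

theorem IsPS.inr_eq (h : R.IsPS) {v : R.Cell} (hv : v ∈ R.bangs)
    {E : (R.box v).Port → Multiset (Dom A)} (hE : IsExp (R.box v) E) {p : R.Port}
    (hp : p ∈ R.b v) : E (Sum.inr p) = {bag .neg (E (Sum.inl p))} := by
  have h1 := hE.whynot_eq (l := Sum.inr p) (inr_mem_cells.2 hp) rfl
    (Graph.IsPLPS.depth_root (h.not_below_inr hv))
  rwa [aux_box_inr, Finset.sum_singleton] at h1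

/-- The only port of the region that the box may lack is the auxiliary port of `v`; it then has the
label of the principal port to which it is wired. -/
theorem IsPS.exists_inBox (h : R.IsPS) {p : R.Port} (hp : p ∈ R.ports) (h0 : R.depth p ≠ 0) :
    ∃ v ∈ R.bangs, R.depth (R.pri v) = 0 ∧ ∃ q, R.InBox v q ∧
      (q = p ∨ (s(p, q) ∈ R.wires ∧ s(p, q) ∉ R.axioms)) := by
  obtain ⟨v, hv, hv0, hpv⟩ := h.exists_box hp h0
  refine ⟨v, hv, hv0, ?_⟩
  by_cases hin : R.InBox v p
  · exact ⟨p, hin, Or.inl rfl⟩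
  · have : ∃ l ∈ R.cells, s(p, R.pri l) ∈ R.wires := by
      by_contra hn
      exact hin ⟨hpv, fun hn' => hn hn'.2⟩
    obtain ⟨l, hl, hw⟩ := this
    exact ⟨R.pri l, h.inBox_of_pri hv (h.region_up hpv (.single (h.lps.below_of_wire_pri hl hw)))
      (Graph.pri_mem_priPorts hl), Or.inr ⟨hw, fun hax =>
        (Graph.mem_axioms.1 hax).2.2 (Graph.pri_mem_priPorts hl)⟩⟩

/-- If the labels of the conclusions have positive multisets of cardinality `k` only, then so do
all the labels. -/
theorem IsPS.good_ports (h : R.IsPS) {E : R.Port → Multiset (Dom A)} (hE : IsExp R E)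
    (hc : ∀ p ∈ R.conclusions, ∀ x ∈ E p, Good k x) : ∀ p ∈ R.ports, ∀ x ∈ E p, Good k x := by
  induction h with
  | mk R hlps hb hnum hdoor hnest hbox ih =>
    have h : R.IsPS := .mk R hlps hb hnum hdoor hnest hbox
    have hE' := hE
    cases hE with
    | mk _ _ n f hf hcard hax htensor hpar hone hbot hwhynot hbang hinside hwire =>
    have hwn : ∀ l ∈ R.cells, R.type l = .whynot → R.depth (R.pri l) = 0 →
        (∀ x ∈ E (R.pri l), Good k x) → ∀ q ∈ R.aux l, ∀ x ∈ E q, Good k x := by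
      intro l hl ht h0 hg q hq x hx
      have := hg _ (by rw [hwhynot l hl ht h0]; exact Multiset.mem_singleton_self _)
      exact (good_bag.1 this).2 x (Multiset.mem_sum.2 ⟨q, hq, hx⟩)
    -- At depth zero the labels above are components of the labels below, so the property climbs
    -- from the conclusions.
    have hzero : ∀ p ∈ R.ports, R.depth p = 0 → ∀ x ∈ E p, Good k x := by
      refine hlps.ind_down fun p hp ih hp0 => ?_
      by_cases hr : ∀ q, ¬ R.Below q p
      · exact hc p (hlps.mem_conclusions_iff.2 ⟨hp, hr⟩)
      push Not at hr
      obtain ⟨p', hb'⟩ := hr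
      have hp'0 : R.depth p' = 0 :=
        Nat.le_zero.1 (hp0 ▸ hlps.depth_mono (.single hb'))
      have hg := ih p' hb' hp'0
      rcases hb' with ⟨l, hl, rfl, hpl⟩ | ⟨l, hl, l', hl', hpl, rfl, hw⟩
      · have hmult : (R.type l = .tensor ∨ R.type l = .par) →
            (∀ q ∈ R.aux l, q ≠ R.left l → ∃ i, ∃ α β : Dom A,
              E (R.left l) = {α} ∧ E q = {β} ∧ E (R.pri l) = {Dom.pair i α β}) →
            ∀ x ∈ E p, Good k x := by
          intro ht hm x hx
          obtain ⟨q, hq, hne, huniq⟩ := hlps.exists_aux_mult hl ht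
          obtain ⟨i, α, β, h1, h2, h3⟩ := hm q hq hne
          have hg' := good_pair.1 (hg _ (by rw [h3]; exact Multiset.mem_singleton_self _))
          by_cases hpe : p = R.left l
          · rw [hpe, h1, Multiset.mem_singleton] at hx
            exact hx ▸ hg'.1
          · rw [huniq p hpl hpe, h2, Multiset.mem_singleton] at hx
            exact hx ▸ hg'.2
        have hunit : (R.type l = .one ∨ R.type l = .bot) → ∀ x ∈ E p, Good k x := by
          intro ht
          have hcard := hlps.card_aux hl
          rw [hlps.arity_unit l hl ht, Finset.card_eq_zero] at hcard
          rw [hcard] at hpl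
          simp at hpl
        cases ht : R.type l with
        | tensor => exact hmult (Or.inl ht) fun q hq hne => ⟨_, htensor l hl ht hp'0 q hq hne⟩
        | par => exact hmult (Or.inr ht) fun q hq hne => ⟨_, hpar l hl ht hp'0 q hq hne⟩
        | one => exact hunit (Or.inl ht)
        | bot => exact hunit (Or.inr ht)
        | bang =>
          rw [hlps.depth_aux_bang (Graph.mem_bangs.2 ⟨hl, ht⟩) hpl] at hp0
          cases hp0
        | whynot => exact hwn l hl ht hp'0 hg p hpl
      · rw [← hwire p' _ hw fun hax => (Graph.mem_axioms.1 hax).2.2 (Graph.pri_mem_priPorts hl')]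
        exact hg
    have hboxes : ∀ v ∈ R.bangs, R.depth (R.pri v) = 0 → ∀ i, ∀ x ∈ (R.box v).ports,
        ∀ y ∈ f v i x, Good k y := by
      intro v hv h0 i
      refine ih v hv (hf v hv h0 i) ?_
      rintro (p | p) hp y hy
      · obtain ⟨q, hq, _, he⟩ := hbang v hv h0
        rw [← h.conclusion_box_unique hv hp hq] at he
        have := hzero _ (h.pri_ports hv) h0 _ (by rw [he]; exact Multiset.mem_singleton_self _)
        exact (good_bag.1 this).2 y (Multiset.mem_sum.2 ⟨i, Finset.mem_univ _, hy⟩)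
      -- A new conclusion of the box collects part of the label of the door `p`, which is in turn
      -- part of the label of a `?`-cell of depth zero.
      · have hp' : p ∈ R.b v := inr_mem_ports.1 hp.1
        rw [h.inr_eq hv (hf v hv h0 i) hp', Multiset.mem_singleton] at hy
        rw [hy, good_bag]
        refine ⟨nofun, fun z hz => ?_⟩
        obtain ⟨l, hl, ht, hpl⟩ := h.b_aux hv hp'
        have hb' := Graph.below_aux hl hpl
        have hl0 := h.depth_pri_of_b hv h0 hp' hb'
        refine hwn l hl ht hl0 (hzero _ (hlps.pri_mem_ports hl) hl0) p hpl z ?_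
        rw [hinside v hv h0 p (inl_mem_ports.2 (inBox_of_not_aux
          (h.door_region hv (Or.inr hp')) fun ha => h.not_b_of_aux hv hv ha hp'))]
        exact Multiset.mem_sum.2 ⟨i, Finset.mem_univ _, hz⟩
    intro p hp
    by_cases h0 : R.depth p = 0
    · exact hzero p hp h0
    · obtain ⟨v, hv, hv0, q, hq, hpq⟩ := h.exists_inBox hp h0
      have : E p = E q := by
        rcases hpq with rfl | hpq
        · rfl
        · exact hwire p q hpq.1 hpq.2
      intro x hx
      rw [this, hinside v hv hv0 q (inl_mem_ports.2 hq)] at hx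
      obtain ⟨i, _, hx⟩ := Multiset.mem_sum.1 hx
      exact hboxes v hv hv0 i _ (inl_mem_ports.2 hq) x hx

/-- Of two distinct outermost boxes that meet, one would contain the principal port of the other. -/
theorem IsPS.eq_of_mem_regions (h : R.IsPS) {v w : R.Cell} (hv : v ∈ R.bangs) (hw : w ∈ R.bangs)
    (hv0 : R.depth (R.pri v) = 0) (hw0 : R.depth (R.pri w) = 0) {p : R.Port}
    (hpv : p ∈ R.region v) (hpw : p ∈ R.region w) : v = w := by
  by_contra hne
  have h1 := h.pri_mem_region hw hv hne (h.region_subset hw hw0 hv hpw hpv)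
  exact (h.depth_eq_zero_iff (h.pri_ports hv)).1 hv0 w hw h1

/-- The experiments of a box are indexed by `Fin (n v)`, where `n v` equals `k` only
propositionally. -/
theorem IsPS.copies_box_of_eq (h : R.IsPS) {e : R.Port → Dom (IAtom A)} {v : R.Cell}
    (hv : v ∈ R.bangs) (h0 : R.depth (R.pri v) = 0) {p : R.Port} (hp : R.InBox v p) {m : ℕ}
    (hm : m = k) : copies k R.toGraph e p = ∑ i : Fin m,
      (copies k (R.box v).toGraph (boxExp k R v e) (Sum.inl p)).map
        (Dom.map (dig [(i : ℕ) + 1])) := by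
  subst hm
  exact h.copies_box hv h0 hp

/-- The patching of substitutions for the copies of the boxes of depth zero and for the axioms
of depth zero. -/
theorem IsPS.exists_patch (h : R.IsPS) {e : R.Port → Dom (IAtom A)}
    (hi : IsInjectiveExp R.toGraph e) {n : R.Cell → ℕ}
    (G : (v : R.Cell) → Fin (n v) → IAtom A → Dom A) {E : R.Port → Multiset (Dom A)}
    (hE : ∀ p q, s(p, q) ∈ R.axioms → R.depth p = 0 → ∃ α, E p = {α}) :
    ∃ g : IAtom A → Dom A,
      (∀ v ∈ R.bangs, R.depth (R.pri v) = 0 → ∀ i : Fin (n v), ∀ q r, q ∈ R.region v →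
        s(q, r) ∈ R.axioms → ∀ c t, e q = atom (toIAtom c) →
          g (c, t ++ [(i : ℕ) + 1]) = G v i (c, t)) ∧
      ∀ q r, s(q, r) ∈ R.axioms → R.depth q = 0 → ∀ c, e q = atom (toIAtom c) →
        E q = {g (c, [])} ∨ E r = {g (c, [])} := by
  classical
  -- `S` collects the prescribed values: at a nonempty index those coming from the boxes, at the
  -- empty index those coming from the axioms of depth zero.
  let S : IAtom A → Dom A → Prop := fun x α =>
    (∃ v ∈ R.bangs, R.depth (R.pri v) = 0 ∧ ∃ i : Fin (n v), ∃ q r t, q ∈ R.region v ∧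
      s(q, r) ∈ R.axioms ∧ e q = atom (toIAtom x.1) ∧ x.2 = t ++ [(i : ℕ) + 1] ∧
        α = G v i (x.1, t)) ∨
    ∃ q r, s(q, r) ∈ R.axioms ∧ R.depth q = 0 ∧ e q = atom (toIAtom x.1) ∧ x.2 = [] ∧ E q = {α}
  have hS : ∀ x, ∃ α, (∃ β, S x β) → S x α := by
    intro x
    by_cases hx : ∃ β, S x β
    · obtain ⟨β, hβ⟩ := hx
      exact ⟨β, fun _ => hβ⟩
    -- Where nothing is prescribed any value will do.
    · exact ⟨.unit .pos, fun hx' => absurd hx' hx⟩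
  choose g hg using hS
  refine ⟨g, ?_, ?_⟩
  · intro v hv hv0 i q r hq hqr c t hc
    rcases hg (c, t ++ [(i : ℕ) + 1]) ⟨_, Or.inl ⟨v, hv, hv0, i, q, r, t, hq, hqr, hc, rfl, rfl⟩⟩
      with ⟨w, hw, hw0, j, q', r', t', hq', hqr', hc', ht, hα⟩ | ⟨_, _, _, _, _, ht, _⟩
    -- The value was chosen from some prescription for the same atom. By injectivity of `e` it comes
    -- from the same axiom, hence the same box, and the last index gives the same copy.
    · have hqw : q' ∈ R.region v := by
        rcases hi.eq_or_eq hqr hqr' hc hc' with rfl | rfl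
        · exact hq
        · exact (h.inBox_mem_axioms hv hq hqr).1
      obtain rfl := h.eq_of_mem_regions hv hw hv0 hw0 hqw hq'
      obtain ⟨rfl, hij⟩ := List.append_inj' ht rfl
      obtain rfl : i = j := Fin.ext (by simpa using hij)
      exact hα
    · simp at ht
  · intro q r hqr hq0 c hc
    obtain ⟨α, hα⟩ := hE q r hqr hq0
    rcases hg (c, []) ⟨α, Or.inr ⟨q, r, hqr, hq0, hc, rfl, hα⟩⟩
      with ⟨_, _, _, _, _, _, _, _, _, _, ht, _⟩ | ⟨q', r', hqr', _, hc', _, hα'⟩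
    · simp at ht
    -- Either end of the axiom may have provided the value, which explains the disjunction.
    · rcases hi.eq_or_eq hqr hqr' hc hc' with rfl | rfl
      · exact Or.inl hα'
      · exact Or.inr hα'

/-- An experiment with positive multisets of cardinality `k` is a substitution instance of an
injective atomic `k`-experiment. -/
theorem IsPS.exists_subst (h : R.IsPS) {e : R.Port → Dom (IAtom A)}
    (he : IsKExp k R.toGraph e) (ha : IsAtomicExp R.toGraph e) (hi : IsInjectiveExp R.toGraph e)
    {E : R.Port → Multiset (Dom A)} (hE : IsExp R E)
    (hgood : ∀ p ∈ R.ports, ∀ x ∈ E p, Good k x) :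
    ∃ g : IAtom A → Dom A, ∀ p ∈ R.ports,
      Multiset.Rel (SubstRel g) (copies k R.toGraph e p) (E p) := by
  induction h with
  | mk R hlps hb hnum hdoor hnest hbox ih =>
    have h : R.IsPS := .mk R hlps hb hnum hdoor hnest hbox
    cases hE with
    | mk _ _ n f hf hcard hax htensor hpar hone hbot hwhynot hbang hinside hwire =>
    -- Each experiment of the box contributes one element to the positive multiset at `v`, as the
    -- conclusion of the box has depth zero.
    have hn : ∀ v ∈ R.bangs, R.depth (R.pri v) = 0 → n v = k := by
      intro v hv h0
      obtain ⟨p, hp, _, hep⟩ := hbang v hv h0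
      have h1 := hgood _ (h.pri_ports hv) _ (by rw [hep]; exact Multiset.mem_singleton_self _)
      have h2 := (good_bag.1 h1).1 rfl
      have hp0 := (h.box hv).lps.depth_conclusion hp
      rw [Multiset.card_sum, Finset.sum_congr rfl fun i _ =>
        (hf v hv h0 i).card_eq_one hp.1 (fun hd => absurd hp0
          ((h.box hv).lps.depth_pos_of_auxDoor hd).ne') hp0] at h2
      simpa using h2
    have hG : ∀ v, ∀ i : Fin (n v), ∃ g : IAtom A → Dom A, v ∈ R.bangs →
        R.depth (R.pri v) = 0 → ∀ x ∈ (R.box v).ports, Multiset.Rel (SubstRel g)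
          (copies k (R.box v).toGraph (boxExp k R v e) x) (f v i x) := by
      intro v i
      by_cases hv : v ∈ R.bangs ∧ R.depth (R.pri v) = 0
      · obtain ⟨hv, h0⟩ := hv
        have hinl : ∀ p, R.InBox v p → ∀ y ∈ f v i (Sum.inl p), Good k y := fun p hp y hy =>
          hgood p hp.1.1 y (by
            rw [hinside v hv h0 p (inl_mem_ports.2 hp)]
            exact Multiset.mem_sum.2 ⟨i, Finset.mem_univ _, hy⟩)
        obtain ⟨g, hg⟩ := ih v hv (h.isKExp_box he hv h0) (h.isAtomicExp_box ha hv)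
          (h.isInjectiveExp_box hi hv) (hf v hv h0 i) (by
            rintro (p | p) hp
            · exact hinl p (inl_mem_ports.1 hp)
            · intro y hy
              rw [inr_mem_ports] at hp
              rw [h.inr_eq hv (hf v hv h0 i) hp, Multiset.mem_singleton] at hy
              rw [hy, good_bag]
              exact ⟨nofun, hinl p (inBox_of_not_aux (h.door_region hv (Or.inr hp))
                fun ha => h.not_b_of_aux hv hv ha hp)⟩)
        exact ⟨g, fun _ _ => hg⟩
      · exact ⟨fun _ => .unit .pos, fun h1 h2 => absurd ⟨h1, h2⟩ hv⟩
    choose G hG using hG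
    obtain ⟨g, hg1, hg2⟩ := h.exists_patch hi G (E := E) fun p q hpq hp0 => by
      obtain ⟨α, _, hα, _⟩ := hax p q hpq hp0 ((hlps.depth_eq p q hpq).symm.trans hp0)
      exact ⟨α, hα⟩
    have hin : ∀ v ∈ R.bangs, R.depth (R.pri v) = 0 → ∀ p, R.InBox v p →
        Multiset.Rel (SubstRel g) (copies k R.toGraph e p) (E p) := by
      intro v hv h0 p hp
      rw [h.copies_box_of_eq hv h0 hp (hn v hv h0), hinside v hv h0 p (inl_mem_ports.2 hp)]
      refine rel_add_sum _ fun i _ => Multiset.rel_map_left.2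
        ((hG v i hv h0 _ (inl_mem_ports.2 hp)).mono fun y hy z _ hyz => ?_)
      refine substRel_map (fun c hc => ?_) hyz
      -- Up to its index, the atom `c` comes from the label of `p`, hence from an axiom above `p`.
      -- This axiom is in the region of `v`, where `g` has its prescribed values.
      have hc' : ∃ x ∈ atm (e p), x.1 = c.1 := by
        refine forall_mem_digM (P := fun y => c ∈ atm y → ∃ x ∈ atm (e p), x.1 = c.1)
          (fun s y hy hc => ?_) y hy hc
        rw [Multiset.mem_singleton.1 hy, atm_map, Multiset.mem_map] at hc
        obtain ⟨x, hx, rfl⟩ := hc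
        exact ⟨x, hx, rfl⟩
      obtain ⟨x, hx, hxc⟩ := hc'
      obtain ⟨q, r, hpq, hqr, heq⟩ := he.exists_mem_axioms ha hlps.toIsPLPS p hp.1.1 x hx
      rw [hxc] at heq
      exact (hg1 v hv h0 i q r (h.region_up hp.1 hpq) hqr c.1 c.2 heq).symm
    -- At depth zero the relation is built up from the axioms by the rules of the cells; at positive
    -- depth it comes from the box, possibly through a wire.
    refine ⟨g, hlps.ind_up fun p hp ihp => ?_⟩
    have hwire' : ∀ q, s(p, q) ∈ R.wires → s(p, q) ∉ R.axioms →
        Multiset.Rel (SubstRel g) (copies k R.toGraph e q) (E q) →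
          Multiset.Rel (SubstRel g) (copies k R.toGraph e p) (E p) := by
      intro q hw hna hr
      rwa [copies, he.wire p q hw hna, hlps.depth_of_wire hw, hwire p q hw hna]
    by_cases h0 : R.depth p = 0
    · rcases hlps.cases_above hp with ⟨l, hl, rfl⟩ | ⟨hpri, l, hl, hw⟩ | ⟨q, hq⟩
      · rw [copies_of_depth_zero h0]
        have ih' : ∀ q ∈ R.aux l, Multiset.Rel (SubstRel g) (copies k R.toGraph e q) (E q) :=
          fun q hq => ihp q (Graph.below_aux hl hq)
        have hmult : ∀ i, (R.type l = .tensor ∨ R.type l = .par) →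
            (∀ q ∈ R.aux l, q ≠ R.left l →
              e (R.pri l) = Dom.pair i (e (R.left l)) (e q) ∧ ∃ α β : Dom A,
              E (R.left l) = {α} ∧ E q = {β} ∧ E (R.pri l) = {Dom.pair i α β}) →
            Multiset.Rel (SubstRel g) {e (R.pri l)} (E (R.pri l)) := by
          intro i ht hm
          obtain ⟨q, hq, hne, _⟩ := hlps.exists_aux_mult hl ht
          obtain ⟨h1, α, β, h2, h3, h4⟩ := hm q hq hne
          have hd : ∀ q ∈ R.aux l, copies k R.toGraph e q = {e q} := fun q hq =>
            copies_of_depth_zero (by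
              rw [hlps.depth_aux hl hq (by rcases ht with ht | ht <;> simp [ht])
                (by rcases ht with ht | ht <;> simp [ht]), h0])
          have hleft := hlps.left_mem l hl ht
          have ih1 := ih' _ hleft
          have ih2 := ih' _ hq
          rw [hd _ hleft, h2, rel_singleton] at ih1
          rw [hd _ hq, h3, rel_singleton] at ih2
          rw [h4, h1, rel_singleton, substRel_pair]
          exact ⟨α, β, ih1, ih2, rfl⟩
        cases ht : R.type l with
        | tensor => exact hmult .pos (Or.inl ht) fun q hq hne =>
            ⟨he.tensor l hl ht q hq hne, htensor l hl ht h0 q hq hne⟩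
        | par => exact hmult .neg (Or.inr ht) fun q hq hne =>
            ⟨he.par l hl ht q hq hne, hpar l hl ht h0 q hq hne⟩
        | one => rw [he.one l hl ht, hone l hl ht h0, rel_singleton]; rfl
        | bot => rw [he.bot l hl ht, hbot l hl ht h0, rel_singleton]; rfl
        | bang =>
          have hl' := Graph.mem_bangs.2 ⟨hl, ht⟩
          obtain ⟨q, hq, _, hep⟩ := hbang l hl' h0
          obtain ⟨hqin, a, hal, haq⟩ := h.wire_of_conclusion_box hl' hq hwire
          obtain ⟨a', ha'⟩ := hlps.exists_aux_bang hl'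
          rw [ha', Finset.mem_singleton] at hal
          subst hal
          have hal : a ∈ R.aux l := by simp [ha']
          rw [he.bang l hl ht, hep, rel_singleton, substRel_bag, ha', Finset.sum_singleton]
          refine ⟨_, ?_, rfl⟩
          rw [← hinside l hl' h0 q (inl_mem_ports.2 hqin), ← haq]
          have := ih' a hal
          rwa [copies, hlps.depth_aux_bang hl' hal, h0] at this
        | whynot =>
          rw [he.whynot l hl ht, hwhynot l hl ht h0, rel_singleton, substRel_bag]
          refine ⟨_, rel_add_sum _ fun q hq => ?_, rfl⟩
          have := ih' q hq
          rwa [copies, hlps.depth_aux_whynot hl ht hq, h0, zero_add] at this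
      · exact hwire' _ hw (fun hax =>
          (Graph.mem_axioms.1 hax).2.2 (Graph.pri_mem_priPorts hl))
          (ihp _ (hlps.below_of_wire_pri hl hw))
      · obtain ⟨c, hc⟩ := ha.exists_atom hq
        obtain ⟨α, β, hα, hβ, hαβ⟩ := hax p q hq h0 ((hlps.depth_eq p q hq).symm.trans h0)
        rw [copies_of_depth_zero h0, hα, hc, rel_singleton]
        -- `g` takes at this atom the label of `p`, or that of `q`, which is the dual one;
        -- `SubstRel` allows both.
        rcases hg2 p q hq h0 c hc with hg | hg
        · rw [hα] at hg
          exact Or.inl (Multiset.singleton_inj.1 hg)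
        · rw [hβ] at hg
          exact Or.inr (hαβ.trans (congrArg perp (Multiset.singleton_inj.1 hg)))
    · obtain ⟨v, hv, hv0, q, hq, hpq⟩ := h.exists_inBox hp h0
      rcases hpq with rfl | hpq
      · exact hin v hv hv0 q hq
      · exact hwire' q hpq.1 hpq.2 (hin v hv hv0 q hq)

end PreStr

end ProofStr

namespace ProofStr

open Dom

/-! ### Existence of injective atomic `k`-experiments. -/

section Existence

variable {A : Type u} {G : Graph.{v}}

open scoped Classical in
/-- The auxiliary port of a multiplicative cell that is not the left one. -/
noncomputable def right (G : Graph.{v}) (l : G.Cell) : G.Port :=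
  if h : ∃ q ∈ G.aux l, q ≠ G.left l then h.choose else G.left l

theorem right_mem (h : G.IsPorts) {l : G.Cell} (hl : l ∈ G.cells)
    (ht : G.type l = .tensor ∨ G.type l = .par) : right G l ∈ G.aux l := by
  rw [right]
  split_ifs with hq
  · exact hq.choose_spec.1
  · exact h.left_mem l hl ht

theorem eq_right (h : G.IsPorts) {l : G.Cell} (hl : l ∈ G.cells)
    (ht : G.type l = .tensor ∨ G.type l = .par) {q : G.Port} (hq : q ∈ G.aux l)
    (hne : q ≠ G.left l) : q = right G l := by
  have hex : ∃ q ∈ G.aux l, q ≠ G.left l := ⟨q, hq, hne⟩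
  obtain ⟨r, _, _, hr⟩ := h.exists_aux_mult hl ht
  rw [right, dif_pos hex, hr q hq hne, hr _ hex.choose_spec.1 hex.choose_spec.2]

/-- The label of the principal port of a cell, as a function of the labels of its auxiliary
ports. -/
noncomputable def cellLabel (k : ℕ) (G : Graph.{v}) (l : G.Cell)
    (e : G.Port → Dom (IAtom A)) : Dom (IAtom A) :=
  match G.type l with
  | .tensor => .pair .pos (e (G.left l)) (e (right G l))
  | .par => .pair .neg (e (G.left l)) (e (right G l))
  | .one => .unit .pos
  | .bot => .unit .neg
  | .bang => .bag .pos (∑ p ∈ G.aux l, digM k 1 {e p})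
  | .whynot => .bag .neg (∑ p ∈ G.aux l, digM k (G.num p) {e p})

theorem cellLabel_congr (h : G.IsPorts) {k : ℕ} {l : G.Cell} (hl : l ∈ G.cells)
    {e e' : G.Port → Dom (IAtom A)} (he : ∀ q ∈ G.aux l, e q = e' q) :
    cellLabel k G l e = cellLabel k G l e' := by
  rw [cellLabel, cellLabel]
  cases ht : G.type l with
  | tensor =>
    simp only
    rw [he _ (h.left_mem l hl (Or.inl ht)), he _ (right_mem h hl (Or.inl ht))]
  | par =>
    simp only
    rw [he _ (h.left_mem l hl (Or.inr ht)), he _ (right_mem h hl (Or.inr ht))]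
  | one => rfl
  | bot => rfl
  | bang =>
    simp only
    congr 1
    exact Finset.sum_congr rfl fun q hq => by rw [he q hq]
  | whynot =>
    simp only
    congr 1
    exact Finset.sum_congr rfl fun q hq => by rw [he q hq]

open scoped Classical in
/-- One step of the computation of the experiment that labels the axioms by `j`. -/
noncomputable def expStep (k : ℕ) (G : Graph.{v}) (j : Sym2 G.Port → A)
    (e : G.Port → Dom (IAtom A)) (p : G.Port) : Dom (IAtom A) :=
  if h : ∃ l ∈ G.cells, G.pri l = p then cellLabel k G h.choose e
  else if h : ∃ l ∈ G.cells, s(p, G.pri l) ∈ G.wires then e (G.pri h.choose)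
  else if h : ∃ q, s(p, q) ∈ G.wires then atom (toIAtom (j s(p, h.choose)))
  else .unit .pos

variable {k : ℕ} {j : Sym2 G.Port → A}

theorem expStep_pri (h : G.IsPorts) (e : G.Port → Dom (IAtom A)) {l : G.Cell}
    (hl : l ∈ G.cells) : expStep k G j e (G.pri l) = cellLabel k G l e := by
  have hex : ∃ l' ∈ G.cells, G.pri l' = G.pri l := ⟨l, hl, rfl⟩
  rw [expStep, dif_pos hex, h.pri_inj hex.choose_spec.1 hl hex.choose_spec.2]

theorem expStep_wire (h : G.IsPPLPS) (e : G.Port → Dom (IAtom A)) {p : G.Port} {l : G.Cell}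
    (hp : p ∉ G.priPorts) (hl : l ∈ G.cells) (hw : s(p, G.pri l) ∈ G.wires) :
    expStep k G j e p = e (G.pri l) := by
  have hex : ∃ l' ∈ G.cells, s(p, G.pri l') ∈ G.wires := ⟨l, hl, hw⟩
  have hp' : ¬ ∃ l ∈ G.cells, G.pri l = p := hp
  rw [expStep, dif_neg hp', dif_pos hex, h.wire_unique hex.choose_spec.2 hw]

theorem expStep_mem_axioms (h : G.IsPPLPS) (e : G.Port → Dom (IAtom A)) {p q : G.Port}
    (hpq : s(p, q) ∈ G.axioms) : expStep k G j e p = atom (toIAtom (j s(p, q))) := by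
  rw [Graph.mem_axioms] at hpq
  have hex : ∃ q, s(p, q) ∈ G.wires := ⟨q, hpq.1⟩
  have hp' : ¬ ∃ l ∈ G.cells, G.pri l = p := hpq.2.1
  rw [expStep, dif_neg hp', dif_neg, dif_pos hex, h.wire_unique hex.choose_spec hpq.1]
  rintro ⟨l, hl, hw⟩
  rw [h.wire_unique hpq.1 hw] at hpq
  exact hpq.2.2 (Graph.pri_mem_priPorts hl)

theorem expStep_congr (h : G.IsPPLPS) {p : G.Port} (hp : p ∈ G.ports)
    {e e' : G.Port → Dom (IAtom A)} (he : ∀ q, G.Below p q → e q = e' q) :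
    expStep k G j e p = expStep k G j e' p := by
  rcases h.cases_above hp with ⟨l, hl, rfl⟩ | ⟨hpri, l, hl, hw⟩ | ⟨q, hq⟩
  · rw [expStep_pri h.toIsPorts _ hl, expStep_pri h.toIsPorts _ hl]
    exact cellLabel_congr h.toIsPorts hl fun q hq => he q (Graph.below_aux hl hq)
  · rw [expStep_wire h _ hpri hl hw, expStep_wire h _ hpri hl hw]
    exact he _ (h.below_of_wire_pri hl hw)
  · rw [expStep_mem_axioms h _ hq, expStep_mem_axioms h _ hq]

/-- Iterate `expStep` from a constant labelling. The value at a port is stationary once those above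
it are, and there are finitely many ports, so some iterate is fixed on all of them. -/
theorem exists_expStep_eq (h : G.IsPLPS) (k : ℕ) (j : Sym2 G.Port → A) :
    ∃ e : G.Port → Dom (IAtom A), ∀ p ∈ G.ports, expStep k G j e p = e p := by
  classical
  let F : ℕ → G.Port → Dom (IAtom A) := fun n => (expStep k G j)^[n] fun _ => .unit .pos
  have hF : ∀ n, F (n + 1) = expStep k G j (F n) := fun n => Function.iterate_succ_apply' _ _ _
  have hev : ∀ p ∈ G.ports, ∀ᶠ n in Filter.atTop, F (n + 1) p = F n p := by
    refine h.ind_up fun p hp ih => ?_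
    have h1 : ∀ᶠ n in Filter.atTop, ∀ q ∈ G.ports.filter (fun q => G.Below p q),
        F (n + 1) q = F n q :=
      (Filter.eventually_all_finset _).2 fun q hq => ih q (Finset.mem_filter.1 hq).2
    rw [← Filter.map_add_atTop_eq_nat 1, Filter.eventually_map]
    filter_upwards [h1] with n hn
    rw [hF (n + 1), hF n]
    exact expStep_congr h.toIsPPLPS hp fun q hq => by
      rw [← hF]
      exact hn q (Finset.mem_filter.2 ⟨h.below_right hq, hq⟩)
  obtain ⟨n, hn⟩ := ((Filter.eventually_all_finset G.ports).2 hev).exists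
  exact ⟨F n, fun p hp => by rw [← hF]; exact hn p hp⟩

/-- Injective atomic `k`-experiments exist. -/
theorem exists_kExp [Infinite A] (h : G.IsPLPS) (k : ℕ) :
    ∃ e : G.Port → Dom (IAtom A), IsKExp k G e ∧ IsAtomicExp G e ∧ IsInjectiveExp G e := by
  classical
  -- Different axioms get different atoms: the finitely many unordered pairs of ports inject into
  -- the infinite set `A`.
  have hj : ∃ j : Sym2 G.Port → A, Set.InjOn j (G.ports.sym2 : Set (Sym2 G.Port)) := by
    refine ⟨fun w => if hw : w ∈ G.ports.sym2 then
      Infinite.natEmbedding A (G.ports.sym2.equivFin ⟨w, hw⟩) else Classical.arbitrary A, ?_⟩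
    intro w hw w' hw' he
    rw [Finset.mem_coe] at hw hw'
    simp only [dif_pos hw, dif_pos hw'] at he
    have := G.ports.sym2.equivFin.injective (Fin.ext ((Infinite.natEmbedding A).injective he))
    exact congrArg Subtype.val this
  obtain ⟨j, hj⟩ := hj
  obtain ⟨e, he⟩ := exists_expStep_eq h k j
  have hpri : ∀ l ∈ G.cells, e (G.pri l) = cellLabel k G l e := fun l hl => by
    rw [← expStep_pri h.toIsPorts e hl, he _ (h.pri_mem_ports hl)]
  have hax : ∀ p q, s(p, q) ∈ G.axioms → e p = atom (toIAtom (j s(p, q))) := fun p q hpq => by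
    rw [← expStep_mem_axioms h.toIsPPLPS e hpq, he _ (h.wire_left hpq.1)]
  have hwire : ∀ p q, G.Below p q → p ∉ G.priPorts → q ∈ G.priPorts → s(p, q) ∈ G.wires →
      e p = e q := by
    rintro p _ _ hp ⟨l, hl, rfl⟩ hw
    rw [← he p (h.wire_left hw), expStep_wire h.toIsPPLPS e hp hl hw]
  refine ⟨e, ⟨?_, ?_, ?_, ?_, ?_, ?_, ?_, ?_⟩, ?_, ?_⟩
  · intro l hl ht q hq hne
    rw [hpri l hl, cellLabel, ht, eq_right h.toIsPorts hl (Or.inl ht) hq hne]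
  · intro l hl ht q hq hne
    rw [hpri l hl, cellLabel, ht, eq_right h.toIsPorts hl (Or.inr ht) hq hne]
  · intro l hl ht
    rw [hpri l hl, cellLabel, ht]
  · intro l hl ht
    rw [hpri l hl, cellLabel, ht]
  · intro l hl ht
    rw [hpri l hl, cellLabel, ht]
  · intro l hl ht
    rw [hpri l hl, cellLabel, ht]
  · intro p q hpq
    rw [hax p q hpq, hax q p (Graph.axioms_swap hpq), Sym2.eq_swap]
    exact ⟨rfl, atom (j s(q, p)), rfl⟩
  · intro p q hw hna
    rcases h.wire_cases hw hna with ⟨h1, h2, h3⟩ | ⟨h1, h2, h3⟩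
    · exact hwire p q h1 h2 h3 hw
    · exact (hwire q p h1 h2 h3 (Graph.wires_swap hw)).symm
  · intro w hw p hp
    obtain ⟨q, rfl⟩ := Sym2.mem_iff_exists.1 hp
    exact ⟨_, hax p q hw⟩
  · intro w hw w' hw' p hp p' hp' hne
    obtain ⟨q, rfl⟩ := Sym2.mem_iff_exists.1 hp
    obtain ⟨q', rfl⟩ := Sym2.mem_iff_exists.1 hp'
    obtain ⟨x, hx, hx'⟩ := hne
    rw [hax p q hw] at hx
    rw [hax p' q' hw'] at hx'
    have h1 := Multiset.mem_singleton.1 hx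
    have h2 := Multiset.mem_singleton.1 hx'
    have h3 := congrArg Prod.fst (atom_injective (h1.symm.trans h2))
    exact hj (Finset.mem_sym2_iff.2 (h.wire_ports _ hw.1))
      (Finset.mem_sym2_iff.2 (h.wire_ports _ hw'.1)) h3

/-- Finite sequences of integers are countable, so indexing does not raise an infinite cardinality.
This lets a result over indexed atoms be read faithfully over `A`. -/
theorem exists_embedding [Infinite A] : Nonempty (IAtom A ↪ A) := by
  rw [← Cardinal.le_def, IAtom, Cardinal.mk_prod]
  have h1 : Cardinal.lift.{u} (Cardinal.mk (List ℕ)) = Cardinal.aleph0 := by simp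
  rw [h1, Cardinal.lift_id', Cardinal.mul_aleph0_eq (Cardinal.aleph0_le_mk A)]

end Existence

/-! ### Occurrences of atoms in points. -/

section Points

variable {B : Type u} {n : ℕ}

theorem mem_ptSub {r : Fin n → Dom B} {x : Dom B} : x ∈ ptSub r ↔ ∃ i, x ∈ (r i).sub := by
  simp [ptSub, Multiset.mem_sum]

theorem mem_sum_atm {r : Fin n → Dom B} {x : B} : x ∈ ∑ i, atm (r i) ↔ ∃ i, x ∈ atm (r i) := by
  simp [Multiset.mem_sum]

open scoped Classical in
theorem count_ptSub (r : Fin n → Dom B) (x : B) :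
    (ptSub r).count (atom x) = (∑ i, atm (r i)).count x := by
  rw [ptSub, Multiset.count_sum', Multiset.count_sum']
  exact Finset.sum_congr rfl fun i _ => count_atom_sub _ _

theorem isKPoint_iff {k : ℕ} {r : Fin n → Dom B} : IsKPoint k r ↔ ∀ i, Good k (r i) := by
  simp only [IsKPoint, mem_ptSub, good_iff]
  exact ⟨fun h i m hm => h m ⟨i, hm⟩, fun h m ⟨i, hm⟩ => h i m hm⟩

open scoped Classical in
theorem isInjectivePoint_iff {r : Fin n → Dom B} : IsInjectivePoint r ↔
    ∀ x, (∑ i, atm (r i)).count x = 0 ∨ (∑ i, atm (r i)).count x = 2 := by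
  refine forall_congr' fun x => ?_
  rw [← Multiset.count_eq_zero, count_ptSub]

theorem sum_atm_map {C : Type v} (f : B → C) (r : Fin n → Dom B) :
    ∑ i, atm (Dom.map f (r i)) = (∑ i, atm (r i)).map f := by
  rw [map_sum_finset]
  exact Finset.sum_congr rfl fun i _ => atm_map f _

-- Two different elements with one image would give it four occurrences.
open scoped Classical in
theorem injOn_of_count_map {C : Type v} {f : B → C} {m : Multiset B}
    (h1 : ∀ x ∈ m, m.count x = 2) (h2 : ∀ y, (m.map f).count y ≤ 2) :
    Set.InjOn f {x | x ∈ m} := by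
  intro x hx y hy he
  by_contra hne
  have hle : Multiset.replicate 2 x + Multiset.replicate 2 y ≤ m := by
    rw [Multiset.le_iff_count]
    intro z
    rw [Multiset.count_add, Multiset.count_replicate, Multiset.count_replicate]
    by_cases hxz : x = z
    · rw [if_pos hxz, if_neg fun hyz => hne (hxz.trans hyz.symm), ← hxz, h1 x hx]
    · rw [if_neg hxz, zero_add]
      split_ifs with hyz
      · rw [← hyz, h1 y hy]
      · exact Nat.zero_le _
  have h3 := Multiset.count_le_of_le (f x) (Multiset.map_le_map (f := f) hle)
  rw [Multiset.map_add, Multiset.map_replicate, Multiset.map_replicate, he, Multiset.count_add,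
    Multiset.count_replicate_self] at h3
  have := h2 (f y)
  omega

theorem exists_pequiv {C : Type v} {f : B → C} {s : Set B} (hf : Set.InjOn f s) :
    ∃ ρ : B ≃. C, ∀ x ∈ s, ρ x = some (f x) := by
  classical
  refine ⟨⟨fun x => if x ∈ s then some (f x) else none,
    fun y => if h : ∃ x ∈ s, f x = y then some h.choose else none, fun x y => ?_⟩,
    fun x hx => if_pos hx⟩
  constructor
  · intro hx
    split_ifs at hx with h
    · obtain rfl := Option.mem_some_iff.1 hx
      rw [if_pos h.choose_spec.1, h.choose_spec.2]
  · intro hy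
    split_ifs at hy with h
    · obtain rfl := Option.mem_some_iff.1 hy
      have hex : ∃ x' ∈ s, f x' = f x := ⟨x, h, rfl⟩
      rw [dif_pos hex, hf hex.choose_spec.1 h hex.choose_spec.2]

end Points

/-! ### The two inclusions. -/

namespace PreStr

variable {A : Type u} {R : PreStr.{v}} {k n : ℕ} {ind : R.conclusions ≃ Fin n}

theorem IsPS.map_result_mem_interp (h : R.IsPS) {e : R.Port → Dom (IAtom A)}
    (he : IsKExp k R.toGraph e) (ha : IsAtomicExp R.toGraph e) (g : IAtom A → A) :
    (fun i => Dom.map g (kResult R.toGraph ind e i)) ∈ R.interp A ind := by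
  refine ⟨_, h.isExp_copies he ha g, fun i => ?_⟩
  rw [copies_of_depth_zero (h.lps.depth_conclusion (ind.symm i).2), Multiset.map_singleton]
  rfl

theorem IsPS.exists_subst_result (h : R.IsPS) {e : R.Port → Dom (IAtom A)}
    (he : IsKExp k R.toGraph e) (ha : IsAtomicExp R.toGraph e) (hi : IsInjectiveExp R.toGraph e)
    {r : Fin n → Dom A} (hr : r ∈ R.interp A ind) (hk : ∀ i, Good k (r i)) :
    ∃ g : IAtom A → Dom A, ∀ i, SubstRel g (kResult R.toGraph ind e i) (r i) := by
  obtain ⟨E, hE, hEr⟩ := hr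
  have hc : ∀ p ∈ R.conclusions, ∀ x ∈ E p, Good k x := by
    intro p hp x hx
    have := hEr (ind ⟨p, hp⟩)
    rw [Equiv.symm_apply_apply] at this
    rw [this, Multiset.mem_singleton] at hx
    exact hx ▸ hk _
  obtain ⟨g, hg⟩ := h.exists_subst he ha hi hE (h.good_ports hE hc)
  refine ⟨g, fun i => ?_⟩
  have := hg _ (ind.symm i).2.1
  rwa [copies_of_depth_zero (h.lps.depth_conclusion (ind.symm i).2), hEr i,
    rel_singleton] at this

theorem IsPS.exists_renaming [Infinite A] (h : R.IsPS) {r₀ : Fin n → Dom A}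
    (hr : r₀ ∈ atomicPart (R.interp A ind)) (hinj : IsInjectivePoint r₀) (hk : IsKPoint k r₀) :
    ∃ e : R.Port → Dom (IAtom A), (IsKExp k R.toGraph e ∧ IsAtomicExp R.toGraph e ∧
      IsInjectiveExp R.toGraph e) ∧ ∃ ρ, IsRenaming ρ (kResult R.toGraph ind e) r₀ := by
  classical
  obtain ⟨e, he, ha, hi⟩ := exists_kExp (A := A) h.lps.toIsPLPS k
  refine ⟨e, ⟨he, ha, hi⟩, ?_⟩
  obtain ⟨g, hg⟩ := h.exists_subst_result he ha hi hr.1 (isKPoint_iff.1 hk)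
  obtain ⟨φ⟩ := exists_embedding (A := A)
  have hatom : ∀ x ∈ ∑ i, atm (kResult R.toGraph ind e i), ∃ a, g x = atom a := by
    intro x hx
    -- The result embedded by `φ` is in the interpretation, and `r₀` is its instance under `g`
    -- transported along `φ`. Atomicity of `r₀` then forces `g` to have atomic values at the atoms
    -- of the result.
    have := hr.2 _ (h.map_result_mem_interp (ind := ind) he ha φ)
      (Function.extend φ g fun _ => .unit .pos)
      (fun i => (substRel_map (fun c _ => (φ.injective.extend_apply g _ c).symm) (hg i)).inst)
      (φ x) (by
        obtain ⟨i, hx⟩ := mem_sum_atm.1 hx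
        refine mem_ptSub.2 ⟨i, atom_mem_sub.2 ?_⟩
        rw [atm_map]
        exact Multiset.mem_map_of_mem φ hx)
    rwa [φ.injective.extend_apply] at this
  have hg' : ∀ x, ∃ a : A, x ∈ ∑ i, atm (kResult R.toGraph ind e i) → g x = atom a := by
    intro x
    by_cases hx : x ∈ ∑ i, atm (kResult R.toGraph ind e i)
    · obtain ⟨a, ha⟩ := hatom x hx
      exact ⟨a, fun _ => ha⟩
    · exact ⟨Classical.arbitrary A, fun hx' => absurd hx' hx⟩
  choose g' hg' using hg'
  have hr₀ : ∀ i, r₀ i = Dom.map g' (kResult R.toGraph ind e i) := fun i =>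
    (hg i).eq_map fun c hc => hg' c (mem_sum_atm.2 ⟨i, hc⟩)
  have hinj' : Set.InjOn g' {x | x ∈ ∑ i, atm (kResult R.toGraph ind e i)} := by
    -- Every atom of the result occurs twice in it, and the injective point `r₀` leaves no room for
    -- more than two occurrences of an image.
    refine injOn_of_count_map (fun x hx => ?_) fun y => ?_
    · rcases he.count_result ha hi h.lps ind x with h0 | h2
      · exact absurd hx (Multiset.count_eq_zero.1 h0)
      · convert h2
    · rw [← sum_atm_map]
      simp only [← hr₀]
      rcases isInjectivePoint_iff.1 hinj y with h0 | h2 <;> omega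
  obtain ⟨ρ, hρ⟩ := exists_pequiv hinj'
  refine ⟨ρ, fun i => ?_⟩
  rw [hr₀ i, Dom.map_map]
  exact Dom.map_congr fun x hx => hρ x (mem_sum_atm.2 ⟨i, hx⟩)

theorem IsPS.of_renaming [Infinite A] (h : R.IsPS) {r₀ : Fin n → Dom A}
    {e : R.Port → Dom (IAtom A)} (he : IsKExp k R.toGraph e) (ha : IsAtomicExp R.toGraph e)
    (hi : IsInjectiveExp R.toGraph e) {ρ : IAtom A ≃. A}
    (hρ : IsRenaming ρ (kResult R.toGraph ind e) r₀) :
    r₀ ∈ atomicPart (R.interp A ind) ∧ IsInjectivePoint r₀ ∧ IsKPoint k r₀ := by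
  classical
  -- A total extension of `ρ`; its default value is never met, as `ρ` is defined on the atoms of the
  -- result.
  let g : IAtom A → A := fun x => (ρ x).getD (Classical.arbitrary A)
  have hr₀ : r₀ = fun i => Dom.map g (kResult R.toGraph ind e i) := by
    funext i
    have := congrArg (Dom.map fun o : Option A => o.getD (Classical.arbitrary A)) (hρ i)
    rw [Dom.map_map, Dom.map_map] at this
    exact ((this.trans (Dom.map_id (r₀ i)))).symm
  have hg : ∀ x ∈ ∑ i, atm (kResult R.toGraph ind e i), ρ x = some (g x) := by
    intro x hx
    obtain ⟨i, hx⟩ := mem_sum_atm.1 hx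
    have h1 : ρ x ∈ atm (Dom.map ρ (kResult R.toGraph ind e i)) := by
      rw [atm_map]
      exact Multiset.mem_map_of_mem _ hx
    rw [hρ i, atm_map, Multiset.mem_map] at h1
    obtain ⟨a, _, ha⟩ := h1
    simp only [g, ← ha, Option.getD_some]
  have hinj : Set.InjOn g {x | x ∈ ∑ i, atm (kResult R.toGraph ind e i)} := by
    intro x hx y hy hxy
    refine ρ.inj (b := g x) (hg x hx) ?_
    rw [hxy]
    exact hg y hy
  have hgood : ∀ i, Good k (kResult R.toGraph ind e i) := fun i =>
    he.good ha h.lps.toIsPLPS _ (ind.symm i).2.1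
  have hgood₀ : ∀ i, Good k (r₀ i) := fun i => by
    rw [hr₀]
    exact good_map.2 (hgood i)
  refine ⟨⟨hr₀ ▸ h.map_result_mem_interp he ha g, ?_⟩, ?_, isKPoint_iff.2 hgood₀⟩
  · intro r' hr' s hs c hc
    have hsub : ∀ i, SubstRel s (r' i) (r₀ i) := fun i => (hs i).substRel
    -- By genericity `r'` is an instance of the result of the same `e`, so `r₀` is reached from that
    -- result by `g'` followed by `s`.
    obtain ⟨g', hg'⟩ := h.exists_subst_result he ha hi hr' fun i => (hsub i).good (hgood₀ i)
    obtain ⟨i, hc⟩ := mem_ptSub.1 hc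
    obtain ⟨x, hx, hcx⟩ := (hg' i).mem_atm (atom_mem_sub.1 hc)
    have hone : ∀ a, 1 ≤ wt (fun _ => 1) (s a) := fun a => one_le_wt (fun _ => le_rfl) _
    -- The left side is the weight of `r₀` computed through the two substitutions. It equals the
    -- weight of the result because `r₀` is also a renaming of it.
    have hwt : wt (fun x => wt (fun c => wt (fun _ => 1) (s c)) (g' x))
        (kResult R.toGraph ind e i) = wt (fun _ => 1) (kResult R.toGraph ind e i) := by
      rw [← (hg' i).wt_eq, ← (hsub i).wt_eq, hr₀]
      exact wt_map _ _ _
    -- The composite has weight `1` at `x`, so `g' x` is an atom, necessarily `c`; what remains says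
    -- that `s c` has weight `1`.
    have h1 := eq_one_of_wt_eq (fun x => one_le_wt hone (g' x)) hwt x hx
    obtain ⟨a, ha'⟩ := exists_atom_of_wt_eq_one h1
    simp only [ha', atm_atom, Multiset.mem_singleton] at hcx
    simp only [ha', wt_atom] at h1
    subst hcx
    exact exists_atom_of_wt_eq_one h1
  · rw [isInjectivePoint_iff]
    intro y
    rw [hr₀, sum_atm_map]
    by_cases hy : y ∈ (∑ i, atm (kResult R.toGraph ind e i)).map g
    · obtain ⟨x, hx, rfl⟩ := Multiset.mem_map.1 hy
      rw [Multiset.count_map_eq_count g _ hinj x hx]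
      exact he.count_result ha hi h.lps ind x
    · exact Or.inl (Multiset.count_eq_zero.2 hy)

end PreStr

end ProofStr

theorem mainTheorem6 {A : Type u} [Infinite A] (k : ℕ) (R : ProofStr.PreStr.{v})
    (hR : R.IsPS) {n : ℕ} (ind : R.conclusions ≃ Fin n) :
    {r₀ : Fin n → ProofStr.Dom A | r₀ ∈ ProofStr.atomicPart (R.interp A ind) ∧
        ProofStr.IsInjectivePoint r₀ ∧ ProofStr.IsKPoint k r₀} =
      ⋃ e ∈ {e : R.Port → ProofStr.Dom (ProofStr.IAtom A) |
          ProofStr.IsKExp k R.toGraph e ∧ ProofStr.IsAtomicExp R.toGraph e ∧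
            ProofStr.IsInjectiveExp R.toGraph e},
        {r₀ : Fin n → ProofStr.Dom A | ∃ ρ : ProofStr.IAtom A ≃. A,
          ProofStr.IsRenaming ρ (ProofStr.kResult R.toGraph ind e) r₀} := by
  ext r₀
  simp only [Set.mem_iUnion, Set.mem_ofPred_eq, exists_prop]
  constructor
  · rintro ⟨hr, hinj, hk⟩
    exact hR.exists_renaming hr hinj hk
  · rintro ⟨e, ⟨he, ha, hi⟩, ρ, hρ⟩
    exact hR.of_renaming he ha hi hρ
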